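/- Let $G$ be a compact Lie group (realised, as is always possible, as a closed subgroup of some $U(N)$), let $K\le H\le G$ be closed subgroups with Lie algebras $\mathfrak k\subset\mathfrak h\subset\mathfrak g$, and assume that $G/K$ and $H/K$ are connected. Let $Q$ be an $\mathrm{Ad}(G)$-invariant scalar product on $\mathfrak g$ and let $\mathfrak p=\mathfrak k^{\perp}\cong T_{eK}(G/K)$ be the isotropy representation. Assume that $\mathfrak p=\mathfrak p_1\oplus\mathfrak p_2$, where $\mathfrak p_1,\mathfrak p_2$ are irreducible, inequivalent (real) $\mathrm{Ad}(K)$-modules, that $\mathfrak h=\mathfrak k\oplus\mathfrak p_1$, and that the structure constant $[122]=\sum Q([e_\alpha,e_\beta],e_\gamma)^2$ (sum over $Q$-orthonormal bases $(e_\alpha)$ of $\mathfrak p_1$ and $(e_\beta)$, $(e_\gamma)$ of $\mathfrak p_2$) is positive. A $G$-invariant Riemannian metric on $G/K$ is an $\mathrm{Ad}(K)$-invariant scalar product on $\mathfrak p$; the homogeneous Ricci flow is the equation $\partial_t g(t)=-2\,\mathrm{Ric}(g(t))$ for families of $G$-invariant metrics, and an ancient solution is a solution on an interval $(-\infty,T)$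 with $T<\infty$. Suppose that $G/K$ does not carry any $G$-invariant Einstein metric. Then: 1. The homogeneous Ricci flow on $G/K$ has no ancient solution; in particular, no homogeneous Ricci flow starting at a $G$-invariant metric extends to an ancient solution. 2. For every $G$-invariant metric $g_0$ on $G/K$ there is a unique maximal solution $g(t)$, $t\in[0,T)$, of the homogeneous Ricci flow with $g(0)=g_0$, and $0<T<\infty$. As $t\to T$, the fibre $H/K$ of $H/K\to G/K\to G/H$ shrinks to a point (the metric $g(t)|_{\mathfrak p_1}$ induced on $H/K$ and its diameter tend to $0$), the restrictions $g(t)|_{\mathfrak p_2}$ converge to a $G$-invariant Riemannian metric $\bar g$ on $G/H$, and $(G/K,g(t))$ converges to $(G/H,\bar g)$ in the Hausdorff-Gromov sense. Moreover, the following is an example. Let $G=SU(4)$, $H=Sp(2)$ and $K=SU(2)$, embedded by the irreducible representation of $SU(2)$ on $S^3\mathbb C^2=\mathbb C^4$, and let $Q$ be the negative of the Killing form. Then all of the above assumptions hold (for suitable $\mathfrak p_1,\mathfrak p_2$), $SU(4)/SU(2)$ carries no $SU(4)$-invariant Einstein metric, and hence 1 and 2 hold for it. -/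

import Mathlib

open Set Filter Topology Matrix
open scoped ContDiff

namespace HRF

/-! ## Compact Lie groups and their Lie algebras

A compact Lie group is a closed subgroup `G` of some unitary group `U(N)`.  Lie algebras are real
subspaces of the space of complex `N × N` matrices; the bracket is the commutator. -/

/-- Complex `N × N` matrices. -/
abbrev Mat (N : ℕ) : Type := Matrix (Fin N) (Fin N) ℂ

/-- The unitary group `U(N)`. -/
abbrev U (N : ℕ) : Type := Matrix.unitaryGroup (Fin N) ℂ

/-- A matrix-valued curve is `n` times continuously differentiable if its entries are. -/
def IsContDiff {N : ℕ} (n : WithTop ℕ∞) (c : ℝ → Mat N) : Prop :=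
  ∀ i j, ContDiff ℝ n (fun t => c t i j)

/-- The velocity of a matrix-valued curve. -/
noncomputable def velocity {N : ℕ} (c : ℝ → Mat N) (t : ℝ) : Mat N :=
  Matrix.of fun i j => deriv (fun s => c s i j) t

theorem IsContDiff.hasDerivAt {N : ℕ} {c : ℝ → Mat N} (hc : IsContDiff ∞ c) (t : ℝ)
    (i j : Fin N) : HasDerivAt (fun s => c s i j) (velocity c t i j) t :=
  ((hc i j).differentiable (by simp)).differentiableAt.hasDerivAt

/-- The Lie algebra of `G`: velocities at time `0` of smooth curves in `G` through the identity. -/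
def lieAlg {N : ℕ} (G : Subgroup (U N)) : Submodule ℝ (Mat N) where
  carrier := {X | ∃ γ : ℝ → U N, (∀ t, γ t ∈ G) ∧ IsContDiff ∞ (fun t => (γ t : Mat N)) ∧
    γ 0 = 1 ∧ velocity (fun t => (γ t : Mat N)) 0 = X}
  zero_mem' := ⟨fun _ => 1, fun _ => G.one_mem, fun _ _ => contDiff_const, rfl, by
    ext i j; simp [velocity]⟩
  add_mem' := by
    rintro X Y ⟨γ, hγ, hs, h0, rfl⟩ ⟨δ, hδ, hs', h0', rfl⟩
    refine ⟨fun t => γ t * δ t, fun t => G.mul_mem (hγ t) (hδ t), fun i j => ?_,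
      by simp [h0, h0'], ?_⟩
    · simp only [Submonoid.coe_mul, Matrix.mul_apply]
      exact ContDiff.sum fun k _ => (hs i k).mul (hs' k j)
    · ext i j
      have h : HasDerivAt (fun t => ∑ k, (γ t : Mat N) i k * (δ t : Mat N) k j)
          (∑ k, (velocity (fun t => (γ t : Mat N)) 0 i k * (δ 0 : Mat N) k j +
            (γ 0 : Mat N) i k * velocity (fun t => (δ t : Mat N)) 0 k j)) 0 :=
        HasDerivAt.fun_sum fun k _ => (hs.hasDerivAt 0 i k).mul (hs'.hasDerivAt 0 k j)
      have e : (fun t => ((γ t * δ t : U N) : Mat N) i j) =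
          fun t => ∑ k, (γ t : Mat N) i k * (δ t : Mat N) k j := by
        funext t; simp [Matrix.mul_apply]
      rw [velocity, Matrix.of_apply, e, h.deriv, h0, h0', Finset.sum_add_distrib]
      simp [Matrix.one_apply]
  smul_mem' := by
    rintro c X ⟨γ, hγ, hs, h0, rfl⟩
    refine ⟨fun t => γ (c * t), fun t => hγ _,
      fun i j => (hs i j).comp (contDiff_const.mul contDiff_id), by simp [h0], ?_⟩
    ext i j
    have h1 : HasDerivAt (fun t : ℝ => c * t) c 0 := by
      simpa using (hasDerivAt_id (0 : ℝ)).const_mul c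
    have h2 : HasDerivAt (fun t => (γ t : Mat N) i j) (velocity (fun t => (γ t : Mat N)) 0 i j)
        (c * 0) := by simpa using hs.hasDerivAt 0 i j
    exact (h2.scomp (0 : ℝ) h1).deriv

/-- The Lie bracket. -/
def comm {N : ℕ} (X Y : Mat N) : Mat N := X * Y - Y * X

/-- The adjoint action `X ↦ u X u⁻¹`. -/
def Ad {N : ℕ} (u : U N) (X : Mat N) : Mat N := (u : Mat N) * X * star (u : Mat N)

/-- `Q` restricts to an `Ad(G)`-invariant scalar product on the Lie algebra of `G`. -/
structure IsBackground {N : ℕ} (G : Subgroup (U N)) (Q : LinearMap.BilinForm ℝ (Mat N)) :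
    Prop where
  symm : ∀ X ∈ lieAlg G, ∀ Y ∈ lieAlg G, Q X Y = Q Y X
  pos : ∀ X ∈ lieAlg G, X ≠ 0 → 0 < Q X X
  inv : ∀ u ∈ G, ∀ X ∈ lieAlg G, ∀ Y ∈ lieAlg G, Q (Ad u X) (Ad u Y) = Q X Y

/-- The isotropy representation `𝔭`: the `Q`-orthogonal complement of `𝔨` in `𝔤`, identified with
the tangent space of `G/K` at the base point. -/
noncomputable def isotropy {N : ℕ} (Q : LinearMap.BilinForm ℝ (Mat N)) (G K : Subgroup (U N)) :
    Submodule ℝ (Mat N) :=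
  lieAlg G ⊓ Q.orthogonal (lieAlg K)

/-- `W` is stable under `Ad(K)`. -/
def IsAdInvariant {N : ℕ} (K : Subgroup (U N)) (W : Submodule ℝ (Mat N)) : Prop :=
  ∀ u ∈ K, ∀ X ∈ W, Ad u X ∈ W

/-- `W` is a (real) irreducible `Ad(K)`-module. -/
def IsAdIrreducible {N : ℕ} (K : Subgroup (U N)) (W : Submodule ℝ (Mat N)) : Prop :=
  IsAdInvariant K W ∧ W ≠ ⊥ ∧
    ∀ W' : Submodule ℝ (Mat N), W' ≤ W → IsAdInvariant K W' → W' = ⊥ ∨ W' = W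

/-- `W₁` and `W₂` are equivalent `Ad(K)`-modules. -/
def AdEquivalent {N : ℕ} (K : Subgroup (U N)) (W₁ W₂ : Submodule ℝ (Mat N)) : Prop :=
  ∃ φ : W₁ ≃ₗ[ℝ] W₂, ∀ u ∈ K, ∀ X Y : W₁,
    (Y : Mat N) = Ad u (X : Mat N) → ((φ Y : W₂) : Mat N) = Ad u (φ X : Mat N)

/-! ## The projection of `𝔨 ⊕ 𝔭` onto `𝔭` -/

theorem exists_proj {N : ℕ} (k p : Submodule ℝ (Mat N)) (h : Disjoint k p) :
    ∃ π : Mat N →ₗ[ℝ] p, (∀ X : p, π X = X) ∧ ∀ Y ∈ k, π Y = 0 := by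
  obtain ⟨W, hkW, hW⟩ := h.exists_isCompl
  refine ⟨p.projectionOnto W hW.symm, fun X => ?_, fun Y hY => ?_⟩
  · simp
  · simpa using hkW hY

open Classical in
/-- A linear map that on `k ⊕ p` is the projection onto `p` along `k` (its values off `k ⊕ p` are
never used). -/
noncomputable def proj {N : ℕ} (k p : Submodule ℝ (Mat N)) : Mat N →ₗ[ℝ] p :=
  if h : Disjoint k p then Classical.choose (exists_proj k p h) else 0

theorem proj_apply_right {N : ℕ} {k p : Submodule ℝ (Mat N)} (h : Disjoint k p) (X : p) :
    proj k p X = X := by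
  rw [proj, dif_pos h]
  exact (Classical.choose_spec (exists_proj k p h)).1 X

theorem proj_apply_left {N : ℕ} {k p : Submodule ℝ (Mat N)} (h : Disjoint k p) {Y : Mat N}
    (hY : Y ∈ k) : proj k p Y = 0 := by
  rw [proj, dif_pos h]
  exact (Classical.choose_spec (exists_proj k p h)).2 Y hY

/-! ## Invariant metrics, their Levi-Civita connection and their Ricci tensor -/

/-- `g` is an `Ad(K)`-invariant scalar product on `p`, that is, a `G`-invariant Riemannian metric
on the homogeneous space `G/K` whose tangent space at the base point is `p`. -/
structure IsInvariantMetric {N : ℕ} (K : Subgroup (U N)) (p : Submodule ℝ (Mat N))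
    (g : LinearMap.BilinForm ℝ p) : Prop where
  symm : ∀ X Y : p, g X Y = g Y X
  pos : ∀ X : p, X ≠ 0 → 0 < g X X
  inv : ∀ u ∈ K, ∀ X Y X' Y' : p, (X' : Mat N) = Ad u X → (Y' : Mat N) = Ad u Y →
    g X' Y' = g X Y

/-- `Λ` is the Levi-Civita connection of the invariant metric `g`.  Invariant connections on the
reductive space `G/K` are bilinear maps `(X, Y) ↦ Λ X Y = ∇_X Y` on `p`; the two conditions say
that `∇ g = 0` and that the torsion `Λ X Y - Λ Y X - [X, Y]_p` vanishes. -/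
structure IsLeviCivita {N : ℕ} (k p : Submodule ℝ (Mat N)) (g : LinearMap.BilinForm ℝ p)
    (Λ : p →ₗ[ℝ] p →ₗ[ℝ] p) : Prop where
  metric : ∀ X Y Z : p, g (Λ X Y) Z + g Y (Λ X Z) = 0
  torsion_free : ∀ X Y : p, Λ X Y - Λ Y X = proj k p (comm X Y)

/-- For fixed `Y`, `Z`, the linear map `X ↦ R(X, Y) Z`, where
`R(X, Y) Z = Λ X (Λ Y Z) - Λ Y (Λ X Z) - Λ [X, Y]_p Z - [[X, Y]_k, Z]` is the curvature tensor of
the invariant connection `Λ` and `[X, Y]_k = [X, Y] - [X, Y]_p`. -/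
noncomputable def curvature {N : ℕ} (k p : Submodule ℝ (Mat N)) (Λ : p →ₗ[ℝ] p →ₗ[ℝ] p)
    (Y Z : p) : p →ₗ[ℝ] p where
  toFun X := Λ X (Λ Y Z) - Λ Y (Λ X Z) - Λ (proj k p (comm X Y)) Z
    - proj k p (comm (comm X Y - (proj k p (comm X Y) : Mat N)) Z)
  map_add' X X' := by
    have e : comm ((X : Mat N) + (X' : Mat N)) Y = comm X Y + comm X' Y := by
      simp only [comm]; noncomm_ring
    have e' : ∀ A B C D : Mat N, comm (A + B - (C + D)) (Z : Mat N) =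
        comm (A - C) Z + comm (B - D) Z := by
      intro A B C D; simp only [comm]; noncomm_ring
    simp only [e, map_add, LinearMap.add_apply, Submodule.coe_add, e']
    abel
  map_smul' c X := by
    have e : comm (c • (X : Mat N)) Y = c • comm X Y := by
      simp only [comm, smul_mul_assoc, mul_smul_comm, smul_sub]
    have e' : ∀ A B : Mat N, comm (c • A - c • B) (Z : Mat N) = c • comm (A - B) Z := by
      intro A B
      simp only [comm, ← smul_sub, smul_mul_assoc, mul_smul_comm]
    simp only [e, map_smul, LinearMap.smul_apply, Submodule.coe_smul, e', smul_sub,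
      RingHom.id_apply]

/-- The Ricci tensor `Ric(Y, Z) = tr (X ↦ R(X, Y) Z)`. -/
noncomputable def ricci {N : ℕ} (k p : Submodule ℝ (Mat N)) (Λ : p →ₗ[ℝ] p →ₗ[ℝ] p)
    (Y Z : p) : ℝ :=
  LinearMap.trace ℝ p (curvature k p Λ Y Z)

/-- `g` is a `G`-invariant Einstein metric on `G/K`. -/
def IsEinstein {N : ℕ} (K : Subgroup (U N)) (p : Submodule ℝ (Mat N))
    (g : LinearMap.BilinForm ℝ p) : Prop :=
  IsInvariantMetric K p g ∧ ∃ Λ, IsLeviCivita (lieAlg K) p g Λ ∧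
    ∃ c : ℝ, ∀ X Y : p, ricci (lieAlg K) p Λ X Y = c * g X Y

/-- The family `g` of `G`-invariant metrics on `G/K` solves the Ricci flow equation
`∂g/∂t = -2 Ric(g)` on the time interval `I`. -/
def IsRicciFlowOn {N : ℕ} (K : Subgroup (U N)) (p : Submodule ℝ (Mat N))
    (g : ℝ → LinearMap.BilinForm ℝ p) (I : Set ℝ) : Prop :=
  ∀ t ∈ I, IsInvariantMetric K p (g t) ∧ ∃ Λ, IsLeviCivita (lieAlg K) p (g t) Λ ∧
    ∀ X Y : p, HasDerivWithinAt (fun s => g s X Y) (-2 * ricci (lieAlg K) p Λ X Y) I t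

/-! ## Distances and Gromov-Hausdorff convergence -/

/-- The coset space `G/L`, for `L ≤ G`. -/
abbrev CosetSpace {N : ℕ} (G L : Subgroup (U N)) : Type := G ⧸ L.subgroupOf G

/-- The length of the projection to `G/L` of a curve `γ : [0, 1] → G`, for the invariant metric on
`G/L` given by the scalar product `g` on `q ≃ 𝔤/𝔩`: the integral over `[0, 1]` of the `g`-norm of
the `q`-component of `γ⁻¹ γ'`. -/
noncomputable def curveLength {N : ℕ} {G : Subgroup (U N)} (L : Subgroup (U N))
    (q : Submodule ℝ (Mat N)) (g : LinearMap.BilinForm ℝ q) (γ : ℝ → G) : ℝ :=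
  ∫ t in (0 : ℝ)..1,
    let v : q := proj (lieAlg L) q
      (star ((γ t : U N) : Mat N) * velocity (fun s => ((γ s : U N) : Mat N)) t)
    Real.sqrt (g v v)

/-- The Riemannian distance on `G/L` of the invariant metric given by the scalar product `g` on
`q ≃ 𝔤/𝔩`.  As every curve in `G/L` lifts to `G`, it is the infimum of the lengths of the
projections of the `C¹` curves in `G` that join the two cosets. -/
noncomputable def rdist {N : ℕ} (G L : Subgroup (U N)) (q : Submodule ℝ (Mat N))
    (g : LinearMap.BilinForm ℝ q) (x y : CosetSpace G L) : ℝ :=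
  sInf {r : ℝ | ∃ γ : ℝ → G, IsContDiff 1 (fun t => ((γ t : U N) : Mat N)) ∧
    (QuotientGroup.mk (γ 0) : CosetSpace G L) = x ∧
    (QuotientGroup.mk (γ 1) : CosetSpace G L) = y ∧ r = curveLength L q g γ}

/-- `S` is an `ε`-approximation between `(A, dA)` and `(B, dB)`. -/
def IsApproximation {A B : Type*} (dA : A → A → ℝ) (dB : B → B → ℝ) (ε : ℝ) (S : Set (A × B)) :
    Prop :=
  (∀ a, ∃ b, (a, b) ∈ S) ∧ (∀ b, ∃ a, (a, b) ∈ S) ∧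
    ∀ z ∈ S, ∀ w ∈ S, |dA z.1 w.1 - dB z.2 w.2| < ε

/-- The Hausdorff-Gromov distance: the infimum of the `ε` for which there is an
`ε`-approximation, and `∞` if there is none. -/
noncomputable def dHG {A B : Type*} (dA : A → A → ℝ) (dB : B → B → ℝ) : ENNReal :=
  ⨅ ε : ℝ, ⨅ _ : ∃ S, IsApproximation dA dB ε S, ENNReal.ofReal ε

/-! ## Two inequivalent isotropy summands and non-maximal isotropy group -/

/-- `G/K` is a compact connected homogeneous space with isotropy representation `p₁ ⊕ p₂`, the
summands being irreducible and inequivalent, and `H` is an intermediate Lie group with Lie algebra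
`𝔨 ⊕ p₁` and with connected fibre `H/K`. The last field says that the structure constant
`[122] = ∑ Q([e_α, e_β], e_γ) ^ 2` (sum over `Q`-orthonormal bases of `p₁`, `p₂`, `p₂`) is
positive. -/
structure NonMaximalTwoSummand {N : ℕ} (G H K : Subgroup (U N))
    (Q : LinearMap.BilinForm ℝ (Mat N)) (p₁ p₂ : Submodule ℝ (Mat N)) : Prop where
  closed_G : IsClosed (G : Set (U N))
  closed_H : IsClosed (H : Set (U N))
  closed_K : IsClosed (K : Set (U N))
  K_le_H : K ≤ H
  H_le_G : H ≤ G
  connected_total : ConnectedSpace (CosetSpace G K)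
  connected_fibre : ConnectedSpace (CosetSpace H K)
  background : IsBackground G Q
  disjoint : Disjoint p₁ p₂
  sum : p₁ ⊔ p₂ = isotropy Q G K
  irreducible₁ : IsAdIrreducible K p₁
  irreducible₂ : IsAdIrreducible K p₂
  inequivalent : ¬ AdEquivalent K p₁ p₂
  lieAlg_H : lieAlg H = lieAlg K ⊔ p₁
  structureConstant_pos : ∃ X ∈ p₁, ∃ Y ∈ p₂, ∃ Z ∈ p₂, Q (comm X Y) Z ≠ 0

/-- The restriction of a bilinear form to a smaller subspace. -/
noncomputable def restrictForm {N : ℕ} {p q : Submodule ℝ (Mat N)} (h : q ≤ p) (g : LinearMap.BilinForm ℝ p) :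
    LinearMap.BilinForm ℝ q :=
  g.compl₁₂ (Submodule.inclusion h) (Submodule.inclusion h)

/-- As `t → T` from below, the fibre `H/K` of `H/K → G/K → G/H` shrinks to a point with respect to
the metrics `g t` on `G/K`: the metric induced on the fibre tends to zero, and so does its
diameter. -/
def FibreShrinks {N : ℕ} (H K : Subgroup (U N)) {p p₁ : Submodule ℝ (Mat N)} (h₁ : p₁ ≤ p)
    (g : ℝ → LinearMap.BilinForm ℝ p) (T : ℝ) : Prop :=
  (∀ X Y : p₁, Tendsto (fun t => restrictForm h₁ (g t) X Y) (𝓝[<] T) (𝓝 0)) ∧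
  ∀ ε > 0, ∀ᶠ t in 𝓝[<] T, ∀ x y : CosetSpace H K,
    rdist H K p₁ (restrictForm h₁ (g t)) x y < ε

/-- As `t → T` from below, the metrics `g t` on `G/K` restricted to the horizontal space `p₂`
converge to a `G`-invariant Riemannian metric on `G/H`, and `G/K` converges in the
Hausdorff-Gromov sense to `G/H` with this metric. -/
def ConvergesToBase {N : ℕ} (G H K : Subgroup (U N)) {p p₂ : Submodule ℝ (Mat N)} (h₂ : p₂ ≤ p)
    (g : ℝ → LinearMap.BilinForm ℝ p) (T : ℝ) : Prop :=
  ∃ gB : LinearMap.BilinForm ℝ p₂, IsInvariantMetric H p₂ gB ∧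
    (∀ X Y : p₂, Tendsto (fun t => restrictForm h₂ (g t) X Y) (𝓝[<] T) (𝓝 (gB X Y))) ∧
    Tendsto (fun t => dHG (rdist G K p (g t)) (rdist G H p₂ gB)) (𝓝[<] T) (𝓝 0)

/-- There is no ancient solution of the homogeneous Ricci flow on `G/K`, i.e. no solution on a time
interval `(-∞, T)`. -/
def NoAncientSolution {N : ℕ} (K : Subgroup (U N)) (p : Submodule ℝ (Mat N)) : Prop :=
  ∀ (T : ℝ) (g : ℝ → LinearMap.BilinForm ℝ p), ¬ IsRicciFlowOn K p g (Iio T)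

/-- From every `G`-invariant metric `g₀` on `G/K` there starts a unique maximal solution of the
homogeneous Ricci flow; its lifetime `T` is finite, and as `t → T` the fibre `H/K` shrinks to a
point and `G/K` converges to `G/H`. -/
def EverySolutionCollapses {N : ℕ} (G H K : Subgroup (U N)) {p p₁ p₂ : Submodule ℝ (Mat N)}
    (h₁ : p₁ ≤ p) (h₂ : p₂ ≤ p) : Prop :=
  ∀ g₀ : LinearMap.BilinForm ℝ p, IsInvariantMetric K p g₀ →
    ∃ (T : ℝ) (g : ℝ → LinearMap.BilinForm ℝ p), 0 < T ∧ g 0 = g₀ ∧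
      IsRicciFlowOn K p g (Ico 0 T) ∧
      (∀ (T' : ℝ) (g' : ℝ → LinearMap.BilinForm ℝ p), 0 < T' → g' 0 = g₀ →
        IsRicciFlowOn K p g' (Ico 0 T') → T' ≤ T ∧ ∀ t ∈ Ico 0 T', g' t = g t) ∧
      FibreShrinks H K h₁ g T ∧ ConvergesToBase G H K h₂ g T

theorem NonMaximalTwoSummand.le₁ {N : ℕ} {G H K : Subgroup (U N)}
    {Q : LinearMap.BilinForm ℝ (Mat N)} {p₁ p₂ : Submodule ℝ (Mat N)}
    (h : NonMaximalTwoSummand G H K Q p₁ p₂) : p₁ ≤ isotropy Q G K :=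
  le_sup_left.trans h.sum.le

theorem NonMaximalTwoSummand.le₂ {N : ℕ} {G H K : Subgroup (U N)}
    {Q : LinearMap.BilinForm ℝ (Mat N)} {p₁ p₂ : Submodule ℝ (Mat N)}
    (h : NonMaximalTwoSummand G H K Q p₁ p₂) : p₂ ≤ isotropy Q G K :=
  le_sup_right.trans h.sum.le

/-! ## The example `SU(2) < Sp(2) < SU(4)` -/

/-- `SU(4)`. -/
def SU4 : Subgroup (U 4) where
  carrier := {u | (u : Mat 4).det = 1}
  one_mem' := by simp
  mul_mem' := by
    intro a b ha hb
    simp only [mem_ofPred_eq] at ha hb ⊢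
    simp [ha, hb]
  inv_mem' := by
    intro a ha
    simp only [mem_ofPred_eq] at ha ⊢
    rw [Matrix.UnitaryGroup.inv_val, Matrix.star_eq_conjTranspose, Matrix.det_conjTranspose, ha,
      star_one]

/-- The matrix of a symplectic form on `ℂ⁴`. -/
def J : Mat 4 := !![0, 0, 0, 1; 0, 0, -1, 0; 0, 1, 0, 0; -1, 0, 0, 0]

/-- `Sp(2)`: the unitary `4 × 4` matrices that preserve the symplectic form `J`. -/
def Sp2 : Subgroup (U 4) where
  carrier := {u | (u : Mat 4)ᵀ * J * (u : Mat 4) = J}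
  one_mem' := by simp
  mul_mem' := by
    intro a b ha hb
    simp only [mem_ofPred_eq] at ha hb ⊢
    calc ((a * b : U 4) : Mat 4)ᵀ * J * ((a * b : U 4) : Mat 4)
        = (b : Mat 4)ᵀ * ((a : Mat 4)ᵀ * J * (a : Mat 4)) * (b : Mat 4) := by
          simp [Matrix.transpose_mul, Matrix.mul_assoc]
      _ = J := by rw [ha, hb]
  inv_mem' := by
    intro a ha
    simp only [mem_ofPred_eq] at ha ⊢
    have h1 : (a : Mat 4) * ((a⁻¹ : U 4) : Mat 4) = 1 := by
      simp
    have h2 : ((a⁻¹ : U 4) : Mat 4)ᵀ * (a : Mat 4)ᵀ = 1 := by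
      rw [← Matrix.transpose_mul, h1, Matrix.transpose_one]
    calc ((a⁻¹ : U 4) : Mat 4)ᵀ * J * ((a⁻¹ : U 4) : Mat 4)
        = ((a⁻¹ : U 4) : Mat 4)ᵀ * ((a : Mat 4)ᵀ * J * (a : Mat 4)) * ((a⁻¹ : U 4) : Mat 4) := by
          rw [ha]
      _ = (((a⁻¹ : U 4) : Mat 4)ᵀ * (a : Mat 4)ᵀ) * J * ((a : Mat 4) * ((a⁻¹ : U 4) : Mat 4)) := by
          simp only [Matrix.mul_assoc]
      _ = J := by rw [h1, h2]; simp

/-- The cubic Veronese map `ℂ² → ℂ⁴ = S³ ℂ²`, in a unitary basis of `S³ ℂ²`. -/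
noncomputable def veronese (v : Fin 2 → ℂ) : Fin 4 → ℂ :=
  ![v 0 ^ 3, (Real.sqrt 3 : ℂ) * v 0 ^ 2 * v 1, (Real.sqrt 3 : ℂ) * v 0 * v 1 ^ 2, v 1 ^ 3]

/-- `SU(2)`, embedded in `SU(4)` by its irreducible representation on `S³ ℂ² = ℂ⁴`: the
`u ∈ SU(4)` that act on the cubic powers `v³`, `v ∈ ℂ²`, as some `a ∈ SU(2)` does. -/
def SU2 : Subgroup (U 4) where
  carrier := {u | (u : Mat 4).det = 1 ∧ ∃ a : U 2, (a : Mat 2).det = 1 ∧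
    ∀ v, (u : Mat 4) *ᵥ veronese v = veronese ((a : Mat 2) *ᵥ v)}
  one_mem' := ⟨by simp, 1, by simp, by simp⟩
  mul_mem' := by
    rintro u u' ⟨hu, a, ha, h⟩ ⟨hu', a', ha', h'⟩
    refine ⟨by simp [hu, hu'], a * a', by simp [ha, ha'], fun v => ?_⟩
    have e1 : ((u * u' : U 4) : Mat 4) = (u : Mat 4) * (u' : Mat 4) := rfl
    have e2 : ((a * a' : U 2) : Mat 2) = (a : Mat 2) * (a' : Mat 2) := rfl
    rw [e1, e2, ← Matrix.mulVec_mulVec, ← Matrix.mulVec_mulVec, h', h]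
  inv_mem' := by
    rintro u ⟨hu, a, ha, h⟩
    refine ⟨SU4.inv_mem hu, a⁻¹, ?_, fun v => ?_⟩
    · rw [Matrix.UnitaryGroup.inv_val, Matrix.star_eq_conjTranspose, Matrix.det_conjTranspose, ha,
        star_one]
    · have e1 : (a : Mat 2) * ((a⁻¹ : U 2) : Mat 2) = 1 := by
        simp
      have e2 : ((u⁻¹ : U 4) : Mat 4) * (u : Mat 4) = 1 := by
        simp
      have := h (((a⁻¹ : U 2) : Mat 2) *ᵥ v)
      rw [Matrix.mulVec_mulVec, e1, Matrix.one_mulVec] at this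
      rw [← this, Matrix.mulVec_mulVec, e2, Matrix.one_mulVec]

/-- The negative of the Killing form `8 tr(XY)` of `𝔰𝔲(4)`, extended to all matrices by taking the
real part. -/
noncomputable def negKilling4 : LinearMap.BilinForm ℝ (Mat 4) :=
  LinearMap.mk₂ ℝ (fun X Y => -8 * (X * Y).trace.re)
    (by intro X X' Y; simp only [add_mul, Matrix.trace_add, Complex.add_re]; ring)
    (by intro c X Y; simp; ring)
    (by intro X Y Y'; simp only [mul_add, Matrix.trace_add, Complex.add_re])
    (by intro c X Y; simp; ring)

end HRF

namespace HRF

-- The flow is a planar ODE in disguise. By Schur's lemma an invariant metric is `x₁ Q|p₁ + x₂ Q|p₂`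
-- (`exists_eq_diagForm`), and with `y = x₁ / x₂` its Ricci tensor has the coefficients `a₁ + b₁ y²`
-- on `p₁` and `a₂ - b₂ y` on `p₂`, where `b₁ ≥ 0` and `a₂, b₂ > 0` (`exists_ricci_eq`); positivity
-- of `b₂` is what `[122] > 0` provides. Hence `y' = -2 P(y) / x₂` with `P(y) = a₁ - a₂ y + (b₁ +
-- b₂) y²`, and Einstein metrics are exactly the positive roots of `P`. If there are none, the
-- discriminant is negative (as `a₂ > 0`, a real root would force a positive one), so `P ≥ δ > 0` on
-- the whole line and `a₁ > 0`.
--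
-- No ancient solution (`not_isPlanarFlow_Iio`): `y` decreases in time. If `y` is ever as large as
-- `2 a₂ / b₂`, then at all earlier times `x₂` grows at rate at least `2 a₂`, so followed backwards
-- it reaches `0` after a finite time. Otherwise `y` is bounded; `x₁`, and with it `x₂`, tends to
-- infinity as `t → -∞`, and comparing `y` with `log x₂` forces `y` to be unbounded.
--
-- Collapse (`exists_planarFlow`): `y` serves as the parameter along the orbit. Both `d log x₂ / dy
-- = (a₂ - b₂ y) / P(y)` and `dt / dy = -x₂ / (2 P(y))` are regular down to `y = 0`, so `y` reaches
-- `0` at a finite time `T` at which `x₂` is still positive; there `x₁ = y x₂` tends to `0`. The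
-- same two integrals give uniqueness and maximality.
--
-- Hausdorff-Gromov convergence (`convergesToBase`): curves in `G` compute the distances on `G/K`
-- and on `G/H` alike, so lengths can be compared pointwise. Projecting to `G/H` costs at most a
-- factor close to `1`; conversely a nearly shortest curve for `G/H` is completed in `G/K` by arcs
-- in fibres of diameter `O(√x₁)`, uniformly by compactness of `G × G`. The pairs `(uK, uH)` then
-- form an approximation with small distortion.
--
-- Example: `𝔰𝔭(2)` and its complement in `𝔰𝔲(4)` are written out in coordinates. The summands have
-- dimensions 7 and 5, and each is irreducible because its zero weight vector has multiplicity one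
-- and is cyclic. Evaluating on these two vectors gives `b₁ = 1/16`, `a₂ = 1/2`, `b₂ = 7/40` and `a₁
-- ≥ 3/10`, for which `P` has no root (`not_isEinstein_SU4`). Connectedness comes from Cayley-type
-- paths inside `Sp(2)` and `U(4)`.

attribute [local instance] Matrix.linftyOpNormedRing Matrix.linftyOpNormedAlgebra

/-! ## Matrix-valued curves and the exponential map -/

/-- The definitions in the statement speak of entries, the exponential map needs a normed algebra.
Entry maps and elementary matrices are linear, which translates between the two. -/
theorem hasDerivAt_matrix_iff {N : ℕ} {c : ℝ → Mat N} {X : Mat N} {t : ℝ} :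
    HasDerivAt c X t ↔ ∀ i j, HasDerivAt (fun s => c s i j) (X i j) t := by
  constructor
  · intro h i j
    have := (Matrix.entryLinearMap ℝ ℂ i j).toContinuousLinearMap.hasFDerivAt.comp_hasDerivAt t h
    exact this
  · intro h
    have e : ∀ M : Mat N, M = ∑ i, ∑ j, (Matrix.singleLinearMap ℝ i j).toContinuousLinearMap (M i j) := by
      intro M
      conv_lhs => rw [Matrix.matrix_eq_sum_single M]
      rfl
    have h2 : HasDerivAt (fun s => ∑ i, ∑ j,
        (Matrix.singleLinearMap ℝ i j : ℂ →ₗ[ℝ] Mat N).toContinuousLinearMap (c s i j))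
        (∑ i, ∑ j, (Matrix.singleLinearMap ℝ i j).toContinuousLinearMap (X i j)) t :=
      HasDerivAt.fun_sum fun i _ => HasDerivAt.fun_sum fun j _ =>
        (Matrix.singleLinearMap ℝ i j : ℂ →ₗ[ℝ] Mat N).toContinuousLinearMap.hasFDerivAt.comp_hasDerivAt
          t (h i j)
    rw [e X]
    convert h2 using 1
    funext s
    exact e (c s)

theorem contDiff_entry {N : ℕ} {n : WithTop ℕ∞} {c : ℝ → Mat N} (h : ContDiff ℝ n c) :
    IsContDiff n c := fun i j =>
  (Matrix.entryLinearMap ℝ ℂ i j).toContinuousLinearMap.contDiff.comp h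

theorem IsContDiff.contDiff {N : ℕ} {n : WithTop ℕ∞} {c : ℝ → Mat N} (h : IsContDiff n c) :
    ContDiff ℝ n c := by
  have e : c = fun s => ∑ i, ∑ j,
      (Matrix.singleLinearMap ℝ i j : ℂ →ₗ[ℝ] Mat N).toContinuousLinearMap (c s i j) := by
    funext s
    conv_lhs => rw [Matrix.matrix_eq_sum_single (c s)]
    rfl
  rw [e]
  exact ContDiff.sum fun i _ => ContDiff.sum fun j _ =>
    (Matrix.singleLinearMap ℝ i j : ℂ →ₗ[ℝ] Mat N).toContinuousLinearMap.contDiff.comp (h i j)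

theorem IsContDiff.hasDerivAt_velocity {N : ℕ} {c : ℝ → Mat N} (hc : IsContDiff 1 c) (t : ℝ) :
    HasDerivAt c (velocity c t) t :=
  hasDerivAt_matrix_iff.2 fun i j =>
    ((hc i j).differentiable (by simp)).differentiableAt.hasDerivAt

theorem velocity_eq {N : ℕ} {c : ℝ → Mat N} {X : Mat N} {t : ℝ} (h : HasDerivAt c X t) :
    velocity c t = X := by
  ext i j
  exact (hasDerivAt_matrix_iff.1 h i j).deriv

theorem IsContDiff.continuous_velocity {N : ℕ} {c : ℝ → Mat N} (hc : IsContDiff 1 c) :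
    Continuous (velocity c) := by
  refine continuous_matrix fun i j => ?_
  exact (hc i j).continuous_deriv le_rfl

/-- The unitarity equations are closed and entries of a unitary matrix have norm at most `1`.
Compactness makes `matSet G` closed in the matrices and later gives the uniform length bounds. -/
instance {N : ℕ} : CompactSpace (U N) := by
  refine isCompact_iff_compactSpace.1 ?_
  refine Metric.isCompact_of_isClosed_isBounded ?_ ?_
  · have : ((Matrix.unitaryGroup (Fin N) ℂ : Set (Mat N))) =
        {M : Mat N | star M * M = 1} ∩ {M | M * star M = 1} := by
      ext M; exact Unitary.mem_iff
    rw [this]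
    have hst : Continuous (fun M : Mat N => star M) := continuous_id.matrix_conjTranspose
    exact (isClosed_eq (hst.mul continuous_id) continuous_const).inter
      (isClosed_eq (continuous_id.mul hst) continuous_const)
  · refine (Metric.isBounded_iff_subset_closedBall 0).2 ⟨N, fun M hM => ?_⟩
    rw [mem_closedBall_zero_iff, Matrix.linfty_opNorm_def]
    have : ∀ i, ∑ j, ‖M i j‖₊ ≤ N := fun i => by
      calc ∑ j, ‖M i j‖₊ ≤ ∑ _j : Fin N, (1 : NNReal) :=
            Finset.sum_le_sum fun j _ => entry_norm_bound_of_unitary hM i j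
        _ = N := by simp
    exact_mod_cast Finset.sup_le fun i _ => this i

instance {N : ℕ} : FirstCountableTopology (U N) :=
  have : FirstCountableTopology (Mat N) :=
    (inferInstance : FirstCountableTopology (Fin N → Fin N → ℂ))
  Topology.IsInducing.subtypeVal.firstCountableTopology

theorem continuous_coe_U {N : ℕ} : Continuous (fun u : U N => (u : Mat N)) :=
  continuous_subtype_val

/-- The matrices of the elements of `G`. -/
def matSet {N : ℕ} (G : Subgroup (U N)) : Set (Mat N) := (fun u : U N => (u : Mat N)) '' G

theorem isClosed_matSet {N : ℕ} {G : Subgroup (U N)} (hG : IsClosed (G : Set (U N))) :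
    IsClosed (matSet G) :=
  (hG.isCompact.image continuous_coe_U).isClosed

theorem matSet_pow {N : ℕ} {G : Subgroup (U N)} {M : Mat N} (h : M ∈ matSet G) (n : ℕ) :
    M ^ n ∈ matSet G := by
  obtain ⟨u, hu, rfl⟩ := h
  exact ⟨u ^ n, G.pow_mem hu n, by simp⟩

theorem star_mem_matSet {N : ℕ} {G : Subgroup (U N)} {M : Mat N} (h : M ∈ matSet G) :
    star M ∈ matSet G := by
  obtain ⟨u, hu, rfl⟩ := h
  exact ⟨u⁻¹, G.inv_mem hu, by simp⟩

theorem mul_mem_matSet {N : ℕ} {G : Subgroup (U N)} {M M' : Mat N} (h : M ∈ matSet G)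
    (h' : M' ∈ matSet G) : M * M' ∈ matSet G := by
  obtain ⟨u, hu, rfl⟩ := h
  obtain ⟨u', hu', rfl⟩ := h'
  exact ⟨u * u', G.mul_mem hu hu', by simp⟩

open NormedSpace

theorem exp_zero_smul_mul {N : ℕ} (X : Mat N) (s t : ℝ) :
    exp ((s + t) • X) = exp (s • X) * exp (t • X) := by
  rw [add_smul, Matrix.exp_add_of_commute]
  exact (Commute.refl X).smul_left s |>.smul_right t

theorem continuous_expMat {N : ℕ} : Continuous (exp : Mat N → Mat N) := exp_continuous

theorem hasDerivAt_expMat {N : ℕ} (X : Mat N) (t : ℝ) :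
    HasDerivAt (fun t : ℝ => exp (t • X)) (exp (t • X) * X) t :=
  hasDerivAt_exp_smul_const X t

theorem hasDerivAt_expMat' {N : ℕ} (X : Mat N) (t : ℝ) :
    HasDerivAt (fun t : ℝ => exp (t • X)) (X * exp (t • X)) t :=
  hasDerivAt_exp_smul_const' X t

theorem contDiff_expMat {N : ℕ} (X : Mat N) {n : WithTop ℕ∞} :
    ContDiff ℝ n (fun t : ℝ => exp (t • X)) := by
  have h : ContDiff ℝ n (exp : Mat N → Mat N) := by
    rw [contDiff_iff_contDiffAt]
    intro x
    have := (NormedSpace.exp_analytic (𝕂 := ℝ) (𝔸 := Mat N) x).contDiffAt (n := n)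
    exact this
  exact h.comp (contDiff_id.smul contDiff_const)

/-- Because `exp (m • Z) = exp Z ^ m` stays in the closed set `matSet G`, integer multiples of small
logarithms may converge to any direction they like: the limit still exponentiates into `G`. -/
theorem exp_mem_of_tendsto {N : ℕ} {G : Subgroup (U N)} (hG : IsClosed (G : Set (U N)))
    {Z : ℕ → Mat N} {m : ℕ → ℕ} {W : Mat N} (hZ : ∀ n, exp (Z n) ∈ matSet G)
    (h : Tendsto (fun n => (m n : ℝ) • Z n) atTop (𝓝 W)) : exp W ∈ matSet G := by
  refine (isClosed_matSet hG).mem_of_tendsto ((continuous_expMat.tendsto W).comp h)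
    (Eventually.of_forall fun n => ?_)
  have : exp ((m n : ℝ) • Z n) = exp (Z n) ^ m n := by
    rw [Nat.cast_smul_eq_nsmul, Matrix.exp_nsmul]
  simp only [Function.comp_apply, this]
  exact matSet_pow (hZ n) _

/-- The exponential map is a local diffeomorphism at the origin. -/
theorem exists_log (N : ℕ) : ∃ L : Mat N → Mat N, L 1 = 0 ∧
    HasStrictFDerivAt L (ContinuousLinearMap.id ℝ (Mat N)) 1 ∧ ∀ᶠ M in 𝓝 (1 : Mat N), exp (L M) = M := by
  have h : HasStrictFDerivAt (exp : Mat N → Mat N)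
      ((ContinuousLinearEquiv.refl ℝ (Mat N) : Mat N ≃L[ℝ] Mat N) : Mat N →L[ℝ] Mat N) 0 :=
    hasStrictFDerivAt_exp_zero
  have e0 : exp (0 : Mat N) = 1 := exp_zero
  refine ⟨h.localInverse, ?_, ?_, ?_⟩
  · rw [← e0]; exact h.localInverse_apply_image
  · rw [← e0]; exact h.to_localInverse
  · rw [← e0]; exact h.eventually_right_inverse

/-- With a local logarithm `L`, the vectors `n L(c(t/n))` converge to `t X`; the previous limit
argument applies. -/
theorem exp_smul_mem_of_hasDerivAt {N : ℕ} {G : Subgroup (U N)} (hG : IsClosed (G : Set (U N)))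
    {c : ℝ → Mat N} {X : Mat N} (hc : ∀ t, c t ∈ matSet G) (h0 : c 0 = 1)
    (hX : HasDerivAt c X 0) (t : ℝ) : exp (t • X) ∈ matSet G := by
  obtain ⟨L, hL1, hL, hLe⟩ := exists_log N
  have hd : HasDerivAt (fun s => L (c (s * t))) (t • X) 0 := by
    have h1 : HasDerivAt (fun s : ℝ => c (s * t)) (t • X) 0 := by
      have h2 : HasDerivAt (fun s : ℝ => s * t) t 0 := by
        simpa using (hasDerivAt_id (0 : ℝ)).mul_const t
      have h3 : HasDerivAt c X (0 * t) := by simpa using hX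
      exact h3.scomp (0 : ℝ) h2
    have h4 : HasFDerivAt L (ContinuousLinearMap.id ℝ (Mat N)) (c (0 * t)) := by
      rw [zero_mul, h0]; exact hL.hasFDerivAt
    exact h4.comp_hasDerivAt 0 h1
  have hs := hd.tendsto_slope_zero
  have hseq : Tendsto (fun n : ℕ => ((n : ℝ) + 1)⁻¹) atTop (𝓝[≠] 0) := by
    refine tendsto_nhdsWithin_iff.2 ⟨?_, Eventually.of_forall fun n => ?_⟩
    · simpa using tendsto_one_div_add_atTop_nhds_zero_nat (𝕜 := ℝ)
    · simp only [mem_compl_iff, mem_singleton_iff, inv_eq_zero]; positivity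
  have hlim := hs.comp hseq
  have hev : ∀ᶠ n : ℕ in atTop, exp (L (c (((n : ℝ) + 1)⁻¹ * t))) = c (((n : ℝ) + 1)⁻¹ * t) := by
    have hcont : Tendsto (fun n : ℕ => c (((n : ℝ) + 1)⁻¹ * t)) atTop (𝓝 1) := by
      rw [← h0]
      refine (hX.continuousAt.tendsto).comp ?_
      have := (tendsto_one_div_add_atTop_nhds_zero_nat (𝕜 := ℝ)).mul_const t
      simpa using this
    exact hcont.eventually hLe
  obtain ⟨n₀, hn₀⟩ := eventually_atTop.1 hev
  -- The index is shifted by `n₀` so that `exp (L M) = M` holds for every term of the sequence and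
  -- not only eventually.
  refine exp_mem_of_tendsto hG (Z := fun n => L (c ((((n + n₀ : ℕ) : ℝ) + 1)⁻¹ * t)))
    (m := fun n => n + n₀ + 1) (fun n => ?_) ?_
  · rw [hn₀ (n + n₀) (by omega)]; exact hc _
  · have := hlim.comp (tendsto_add_atTop_nat n₀)
    refine this.congr fun n => ?_
    simp [h0, hL1]

/-! ## The Lie algebra of a closed subgroup -/

theorem exists_curve_of_exp {N : ℕ} {G : Subgroup (U N)} {X : Mat N}
    (h : ∀ t : ℝ, exp (t • X) ∈ matSet G) : ∃ γ : ℝ → U N, (∀ t, γ t ∈ G) ∧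
      ∀ t, (γ t : Mat N) = exp (t • X) := by
  choose γ hγ using h
  exact ⟨γ, fun t => (hγ t).1, fun t => (hγ t).2⟩

theorem mem_lieAlg_of_exp {N : ℕ} {G : Subgroup (U N)} {X : Mat N}
    (h : ∀ t : ℝ, exp (t • X) ∈ matSet G) : X ∈ lieAlg G := by
  obtain ⟨γ, hγ, he⟩ := exists_curve_of_exp h
  have he' : (fun t => (γ t : Mat N)) = fun t => exp (t • X) := funext he
  refine ⟨γ, hγ, ?_, ?_, ?_⟩
  · rw [he']; exact contDiff_entry (contDiff_expMat X)
  · ext1; rw [he]; simp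
  · rw [he']
    have := velocity_eq (hasDerivAt_expMat X 0)
    simpa using this

/-- Cartan's description of the Lie algebra. Closedness of `G` is needed only to pass from a curve
to its one-parameter subgroup. -/
theorem mem_lieAlg_iff_exp {N : ℕ} {G : Subgroup (U N)} (hG : IsClosed (G : Set (U N)))
    {X : Mat N} : X ∈ lieAlg G ↔ ∀ t : ℝ, exp (t • X) ∈ matSet G := by
  refine ⟨?_, mem_lieAlg_of_exp⟩
  rintro ⟨γ, hγ, hs, h0, rfl⟩ t
  refine exp_smul_mem_of_hasDerivAt hG (c := fun t => (γ t : Mat N)) (fun t => ⟨γ t, hγ t, rfl⟩)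
    (by simp [h0]) ?_ t
  exact IsContDiff.hasDerivAt_velocity (fun i j => (hs i j).of_le (by simp)) 0

/-- Differentiate `γ* γ = 1` at the identity. -/
theorem star_eq_neg_of_mem_lieAlg {N : ℕ} {G : Subgroup (U N)} {X : Mat N} (hX : X ∈ lieAlg G) :
    star X = -X := by
  obtain ⟨γ, hγ, hs, h0, rfl⟩ := hX
  set c : ℝ → Mat N := fun t => (γ t : Mat N)
  have h1 : HasDerivAt c (velocity c 0) 0 :=
    IsContDiff.hasDerivAt_velocity (fun i j => (hs i j).of_le (by simp)) 0
  have h2 : HasDerivAt (fun t => star (c t)) (star (velocity c 0)) 0 := by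
    rw [hasDerivAt_matrix_iff] at h1 ⊢
    exact fun i j => (h1 j i).star
  have h3 := h2.mul h1
  have h4 : (fun t => star (c t) * c t) = fun _ => 1 := by
    funext t; exact (Unitary.mem_iff.1 (γ t).2).1
  have e : c 0 = 1 := by simp [c, h0]
  have h5 := h3.unique (h4 ▸ hasDerivAt_const (0 : ℝ) (1 : Mat N))
  rw [e] at h5
  simp only [mul_one, star_one, one_mul] at h5
  exact eq_neg_of_add_eq_zero_left h5

theorem lieAlg_mono {N : ℕ} {G H : Subgroup (U N)} (h : G ≤ H) : lieAlg G ≤ lieAlg H := by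
  rintro X ⟨γ, hγ, r⟩
  exact ⟨γ, fun t => h (hγ t), r⟩

/-- The left-translated velocity of a `C¹` curve in a closed subgroup is in its Lie algebra. -/
theorem star_mul_velocity_mem {N : ℕ} {G : Subgroup (U N)} (hG : IsClosed (G : Set (U N)))
    {γ : ℝ → U N} (hγ : ∀ t, γ t ∈ G) (hs : IsContDiff 1 (fun t => (γ t : Mat N))) (t : ℝ) :
    star (γ t : Mat N) * velocity (fun s => (γ s : Mat N)) t ∈ lieAlg G := by
  refine mem_lieAlg_of_exp (exp_smul_mem_of_hasDerivAt hG
    (c := fun s => star (γ t : Mat N) * (γ (t + s) : Mat N)) (fun s => ?_) ?_ ?_)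
  · exact mul_mem_matSet (star_mem_matSet ⟨γ t, hγ t, rfl⟩) ⟨γ (t + s), hγ _, rfl⟩
  · simp
  · have h1 := hs.hasDerivAt_velocity (t + 0)
    have h2 : HasDerivAt (fun s => t + s) 1 (0 : ℝ) := (hasDerivAt_id (0 : ℝ)).const_add t
    have h3 := h1.scomp (0 : ℝ) h2
    simp only [one_smul, add_zero] at h3
    exact h3.const_mul _

/-! ### The adjoint action and the bracket -/

/-- `Ad u` as a linear map. -/
def adLin {N : ℕ} (u : U N) : Mat N →ₗ[ℝ] Mat N where
  toFun := Ad u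
  map_add' X Y := by simp [Ad, mul_add, add_mul]
  map_smul' c X := by simp [Ad]

@[simp] theorem adLin_apply {N : ℕ} (u : U N) (X : Mat N) : adLin u X = Ad u X := rfl

theorem Ad_mul {N : ℕ} (u v : U N) (X : Mat N) : Ad (u * v) X = Ad u (Ad v X) := by
  simp [Ad, mul_assoc]

@[simp] theorem Ad_one {N : ℕ} (X : Mat N) : Ad (1 : U N) X = X := by simp [Ad]

theorem Ad_inv_Ad {N : ℕ} (u : U N) (X : Mat N) : Ad u⁻¹ (Ad u X) = X := by
  rw [← Ad_mul]; simp

theorem Ad_Ad_inv {N : ℕ} (u : U N) (X : Mat N) : Ad u (Ad u⁻¹ X) = X := by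
  rw [← Ad_mul]; simp

theorem Ad_comm {N : ℕ} (u : U N) (X Y : Mat N) : Ad u (comm X Y) = comm (Ad u X) (Ad u Y) := by
  have h : star (u : Mat N) * (u : Mat N) = 1 := (Unitary.mem_iff.1 u.2).1
  simp only [Ad, comm, mul_sub, sub_mul]
  have e : ∀ A B : Mat N, (u : Mat N) * A * star (u : Mat N) * ((u : Mat N) * B * star (u : Mat N))
      = (u : Mat N) * (A * B) * star (u : Mat N) := by
    intro A B
    calc _ = (u : Mat N) * A * (star (u : Mat N) * (u : Mat N)) * B * star (u : Mat N) := by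
          simp only [mul_assoc]
      _ = _ := by rw [h]; simp only [mul_one, mul_assoc]
  rw [e, e]

theorem Ad_mem_lieAlg {N : ℕ} {G : Subgroup (U N)} {u : U N} (hu : u ∈ G) {X : Mat N}
    (hX : X ∈ lieAlg G) : Ad u X ∈ lieAlg G := by
  obtain ⟨γ, hγ, hs, h0, rfl⟩ := hX
  have h1 : HasDerivAt (fun t => (γ t : Mat N)) (velocity (fun t => (γ t : Mat N)) 0) 0 :=
    IsContDiff.hasDerivAt_velocity (fun i j => (hs i j).of_le (by simp)) 0
  refine ⟨fun t => u * γ t * u⁻¹, fun t => G.mul_mem (G.mul_mem hu (hγ t)) (G.inv_mem hu), ?_,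
    by simp [h0], ?_⟩
  · apply contDiff_entry
    exact (contDiff_const.mul hs.contDiff).mul contDiff_const
  · refine velocity_eq ?_
    exact (h1.const_mul (u : Mat N)).mul_const _

theorem hasDerivAt_Ad {N : ℕ} {γ : ℝ → U N} {X : Mat N}
    (h0 : γ 0 = 1) (hX : HasDerivAt (fun t => (γ t : Mat N)) X 0) (hs : star X = -X) (Y : Mat N) :
    HasDerivAt (fun t => Ad (γ t) Y) (comm X Y) 0 := by
  have h2 : HasDerivAt (fun t => star (γ t : Mat N)) (star X) 0 := by
    rw [hasDerivAt_matrix_iff] at hX ⊢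
    exact fun i j => (hX j i).star
  refine ((hX.mul_const Y).mul h2).congr_deriv ?_
  simp [h0, hs, comm, sub_eq_add_neg]

/-- The bracket as the derivative of `Ad` along a curve in `G`: every statement about `Ad(G)` below
becomes one about brackets by differentiating it along this curve. -/
theorem exists_hasDerivAt_of_mem_lieAlg {N : ℕ} {G : Subgroup (U N)} {X : Mat N}
    (hX : X ∈ lieAlg G) : ∃ γ : ℝ → U N, (∀ t, γ t ∈ G) ∧ γ 0 = 1 ∧
      ∀ Y, HasDerivAt (fun t => Ad (γ t) Y) (comm X Y) 0 := by
  have hsk := star_eq_neg_of_mem_lieAlg hX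
  obtain ⟨γ, hγ, hs, h0, rfl⟩ := hX
  exact ⟨γ, hγ, h0, fun Y => hasDerivAt_Ad h0
    (IsContDiff.hasDerivAt_velocity (fun i j => (hs i j).of_le (by simp)) 0) hsk Y⟩

/-- Difference quotients stay in `W`, which is closed because it is finite-dimensional. -/
theorem mem_of_hasDerivAt {E : Type*} [NormedAddCommGroup E] [NormedSpace ℝ E]
    [FiniteDimensional ℝ E] {W : Submodule ℝ E} {c : ℝ → E} {v : E} {t : ℝ}
    (hc : ∀ t, c t ∈ W) (h : HasDerivAt c v t) : v ∈ W := by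
  have hs := h.tendsto_slope_zero
  refine W.closed_of_finiteDimensional.mem_of_tendsto hs (Eventually.of_forall fun s => ?_)
  exact W.smul_mem _ (W.sub_mem (hc _) (hc _))

theorem IsAdInvariant.comm_mem {N : ℕ} {L : Subgroup (U N)} {W : Submodule ℝ (Mat N)}
    (h : IsAdInvariant L W) {X Y : Mat N} (hX : X ∈ lieAlg L) (hY : Y ∈ W) : comm X Y ∈ W := by
  obtain ⟨γ, hγ, -, hd⟩ := exists_hasDerivAt_of_mem_lieAlg hX
  exact mem_of_hasDerivAt (fun t => h (γ t) (hγ t) Y hY) (hd Y)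

theorem isAdInvariant_lieAlg {N : ℕ} {G H : Subgroup (U N)} (h : H ≤ G) :
    IsAdInvariant H (lieAlg G) := fun _ hu _ hX => Ad_mem_lieAlg (h hu) hX

theorem comm_mem_lieAlg {N : ℕ} {G : Subgroup (U N)} {X Y : Mat N} (hX : X ∈ lieAlg G)
    (hY : Y ∈ lieAlg G) : comm X Y ∈ lieAlg G :=
  (isAdInvariant_lieAlg le_rfl).comm_mem hX hY

theorem comm_swap {N : ℕ} (X Y : Mat N) : comm X Y = -comm Y X := by simp [comm]

theorem hasDerivAt_bilin {E : Type*} [NormedAddCommGroup E] [NormedSpace ℝ E]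
    [FiniteDimensional ℝ E] (Q : LinearMap.BilinForm ℝ E) {a b : ℝ → E} {a' b' : E} {t : ℝ}
    (ha : HasDerivAt a a' t) (hb : HasDerivAt b b' t) :
    HasDerivAt (fun s => Q (a s) (b s)) (Q a' (b t) + Q (a t) b') t := by
  let B : E →L[ℝ] E →L[ℝ] ℝ :=
    LinearMap.toContinuousLinearMap (LinearMap.toContinuousLinearMap.toLinearMap ∘ₗ Q)
  have h1 : HasDerivAt (fun s => B (a s)) (B a') t :=
    HasFDerivAt.comp_hasDerivAt (l := B) (f := a) t B.hasFDerivAt ha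
  exact h1.clm_apply hb

/-- Infinitesimal `Ad`-invariance of the background scalar product. -/
theorem IsBackground.ad_skew {N : ℕ} {G : Subgroup (U N)} {Q : LinearMap.BilinForm ℝ (Mat N)}
    (hQ : IsBackground G Q) {X Y Z : Mat N} (hX : X ∈ lieAlg G) (hY : Y ∈ lieAlg G)
    (hZ : Z ∈ lieAlg G) : Q (comm X Y) Z = - Q Y (comm X Z) := by
  obtain ⟨γ, hγ, h0, hd⟩ := exists_hasDerivAt_of_mem_lieAlg hX
  have hc : ∀ t, Q (Ad (γ t) Y) (Ad (γ t) Z) = Q Y Z := fun t => hQ.inv _ (hγ t) _ hY _ hZ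
  have h2 := hasDerivAt_bilin Q (hd Y) (hd Z)
  have h3 : (fun t => Q (Ad (γ t) Y) (Ad (γ t) Z)) = fun _ => Q Y Z := funext hc
  have h4 := h2.unique (h3 ▸ hasDerivAt_const (0 : ℝ) (Q Y Z))
  simp only [h0, Ad_one] at h4
  linarith

/-! ### Exponential coordinates near the identity of a closed subgroup -/

/-- Elements near `1` are products of exponentials of elements of complementary subspaces. -/
theorem exists_exp_mul_exp {A : Type*} [NormedRing A] [NormedAlgebra ℝ A] [CompleteSpace A]
    [FiniteDimensional ℝ A] (E W : Submodule ℝ A) (h : IsCompl E W) :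
    ∃ ψ : A → E × W, ψ 1 = 0 ∧ ContinuousAt ψ 1 ∧
      ∀ᶠ M in 𝓝 (1 : A), exp ((ψ M).1 : A) * exp ((ψ M).2 : A) = M := by
  let φ : (E × W) ≃L[ℝ] A := (E.prodEquivOfIsCompl W h).toContinuousLinearEquiv
  have hφ : ∀ z, φ z = (z.1 : A) + z.2 := fun z => rfl
  set F : E × W → A := fun z => exp (z.1 : A) * exp (z.2 : A)
  -- The derivative at `0` is the addition map `E × W → A`, invertible since the subspaces are
  -- complementary; the inverse function theorem then supplies `ψ`.
  have hF : HasStrictFDerivAt F (φ : (E × W) →L[ℝ] A) 0 := by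
    have h1 : HasStrictFDerivAt (fun z : E × W => exp (z.1 : A))
        (E.subtypeL.comp (ContinuousLinearMap.fst ℝ E W)) 0 := by
      have : HasStrictFDerivAt (exp : A → A) (1 : A →L[ℝ] A)
          ((E.subtypeL.comp (ContinuousLinearMap.fst ℝ E W)) 0) := by
        simpa using (hasStrictFDerivAt_exp_zero (𝕂 := ℝ) (𝔸 := A))
      exact this.comp (0 : E × W) (ContinuousLinearMap.hasStrictFDerivAt _)
    have h2 : HasStrictFDerivAt (fun z : E × W => exp (z.2 : A))
        (W.subtypeL.comp (ContinuousLinearMap.snd ℝ E W)) 0 := by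
      have : HasStrictFDerivAt (exp : A → A) (1 : A →L[ℝ] A)
          ((W.subtypeL.comp (ContinuousLinearMap.snd ℝ E W)) 0) := by
        simpa using (hasStrictFDerivAt_exp_zero (𝕂 := ℝ) (𝔸 := A))
      exact this.comp (0 : E × W) (ContinuousLinearMap.hasStrictFDerivAt _)
    refine (h1.mul' h2).congr_fderiv ?_
    ext z <;> simp [hφ]
  have hF0 : F 0 = 1 := by simp [F]
  have h1 := hF.eventually_right_inverse
  have h2 := hF.localInverse_apply_image
  have h3 := hF.localInverse_continuousAt
  rw [hF0] at h1 h2 h3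
  exact ⟨hF.localInverse, h2, h3, h1⟩

/-- Elements of a closed subgroup near the identity are exponentials of small elements of its
Lie algebra. -/
theorem eventually_exists_exp {N : ℕ} {G : Subgroup (U N)} (hG : IsClosed (G : Set (U N))) {ε : ℝ}
    (hε : 0 < ε) : ∀ᶠ u : U N in 𝓝 1, u ∈ G → ∃ X ∈ lieAlg G, ‖X‖ < ε ∧ exp X = (u : Mat N) := by
  obtain ⟨W, hW⟩ := (lieAlg G).exists_isCompl
  set E := lieAlg G
  obtain ⟨ψ, hψ0, hψc, hloc⟩ := exists_exp_mul_exp E W hW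
  -- Otherwise a sequence in `G` tends to `1` with nonzero `W`-components `Y n`. Cancelling the
  -- factor from `lieAlg G` leaves `exp (Y n) ∈ G`, and a limit `V` of the directions `Y n / ‖Y n‖`
  -- is a unit vector of `W` lying in `lieAlg G`, which is absurd.
  have key : ∀ᶠ u : U N in 𝓝 1, u ∈ G → (ψ (u : Mat N)).2 = 0 := by
    by_contra hcon
    rw [not_eventually] at hcon
    have hcon2 : ∃ᶠ u : U N in 𝓝 1, (u ∈ G ∧ (ψ (u : Mat N)).2 ≠ 0) ∧
        exp ((ψ (u : Mat N)).1 : Mat N) * exp ((ψ (u : Mat N)).2 : Mat N) = u := by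
      refine (hcon.and_eventually ((continuous_coe_U.tendsto' 1 1 (by simp)).eventually hloc)).mono ?_
      rintro u ⟨h1, h2⟩
      push Not at h1
      exact ⟨h1, h2⟩
    obtain ⟨u, hu1, hu2⟩ := exists_seq_forall_of_frequently hcon2
    have hu1' : Tendsto (fun n => ψ (u n : Mat N)) atTop (𝓝 0) := by
      rw [← hψ0]
      exact hψc.tendsto.comp ((continuous_coe_U.tendsto' 1 1 (by simp)).comp hu1)
    set Y : ℕ → W := fun n => (ψ (u n : Mat N)).2
    have hY0 : ∀ n, Y n ≠ 0 := fun n => (hu2 n).1.2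
    have hYt : Tendsto Y atTop (𝓝 0) := (continuous_snd.tendsto' (0 : E × W) 0 rfl).comp hu1'
    have hYG : ∀ n, exp (Y n : Mat N) ∈ matSet G := fun n => by
      have h1 : exp ((-1 : ℝ) • ((ψ (u n : Mat N)).1 : Mat N)) ∈ matSet G :=
        (mem_lieAlg_iff_exp hG).1 (ψ (u n : Mat N)).1.2 (-1)
      have h2 := mul_mem_matSet h1 ⟨u n, (hu2 n).1.1, rfl⟩
      have h3 : exp ((-1 : ℝ) • ((ψ (u n : Mat N)).1 : Mat N)) * (u n : Mat N) = exp (Y n : Mat N) := by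
        conv_lhs => arg 2; rw [← (hu2 n).2]
        rw [← mul_assoc]
        have := exp_zero_smul_mul ((ψ (u n : Mat N)).1 : Mat N) (-1) 1
        rw [one_smul] at this
        rw [← this]; simp [Y]
      simpa only [h3] using h2
    have hsph : ∀ n, ‖Y n‖⁻¹ • Y n ∈ Metric.sphere (0 : W) 1 := fun n => by
      rw [mem_sphere_zero_iff_norm, norm_smul, norm_inv, norm_norm]
      exact inv_mul_cancel₀ (norm_ne_zero_iff.2 (hY0 n))
    obtain ⟨V, hV, σ, hσ, hlim⟩ := (isCompact_sphere (0 : W) 1).tendsto_subseq hsph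
    have hVG : (V : Mat N) ∈ lieAlg G := by
      refine mem_lieAlg_of_exp fun t => ?_
      have hpos : ∀ t : ℝ, 0 ≤ t → exp (t • (V : Mat N)) ∈ matSet G := by
        intro t ht
        refine exp_mem_of_tendsto hG (Z := fun n => (Y (σ n) : Mat N))
          (m := fun n => ⌊t * ‖Y (σ n)‖⁻¹⌋₊) (fun n => hYG _) ?_
        have hn : Tendsto (fun n => ‖Y (σ n)‖) atTop (𝓝 0) := by
          simpa using (hYt.comp hσ.tendsto_atTop).norm
        -- Rounding `t / ‖Y‖` down to an integer costs at most `‖Y‖` after multiplying back, so the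
        -- multiples of `Y` converge to `t V`.
        have hfl : Tendsto (fun n => (⌊t * ‖Y (σ n)‖⁻¹⌋₊ : ℝ) * ‖Y (σ n)‖) atTop (𝓝 t) := by
          have hlow : Tendsto (fun n => t - ‖Y (σ n)‖) atTop (𝓝 t) := by
            simpa using hn.const_sub t
          refine tendsto_of_tendsto_of_tendsto_of_le_of_le hlow tendsto_const_nhds ?_ ?_
          · intro n
            have hp : 0 < ‖Y (σ n)‖ := norm_pos_iff.2 (hY0 _)
            have h1 := (Nat.lt_floor_add_one (t * ‖Y (σ n)‖⁻¹)).le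
            have h2 := mul_le_mul_of_nonneg_right h1 hp.le
            rw [mul_assoc, inv_mul_cancel₀ hp.ne', mul_one] at h2
            show t - ‖Y (σ n)‖ ≤ _
            linarith
          · intro n
            have hp : 0 < ‖Y (σ n)‖ := norm_pos_iff.2 (hY0 _)
            have h1 : (⌊t * ‖Y (σ n)‖⁻¹⌋₊ : ℝ) ≤ t * ‖Y (σ n)‖⁻¹ := Nat.floor_le (by positivity)
            have h2 := mul_le_mul_of_nonneg_right h1 hp.le
            rwa [mul_assoc, inv_mul_cancel₀ hp.ne', mul_one] at h2
        have h3 := hfl.smul ((continuous_subtype_val.tendsto V).comp hlim)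
        refine h3.congr fun n => ?_
        have hp : ‖Y (σ n)‖ ≠ 0 := norm_ne_zero_iff.2 (hY0 _)
        simp only [Function.comp_apply, Submodule.coe_smul, smul_smul]
        rw [mul_assoc, mul_inv_cancel₀ hp, mul_one]
      rcases le_total 0 t with ht | ht
      · exact hpos t ht
      · have h1 := star_mem_matSet (hpos (-t) (by linarith))
        have h2 : star (exp ((-t) • (V : Mat N))) = exp (t • (V : Mat N)) := by
          have hmem := hpos (-t) (by linarith)
          obtain ⟨w, hw, hwe⟩ := hmem
          have hwe' : (w : Mat N) = exp ((-t) • (V : Mat N)) := hwe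
          have h4 : star (w : Mat N) * (w : Mat N) = 1 := (Unitary.mem_iff.1 w.2).1
          have h5 : exp ((-t) • (V : Mat N)) * exp (t • (V : Mat N)) = 1 := by
            rw [← exp_zero_smul_mul]; simp
          rw [← hwe'] at h5 ⊢
          calc star (w : Mat N) = star (w : Mat N) * ((w : Mat N) * exp (t • (V : Mat N))) := by
                rw [h5, mul_one]
            _ = _ := by rw [← mul_assoc, h4, one_mul]
        rwa [h2] at h1
    have hV0 : (V : Mat N) = 0 := by
      have : (V : Mat N) ∈ (lieAlg G ⊓ W : Submodule ℝ (Mat N)) := ⟨hVG, V.2⟩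
      rw [hW.inf_eq_bot] at this
      simpa using this
    have : ‖V‖ = 1 := mem_sphere_zero_iff_norm.1 hV
    rw [show V = 0 from Subtype.ext hV0] at this
    simp at this
  have hsmall : ∀ᶠ u : U N in 𝓝 1, ‖((ψ (u : Mat N)).1 : Mat N)‖ < ε := by
    have h1 : Tendsto (fun u : U N => ‖((ψ (u : Mat N)).1 : Mat N)‖) (𝓝 1) (𝓝 0) := by
      have h2 : Tendsto (fun u : U N => ψ (u : Mat N)) (𝓝 1) (𝓝 0) := by
        rw [← hψ0]
        exact hψc.tendsto.comp (continuous_coe_U.tendsto' 1 1 (by simp))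
      have h3 : Continuous (fun z : E × W => ‖(z.1 : Mat N)‖) := by fun_prop
      exact (h3.tendsto' 0 0 (by simp)).comp h2
    exact h1.eventually (gt_mem_nhds hε)
  filter_upwards [key, hsmall, (continuous_coe_U.tendsto' 1 1 (by simp)).eventually hloc]
    with u h1 h2 h3 hu
  refine ⟨(ψ (u : Mat N)).1, (ψ (u : Mat N)).1.2, h2, ?_⟩
  have h4 := h1 hu
  rw [h4, Submodule.coe_zero, exp_zero, mul_one] at h3
  exact h3

/-! ## The planar system -/

/-- `(x₁, x₂)` solves on `I` the system to which the homogeneous Ricci flow reduces. -/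
def IsPlanarFlow (a₁ b₁ a₂ b₂ : ℝ) (x₁ x₂ : ℝ → ℝ) (I : Set ℝ) : Prop :=
  ∀ t ∈ I, 0 < x₁ t ∧ 0 < x₂ t ∧
    HasDerivWithinAt x₁ (-2 * (a₁ + b₁ * (x₁ t / x₂ t) ^ 2)) I t ∧
    HasDerivWithinAt x₂ (-2 * (a₂ - b₂ * (x₁ t / x₂ t))) I t

/-- The quadratic polynomial whose positive roots are the ratios `x₁ / x₂` of Einstein metrics. -/
def einsteinPoly (a₁ b₁ a₂ b₂ y : ℝ) : ℝ := a₁ - a₂ * y + (b₁ + b₂) * y ^ 2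

variable {a₁ b₁ a₂ b₂ : ℝ}

/-- Were the discriminant nonnegative, the larger root would be positive because `a₂ > 0`. -/
theorem einsteinPoly_disc_neg (hb₁ : 0 ≤ b₁) (hb₂ : 0 < b₂) (ha₂ : 0 < a₂)
    (h : ∀ y, 0 < y → einsteinPoly a₁ b₁ a₂ b₂ y ≠ 0) :
    a₂ ^ 2 < 4 * (b₁ + b₂) * a₁ := by
  by_contra hcon
  push Not at hcon
  have hE : 0 < b₁ + b₂ := by linarith
  have hdisc : 0 ≤ a₂ ^ 2 - 4 * (b₁ + b₂) * a₁ := by linarith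
  refine h ((a₂ + Real.sqrt (a₂ ^ 2 - 4 * (b₁ + b₂) * a₁)) / (2 * (b₁ + b₂))) (by positivity) ?_
  have hs := Real.sq_sqrt hdisc
  set s := Real.sqrt (a₂ ^ 2 - 4 * (b₁ + b₂) * a₁)
  rw [einsteinPoly]
  field_simp
  linear_combination hs

theorem einsteinPoly_coeff_pos (hb₁ : 0 ≤ b₁) (hb₂ : 0 < b₂) (ha₂ : 0 < a₂)
    (h : ∀ y, 0 < y → einsteinPoly a₁ b₁ a₂ b₂ y ≠ 0) : 0 < a₁ := by
  have h1 := einsteinPoly_disc_neg hb₁ hb₂ ha₂ h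
  have hE : 0 < b₁ + b₂ := by linarith
  by_contra hcon
  push Not at hcon
  nlinarith [sq_nonneg a₂, mul_nonneg hE.le (neg_nonneg.2 hcon)]

/-- Completing the square; `δ` is the minimum of the polynomial. -/
theorem einsteinPoly_ge (hE : 0 < b₁ + b₂) (hd : a₂ ^ 2 < 4 * (b₁ + b₂) * a₁) :
    ∃ δ > 0, ∀ y, δ ≤ einsteinPoly a₁ b₁ a₂ b₂ y := by
  refine ⟨a₁ - a₂ ^ 2 / (4 * (b₁ + b₂)), ?_, fun y => ?_⟩
  · rw [gt_iff_lt, sub_pos, div_lt_iff₀ (by positivity)]; linarith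
  · have : einsteinPoly a₁ b₁ a₂ b₂ y - (a₁ - a₂ ^ 2 / (4 * (b₁ + b₂))) =
        (2 * (b₁ + b₂) * y - a₂) ^ 2 / (4 * (b₁ + b₂)) := by
      rw [einsteinPoly]; field_simp; ring
    have h2 : 0 ≤ (2 * (b₁ + b₂) * y - a₂) ^ 2 / (4 * (b₁ + b₂)) := by positivity
    linarith

/-- The ratio drives the whole system: its derivative has a constant sign once the polynomial has no
zero, and stationary ratios are Einstein ratios. -/
theorem IsPlanarFlow.hasDerivWithinAt_div {x₁ x₂ : ℝ → ℝ} {I : Set ℝ}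
    (h : IsPlanarFlow a₁ b₁ a₂ b₂ x₁ x₂ I) {t : ℝ} (ht : t ∈ I) :
    HasDerivWithinAt (fun s => x₁ s / x₂ s)
      (-2 * einsteinPoly a₁ b₁ a₂ b₂ (x₁ t / x₂ t) / x₂ t) I t := by
  obtain ⟨-, p₂, d₁, d₂⟩ := h t ht
  refine (d₁.fun_div d₂ p₂.ne').congr_deriv ?_
  rw [einsteinPoly]
  field_simp
  ring

theorem IsPlanarFlow.hasDerivWithinAt_log {x₁ x₂ : ℝ → ℝ} {I : Set ℝ}
    (h : IsPlanarFlow a₁ b₁ a₂ b₂ x₁ x₂ I) {t : ℝ} (ht : t ∈ I) :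
    HasDerivWithinAt (fun s => Real.log (x₂ s))
      (-2 * (a₂ - b₂ * (x₁ t / x₂ t)) / x₂ t) I t := by
  obtain ⟨-, p₂, -, d₂⟩ := h t ht
  exact d₂.log p₂.ne'

theorem antitoneOn_of_hasDerivWithinAt {I : Set ℝ} (hI : Convex ℝ I) {f f' : ℝ → ℝ}
    (h : ∀ t ∈ I, HasDerivWithinAt f (f' t) I t) (h' : ∀ t ∈ I, f' t ≤ 0) : AntitoneOn f I := by
  refine antitoneOn_of_hasDerivWithinAt_nonpos hI (fun t ht => (h t ht).continuousWithinAt)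
    (f' := f') (fun t ht => (h t (interior_subset ht)).mono interior_subset)
    (fun t ht => h' t (interior_subset ht))

/-- The planar system has no ancient solution. -/
theorem not_isPlanarFlow_Iio (hb₁ : 0 ≤ b₁) (hb₂ : 0 < b₂) (ha₂ : 0 < a₂)
    (h : ∀ y, 0 < y → einsteinPoly a₁ b₁ a₂ b₂ y ≠ 0) (x₁ x₂ : ℝ → ℝ) (T : ℝ) :
    ¬ IsPlanarFlow a₁ b₁ a₂ b₂ x₁ x₂ (Iio T) := by
  intro hf
  have ha₁ := einsteinPoly_coeff_pos hb₁ hb₂ ha₂ h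
  obtain ⟨δ, hδ, hP⟩ := einsteinPoly_ge (by linarith) (einsteinPoly_disc_neg hb₁ hb₂ ha₂ h)
  have hconv : Convex ℝ (Iio T) := convex_Iio T
  have hy : AntitoneOn (fun s => x₁ s / x₂ s) (Iio T) := by
    refine antitoneOn_of_hasDerivWithinAt hconv (fun t ht => hf.hasDerivWithinAt_div ht) ?_
    intro t ht
    have p₂ := (hf t ht).2.1
    have h1 := hP (x₁ t / x₂ t)
    refine div_nonpos_of_nonpos_of_nonneg ?_ p₂.le
    linarith
  have hx₁ : AntitoneOn (fun s => x₁ s + 2 * a₁ * s) (Iio T) := by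
    refine antitoneOn_of_hasDerivWithinAt hconv
      (fun t ht => (hf t ht).2.2.1.fun_add ((hasDerivWithinAt_id t _).const_mul (2 * a₁))) ?_
    intro t _
    have := mul_nonneg hb₁ (sq_nonneg (x₁ t / x₂ t))
    linarith
  -- At the threshold `2 a₂ / b₂` one has `a₂ - b₂ y = -a₂`. Since `y` decreases in time, once above
  -- the threshold it was above it at all earlier times.
  by_cases hM : ∃ t₀ ∈ Iio T, 2 * a₂ / b₂ ≤ x₁ t₀ / x₂ t₀
  · obtain ⟨t₀, ht₀, hM⟩ := hM
    have hsub : Iic t₀ ⊆ Iio T := fun s hs => lt_of_le_of_lt (mem_Iic.1 hs) (mem_Iio.1 ht₀)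
    have hx₂ : AntitoneOn (fun s => 2 * a₂ * s - x₂ s) (Iic t₀) := by
      refine antitoneOn_of_hasDerivWithinAt (convex_Iic t₀)
        (fun t ht => ((hasDerivWithinAt_id t _).const_mul (2 * a₂)).fun_sub
          ((hf t (hsub ht)).2.2.2.mono hsub)) ?_
      intro t ht
      have h1 : 2 * a₂ / b₂ ≤ x₁ t / x₂ t := hM.trans (hy (hsub ht) ht₀ ht)
      rw [div_le_iff₀ hb₂] at h1
      linarith
    have hpos := (hf t₀ ht₀).2.1
    -- At this earlier time the rate bound would already give `x₂ ≤ 0`.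
    have ht1 : t₀ - x₂ t₀ / (2 * a₂) ≤ t₀ := by
      have : 0 ≤ x₂ t₀ / (2 * a₂) := by positivity
      linarith
    have h2 := hx₂ (show t₀ - x₂ t₀ / (2 * a₂) ∈ Iic t₀ from ht1) (mem_Iic.2 le_rfl) ht1
    have h3 := (hf _ (hsub ht1)).2.1
    have h4 : 2 * a₂ * (t₀ - x₂ t₀ / (2 * a₂)) = 2 * a₂ * t₀ - x₂ t₀ := by
      field_simp
    simp only [h4] at h2
    linarith
  · push Not at hM
    set M := 2 * a₂ / b₂
    have hMpos : 0 < M := by positivity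
    -- `y' ≤ -2δ / x₂`, while `(log x₂)'` is at least `-2 a₂ / x₂`; the weight `δ / a₂` makes these
    -- two bounds cancel.
    have hlog : AntitoneOn (fun s => x₁ s / x₂ s - δ / a₂ * Real.log (x₂ s)) (Iio T) := by
      refine antitoneOn_of_hasDerivWithinAt hconv (fun t ht => (hf.hasDerivWithinAt_div ht).fun_sub
        ((hf.hasDerivWithinAt_log ht).const_mul (δ / a₂))) ?_
      intro t ht
      obtain ⟨p₁, p₂, -, -⟩ := hf t ht
      have h1 := hP (x₁ t / x₂ t)
      have e : -2 * einsteinPoly a₁ b₁ a₂ b₂ (x₁ t / x₂ t) / x₂ t -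
          δ / a₂ * (-2 * (a₂ - b₂ * (x₁ t / x₂ t)) / x₂ t) =
          (-2 * (einsteinPoly a₁ b₁ a₂ b₂ (x₁ t / x₂ t) - δ)
            - 2 * (δ / a₂) * (b₂ * (x₁ t / x₂ t))) / x₂ t := by
        field_simp
        ring
      rw [e]
      refine div_nonpos_of_nonpos_of_nonneg ?_ p₂.le
      have : 0 ≤ 2 * (δ / a₂) * (b₂ * (x₁ t / x₂ t)) := by positivity
      linarith
    -- Backwards in time `x₁` grows at least linearly, with slope `2 a₁ > 0`, and `x₂ > x₁ / M`.
    have hx₂ : Tendsto x₂ atBot atTop := by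
      have h1 : Tendsto (fun s => (x₁ (T - 1) + 2 * a₁ * (T - 1) - 2 * a₁ * s) / M) atBot atTop := by
        refine Tendsto.atTop_div_const hMpos ?_
        refine tendsto_atTop_add_const_left _ _ ?_
        simp only [← neg_mul]
        exact tendsto_id.const_mul_atBot_of_neg (by linarith)
      refine tendsto_atTop_mono' _ ?_ h1
      filter_upwards [eventually_le_atBot (T - 1)] with s hs
      have hsT : s ∈ Iio T := by simp only [mem_Iio]; linarith
      have h2 := hx₁ hsT (show T - 1 ∈ Iio T by simp) hs
      have h3 := hM s hsT
      have p₂ := (hf s hsT).2.1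
      rw [div_lt_iff₀ p₂] at h3
      rw [div_le_iff₀ hMpos]
      simp only [] at h2
      linarith
    have hlim := Real.tendsto_log_atTop.comp hx₂
    have hκ : 0 < δ / a₂ := by positivity
    have hlim2 := hlim.const_mul_atTop hκ
    -- Far enough in the past the monotone quantity in `hlog` forces `y > M`.
    have hev := hlim2.eventually_gt_atTop
      (M - (x₁ (T - 1) / x₂ (T - 1) - δ / a₂ * Real.log (x₂ (T - 1))))
    obtain ⟨s, hs1, hs2⟩ := (hev.and (eventually_le_atBot (T - 1))).exists
    have hsT : s ∈ Iio T := by simp only [mem_Iio]; linarith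
    have h2 := hlog hsT (show T - 1 ∈ Iio T by simp) hs2
    have h3 := hM s hsT
    simp only [Function.comp_apply] at hs1 h2
    linarith

theorem eq_of_hasDerivWithinAt_zero {I : Set ℝ} (hI : Convex ℝ I) {f : ℝ → ℝ}
    (h : ∀ t ∈ I, HasDerivWithinAt f 0 I t) {s t : ℝ} (hs : s ∈ I) (ht : t ∈ I) : f s = f t := by
  have := hI.norm_image_sub_le_of_norm_hasDerivWithin_le (C := 0) h (fun _ _ => by simp) hs ht
  rw [zero_mul] at this
  exact (sub_eq_zero.1 (norm_le_zero_iff.1 this)).symm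

/-- Every solution of the planar system collapses the first variable in finite time. -/
theorem exists_planarFlow (hb₁ : 0 ≤ b₁) (hb₂ : 0 < b₂) (ha₂ : 0 < a₂)
    (h : ∀ y, 0 < y → einsteinPoly a₁ b₁ a₂ b₂ y ≠ 0) {c₁ c₂ : ℝ} (hc₁ : 0 < c₁) (hc₂ : 0 < c₂) :
    ∃ (T : ℝ) (x₁ x₂ : ℝ → ℝ) (b : ℝ), 0 < T ∧ x₁ 0 = c₁ ∧ x₂ 0 = c₂ ∧
      IsPlanarFlow a₁ b₁ a₂ b₂ x₁ x₂ (Ico 0 T) ∧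
      (∀ (T' : ℝ) (y₁ y₂ : ℝ → ℝ), 0 < T' → y₁ 0 = c₁ → y₂ 0 = c₂ →
        IsPlanarFlow a₁ b₁ a₂ b₂ y₁ y₂ (Ico 0 T') →
          T' ≤ T ∧ ∀ t ∈ Ico 0 T', y₁ t = x₁ t ∧ y₂ t = x₂ t) ∧
      0 < b ∧ Tendsto x₁ (𝓝[<] T) (𝓝 0) ∧ Tendsto x₂ (𝓝[<] T) (𝓝 b) := by
  obtain ⟨δ, hδ, hP⟩ := einsteinPoly_ge (by linarith) (einsteinPoly_disc_neg hb₁ hb₂ ha₂ h)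
  have hPpos : ∀ y, 0 < einsteinPoly a₁ b₁ a₂ b₂ y := fun y => hδ.trans_le (hP y)
  have hPc : Continuous (einsteinPoly a₁ b₁ a₂ b₂) := by unfold einsteinPoly; fun_prop
  set P := einsteinPoly a₁ b₁ a₂ b₂
  set y₀ := c₁ / c₂
  have hy₀ : 0 < y₀ := by positivity
  set f : ℝ → ℝ := fun s => (a₂ - b₂ * s) / P s
  have hfc : Continuous f := (by fun_prop : Continuous fun s => a₂ - b₂ * s).div₀ hPc
    fun s => (hPpos s).ne'
  set F : ℝ → ℝ := fun y => ∫ s in y₀..y, f s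
  have hF : ∀ y, HasDerivAt F (f y) y := fun y => (hfc.integral_hasStrictDerivAt y₀ y).hasDerivAt
  have hF0 : F y₀ = 0 := intervalIntegral.integral_same
  have hFc : Continuous F := continuous_iff_continuousAt.2 fun y => (hF y).continuousAt
  -- `w = -dt / dy`: the time spent per unit decrease of the ratio, namely `x₂ / (2 P)`.
  set w : ℝ → ℝ := fun s => c₂ * Real.exp (F s) / (2 * P s)
  have hwpos : ∀ s, 0 < w s := fun s =>
    div_pos (mul_pos hc₂ (Real.exp_pos _)) (mul_pos two_pos (hPpos s))
  have hwc : Continuous w := (continuous_const.mul (Real.continuous_exp.comp hFc)).div₀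
    (continuous_const.mul hPc) fun s => (mul_pos two_pos (hPpos s)).ne'
  -- Only ratios in `[0, y₀]` occur. Freezing `w` outside this interval bounds it below by a
  -- positive constant, so that `θ`, which is minus the elapsed time, becomes an increasing
  -- bijection of the line with a globally continuous inverse.
  set cl : ℝ → ℝ := fun s => max 0 (min s y₀)
  have hclc : Continuous cl := by fun_prop
  have hcl : ∀ s, cl s ∈ Icc 0 y₀ := fun s =>
    ⟨le_max_left _ _, max_le hy₀.le (min_le_right _ _)⟩
  have hcl' : ∀ s ∈ Icc 0 y₀, cl s = s := fun s hs => by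
    simp only [cl, min_eq_left hs.2, max_eq_right hs.1]
  obtain ⟨s₀, -, hs₀⟩ := isCompact_Icc.exists_isMinOn (nonempty_Icc.2 hy₀.le) hwc.continuousOn
  set m := w s₀
  have hm : 0 < m := hwpos s₀
  have hwm : ∀ s, m ≤ w (cl s) := fun s => hs₀ (hcl s)
  have hwclc : Continuous (w ∘ cl) := hwc.comp hclc
  set θ : ℝ → ℝ := fun y => ∫ s in y₀..y, (w ∘ cl) s
  have hθ : ∀ y, HasDerivAt θ (w (cl y)) y := fun y =>
    (hwclc.integral_hasStrictDerivAt y₀ y).hasDerivAt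
  have hθ0 : θ y₀ = 0 := intervalIntegral.integral_same
  have hθc : Continuous θ := continuous_iff_continuousAt.2 fun y => (hθ y).continuousAt
  have hθm : StrictMono θ := strictMono_of_hasDerivAt_pos hθ fun y => hwpos _
  have hgrow : Monotone fun y => θ y - m * y := by
    refine monotone_of_hasDerivAt_nonneg (f' := fun y => w (cl y) - m * 1) (fun y =>
      (hθ y).fun_sub ((hasDerivAt_id y).const_mul m)) fun y => ?_
    have := hwm y
    simp only [Pi.zero_apply]; linarith
  have hsurj : Function.Surjective θ := by
    refine hθc.surjective ?_ ?_
    · refine tendsto_atTop_mono' _ ?_ (tendsto_atTop_add_const_right _ (θ 0)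
        (tendsto_id.const_mul_atTop hm))
      filter_upwards [eventually_ge_atTop 0] with y hy
      have := hgrow hy
      simp only [mul_zero, sub_zero] at this
      simp only [id]; linarith
    · refine tendsto_atBot_mono' _ ?_ (tendsto_atBot_add_const_right _ (θ 0)
        (tendsto_id.const_mul_atBot hm))
      filter_upwards [eventually_le_atBot 0] with y hy
      have := hgrow hy
      simp only [mul_zero, sub_zero] at this
      simp only [id]; linarith
  set Θ : ℝ ≃o ℝ := hθm.orderIsoOfSurjective θ hsurj
  have hΘ : ∀ y, Θ y = θ y := fun y => rfl
  set Y : ℝ → ℝ := fun t => Θ.symm (-t)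
  have hYc : Continuous Y := Θ.symm.continuous.comp continuous_neg
  have hθY : ∀ t, θ (Y t) = -t := fun t => by rw [← hΘ]; exact Θ.apply_symm_apply _
  have hYθ : ∀ y, Y (-θ y) = y := fun y => by simp [Y, ← hΘ]
  -- The moment when the ratio arrives at `0`.
  set T := -θ 0
  have hT : 0 < T := by
    have := hθm hy₀
    simp only [T]; linarith
  have hY0 : Y 0 = y₀ := by have := hYθ y₀; rwa [hθ0, neg_zero] at this
  have hYT : Y T = 0 := hYθ 0
  have hYmem : ∀ t ∈ Ico 0 T, 0 < Y t ∧ Y t ≤ y₀ := fun t ht => by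
    refine ⟨hθm.lt_iff_lt.1 ?_, hθm.le_iff_le.1 ?_⟩
    · rw [hθY]; simp only [T] at ht; linarith [ht.2]
    · rw [hθY, hθ0]; linarith [ht.1]
  have hYd : ∀ t ∈ Ico 0 T, HasDerivAt Y (-(w (Y t))⁻¹) t := fun t ht => by
    have hd : HasDerivAt (fun y => -θ y) (-(w (Y t))) (Y t) := by
      have := (hθ (Y t)).fun_neg
      rwa [hcl' _ ⟨(hYmem t ht).1.le, (hYmem t ht).2⟩] at this
    have := hd.of_local_left_inverse hYc.continuousAt (neg_ne_zero.2 (hwpos _).ne')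
      (Eventually.of_forall fun s => by simp [hθY])
    rwa [inv_neg] at this
  set x₂ : ℝ → ℝ := fun t => c₂ * Real.exp (F (Y t))
  set x₁ : ℝ → ℝ := fun t => Y t * x₂ t
  have hx₂pos : ∀ t, 0 < x₂ t := fun t => mul_pos hc₂ (Real.exp_pos _)
  have hx₂c : Continuous x₂ := continuous_const.mul (Real.continuous_exp.comp (hFc.comp hYc))
  have hw2 : ∀ t, (w (Y t))⁻¹ = 2 * P (Y t) / x₂ t := fun t => by simp only [w, x₂, inv_div]
  have hx₂d : ∀ t ∈ Ico 0 T, HasDerivAt x₂ (-2 * (a₂ - b₂ * Y t)) t := fun t ht => by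
    have h1 : HasDerivAt (fun s => F (Y s)) (f (Y t) * -(w (Y t))⁻¹) t :=
      (hF (Y t)).comp t (hYd t ht)
    refine (h1.exp.const_mul c₂).congr_deriv ?_
    have e1 : c₂ * (Real.exp (F (Y t)) * (f (Y t) * -(w (Y t))⁻¹)) =
      x₂ t * (f (Y t) * -(w (Y t))⁻¹) := by simp only [x₂]; ring
    rw [e1, hw2]
    simp only [f]
    have := hx₂pos t
    have := hPpos (Y t)
    field_simp
  have hx₁d : ∀ t ∈ Ico 0 T, HasDerivAt x₁ (-2 * (a₁ + b₁ * Y t ^ 2)) t := fun t ht => by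
    refine ((hYd t ht).fun_mul (hx₂d t ht)).congr_deriv ?_
    rw [hw2]
    have := hx₂pos t
    field_simp
    simp only [P, einsteinPoly]
    ring
  have hdiv : ∀ t, x₁ t / x₂ t = Y t := fun t => by
    simp only [x₁]; field_simp [(hx₂pos t).ne']
  refine ⟨T, x₁, x₂, x₂ T, hT, ?_, ?_, ?_, ?_, hx₂pos T, ?_, ?_⟩
  · simp only [x₁, x₂, hY0, hF0, Real.exp_zero, y₀]; field_simp
  · simp only [x₂, hY0, hF0, Real.exp_zero, mul_one]
  · intro t ht
    refine ⟨mul_pos (hYmem t ht).1 (hx₂pos t), hx₂pos t, ?_, ?_⟩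
    · rw [hdiv]; exact (hx₁d t ht).hasDerivWithinAt
    · rw [hdiv]; exact (hx₂d t ht).hasDerivWithinAt
  -- Any solution with these initial values conserves `log x₂ - F(y)` and `θ(y) + t`. The first
  -- determines `x₂` from `y`, the second determines `y` from `t`; and since `y` stays positive, the
  -- second also shows that the solution cannot live up to `T`.
  · intro T' y₁ y₂ hT' h1 h2 hf
    have hconv : Convex ℝ (Ico 0 T') := convex_Ico 0 T'
    have h0 : (0 : ℝ) ∈ Ico 0 T' := ⟨le_rfl, hT'⟩
    have hz0 : y₁ 0 / y₂ 0 = y₀ := by rw [h1, h2]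
    have hzanti : AntitoneOn (fun s => y₁ s / y₂ s) (Ico 0 T') := by
      refine antitoneOn_of_hasDerivWithinAt hconv (fun t ht => hf.hasDerivWithinAt_div ht) ?_
      intro t ht
      have p₂ := (hf t ht).2.1
      have := hPpos (y₁ t / y₂ t)
      refine div_nonpos_of_nonpos_of_nonneg ?_ p₂.le
      simp only [P] at this; linarith
    have hzmem : ∀ t ∈ Ico 0 T', y₁ t / y₂ t ∈ Icc 0 y₀ := fun t ht => by
      refine ⟨(div_pos (hf t ht).1 (hf t ht).2.1).le, ?_⟩
      rw [← hz0]; exact hzanti h0 ht ht.1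
    have hlog : ∀ t ∈ Ico 0 T', Real.log (y₂ t) - F (y₁ t / y₂ t) = Real.log c₂ := fun t ht => by
      have := eq_of_hasDerivWithinAt_zero hconv
        (f := fun s => Real.log (y₂ s) - F (y₁ s / y₂ s)) (fun s hs => ?_) ht h0
      · rw [this, hz0, hF0, h2, sub_zero]
      · refine ((hf.hasDerivWithinAt_log hs).fun_sub
          ((hF _).comp_hasDerivWithinAt s (hf.hasDerivWithinAt_div hs))).congr_deriv ?_
        have p₂ := (hf s hs).2.1
        have hp := hPpos (y₁ s / y₂ s)
        simp only [f, P] at hp ⊢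
        generalize einsteinPoly a₁ b₁ a₂ b₂ (y₁ s / y₂ s) = q at hp ⊢
        generalize y₁ s / y₂ s = z
        field_simp
        ring
    have hy₂ : ∀ t ∈ Ico 0 T', y₂ t = c₂ * Real.exp (F (y₁ t / y₂ t)) := fun t ht => by
      have e : Real.log (y₂ t) = Real.log c₂ + F (y₁ t / y₂ t) := by linarith [hlog t ht]
      rw [← Real.exp_log hc₂, ← Real.exp_add, ← e, Real.exp_log (hf t ht).2.1]
    have htime : ∀ t ∈ Ico 0 T', θ (y₁ t / y₂ t) = -t := fun t ht => by
      have := eq_of_hasDerivWithinAt_zero hconv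
        (f := fun s => θ (y₁ s / y₂ s) + s) (fun s hs => ?_) ht h0
      · simp only [hz0, hθ0] at this
        linarith
      · refine (((hθ _).comp_hasDerivWithinAt s (hf.hasDerivWithinAt_div hs)).fun_add
          (hasDerivWithinAt_id s _)).congr_deriv ?_
        rw [hcl' _ (hzmem s hs)]
        have p₂ := (hf s hs).2.1
        have hp := hPpos (y₁ s / y₂ s)
        have e := hy₂ s hs
        simp only [w]
        rw [← e]
        simp only [P] at hp ⊢
        field_simp
        ring
    have hlt : ∀ t ∈ Ico 0 T', t < T := fun t ht => by
      have := hθm (div_pos (hf t ht).1 (hf t ht).2.1)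
      rw [htime t ht] at this
      simp only [T]; linarith
    refine ⟨?_, fun t ht => ?_⟩
    · by_contra hcon
      push Not at hcon
      exact lt_irrefl _ (hlt T ⟨hT.le, hcon⟩)
    · have hYt : Y t = y₁ t / y₂ t := by
        rw [← hYθ (y₁ t / y₂ t), htime t ht, neg_neg]
      have e2 : y₂ t = x₂ t := by rw [hy₂ t ht]; simp only [x₂, hYt]
      refine ⟨?_, e2⟩
      simp only [x₁]
      rw [← e2, hYt]
      field_simp [(hf t ht).2.1.ne']
  -- `Y` and `x₂` are continuous on the whole line, so the limits are the values at `T`, where `Y T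
  -- = 0`.
  · have : Tendsto x₁ (𝓝 T) (𝓝 (x₁ T)) := (hYc.mul hx₂c).tendsto T
    simp only [x₁, hYT, zero_mul] at this
    exact this.mono_left nhdsWithin_le_nhds
  · exact (hx₂c.tendsto T).mono_left nhdsWithin_le_nhds

/-! ## Linear algebra of positive definite forms -/

section LinearAlgebra

variable {V : Type*} [AddCommGroup V] [Module ℝ V] [FiniteDimensional ℝ V]

theorem exists_orthonormal_basis (Q : LinearMap.BilinForm ℝ V) (hs : ∀ x y, Q x y = Q y x)
    (hp : ∀ x, x ≠ 0 → 0 < Q x x) : ∃ e : Fin (Module.finrank ℝ V) → V,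
      (∀ i j, Q (e i) (e j) = if i = j then 1 else 0) ∧ ∀ x, x = ∑ i, Q x (e i) • e i := by
  let core : InnerProductSpace.Core ℝ V :=
    { inner := fun x y => Q x y
      conj_inner_symm := fun x y => by simp [hs x y]
      re_inner_nonneg := fun x => by
        rcases eq_or_ne x 0 with rfl | hx
        · simp
        · exact (hp x hx).le
      add_left := fun x y z => by simp
      smul_left := fun x y r => by simp
      definite := fun x hx => by
        by_contra h
        exact (hp x h).ne' hx }
  let _ : NormedAddCommGroup V := core.toNormedAddCommGroup
  let _ : InnerProductSpace ℝ V := InnerProductSpace.ofCore core.toCore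
  have hin : ∀ x y : V, inner ℝ x y = Q x y := fun _ _ => rfl
  refine ⟨stdOrthonormalBasis ℝ V, fun i j => ?_, fun x => ?_⟩
  · rw [← hin, orthonormal_iff_ite.1 (stdOrthonormalBasis ℝ V).orthonormal]
  · conv_lhs => rw [← (stdOrthonormalBasis ℝ V).sum_repr' x]
    exact Finset.sum_congr rfl fun i _ => by rw [hin, hs]

/-- The operator `T` representing `g` with respect to `Q` is symmetric for the inner product `Q`, so
the supremum of its Rayleigh quotient is an eigenvalue. -/
theorem exists_eigenvector [Nontrivial V] (Q g : LinearMap.BilinForm ℝ V)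
    (hs : ∀ x y, Q x y = Q y x) (hp : ∀ x, x ≠ 0 → 0 < Q x x) (hg : ∀ x y, g x y = g y x) :
    ∃ (c : ℝ) (v : V), v ≠ 0 ∧ ∀ w, g v w = c * Q v w := by
  obtain ⟨e, -, hspan⟩ := exists_orthonormal_basis Q hs hp
  let core : InnerProductSpace.Core ℝ V :=
    { inner := fun x y => Q x y
      conj_inner_symm := fun x y => by simp [hs x y]
      re_inner_nonneg := fun x => by
        rcases eq_or_ne x 0 with rfl | hx
        · simp
        · exact (hp x hx).le
      add_left := fun x y z => by simp
      smul_left := fun x y r => by simp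
      definite := fun x hx => by
        by_contra h
        exact (hp x h).ne' hx }
  let _ : NormedAddCommGroup V := core.toNormedAddCommGroup
  let _ : InnerProductSpace ℝ V := InnerProductSpace.ofCore core.toCore
  have hin : ∀ x y : V, inner ℝ x y = Q x y := fun _ _ => rfl
  let T : V →ₗ[ℝ] V := ∑ i, (g.flip (e i)).smulRight (e i)
  have hT : ∀ x y, Q (T x) y = g x y := fun x y => by
    conv_rhs => rw [hspan y]
    simp [T, LinearMap.sum_apply, mul_comm, hs y]
  have hsym : T.IsSymmetric := fun x y => by
    rw [hin, hin, hT, hs, hT, hg]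
  obtain ⟨v, hv⟩ := hsym.hasEigenvalue_iSup_of_finiteDimensional.exists_hasEigenvector
  generalize ((⨆ x : { x : V // x ≠ 0 }, RCLike.re (inner ℝ (T x) (x : V)) / ‖(x : V)‖ ^ 2 : ℝ)) = c at hv
  refine ⟨c, v, hv.2, fun w => ?_⟩
  rw [← hT, hv.apply_eq_smul]
  simp

/-- The expansion writes `A` as a sum of rank-one maps, whose traces are known. Linear independence
of the `v i` is not needed. -/
theorem trace_eq_sum_of_expansion {ι : Type*} [Fintype ι] (v : ι → V) (φ : ι → V →ₗ[ℝ] ℝ)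
    (h : ∀ x, x = ∑ i, φ i x • v i) (A : V →ₗ[ℝ] V) :
    LinearMap.trace ℝ V A = ∑ i, φ i (A (v i)) := by
  have e : A = ∑ i, (φ i).smulRight (A (v i)) := by
    ext x
    conv_lhs => rw [h x]
    simp [LinearMap.sum_apply]
  conv_lhs => rw [e]
  rw [map_sum]
  exact Finset.sum_congr rfl fun i _ => LinearMap.trace_smulRight _ _

end LinearAlgebra

/-- `e` is a `Q`-orthonormal basis of `W`. -/
structure IsONBasis {N : ℕ} (Q : LinearMap.BilinForm ℝ (Mat N)) (W : Submodule ℝ (Mat N))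
    {ι : Type*} [Fintype ι] [DecidableEq ι] (e : ι → Mat N) : Prop where
  mem : ∀ i, e i ∈ W
  orth : ∀ i j, Q (e i) (e j) = if i = j then 1 else 0
  expand : ∀ X ∈ W, X = ∑ i, Q X (e i) • e i

/-! ### `Q`-orthonormal bases, orthogonal complements and Schur's lemma -/

section

variable {N : ℕ} {G H K : Subgroup (U N)} {Q : LinearMap.BilinForm ℝ (Mat N)}
  {W W₁ W₂ : Submodule ℝ (Mat N)}

theorem IsBackground.nonneg (hQ : IsBackground G Q) {X : Mat N} (hX : X ∈ lieAlg G) :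
    0 ≤ Q X X := by
  rcases eq_or_ne X 0 with rfl | h
  · simp
  · exact (hQ.pos X hX h).le

theorem IsBackground.eq_zero (hQ : IsBackground G Q) {X : Mat N} (hX : X ∈ lieAlg G)
    (h : Q X X = 0) : X = 0 := by
  by_contra hne
  exact (hQ.pos X hX hne).ne' h

theorem IsBackground.exists_isONBasis (hQ : IsBackground G Q) (hW : W ≤ lieAlg G) :
    ∃ e : Fin (Module.finrank ℝ W) → Mat N, IsONBasis Q W e := by
  obtain ⟨e, he, hs⟩ := exists_orthonormal_basis (V := W) (Q.compl₁₂ W.subtype W.subtype)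
    (fun x y => hQ.symm _ (hW x.2) _ (hW y.2))
    (fun x hx => hQ.pos _ (hW x.2) (by simpa using hx))
  refine ⟨fun i => e i, fun i => (e i).2, fun i j => he i j, fun X hX => ?_⟩
  have := congrArg (Subtype.val) (hs ⟨X, hX⟩)
  simpa using this

/-- Parseval's identity. -/
theorem IsONBasis.parseval {ι : Type*} [Fintype ι] [DecidableEq ι] {e : ι → Mat N}
    (he : IsONBasis Q W e) {X : Mat N} (hX : X ∈ W) (Y : Mat N) :
    Q X Y = ∑ i, Q X (e i) * Q (e i) Y := by
  conv_lhs => rw [he.expand X hX]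
  simp [LinearMap.sum_apply]

/-- The orthogonal decomposition of an invariant scalar product. -/
theorem IsBackground.exists_add (hQ : IsBackground G Q) (hW : W ≤ lieAlg G) {X : Mat N}
    (hX : X ∈ lieAlg G) : ∃ A ∈ W, X - A ∈ lieAlg G ⊓ Q.orthogonal W := by
  obtain ⟨e, he⟩ := hQ.exists_isONBasis hW
  have hA : ∑ i, Q X (e i) • e i ∈ W := W.sum_mem fun i _ => W.smul_mem _ (he.mem i)
  refine ⟨_, hA, (lieAlg G).sub_mem hX (hW hA), ?_⟩
  refine LinearMap.BilinForm.mem_orthogonal_iff.2 ?_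
  intro Y hY
  have e1 := he.parseval hY X
  have e2 : Q Y (∑ i, Q X (e i) • e i) = ∑ i, Q Y (e i) * Q (e i) X := by
    simp only [map_sum, map_smul, smul_eq_mul]
    exact Finset.sum_congr rfl fun i _ => by rw [hQ.symm X hX _ (hW (he.mem i)), mul_comm]
  rw [map_sub, e2, e1, sub_self]

theorem IsAdInvariant.orthogonal (hQ : IsBackground G Q) (hHG : H ≤ G) (hW : W ≤ lieAlg G)
    (h : IsAdInvariant H W) : IsAdInvariant H (lieAlg G ⊓ Q.orthogonal W) := by
  intro u hu X hX
  refine ⟨Ad_mem_lieAlg (hHG hu) hX.1, ?_⟩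
  refine LinearMap.BilinForm.mem_orthogonal_iff.2 ?_
  intro Y hY
  have hY' := h _ (H.inv_mem hu) Y hY
  have := hQ.inv u (hHG hu) _ (hW hY') X hX.1
  rw [Ad_Ad_inv] at this
  rw [this]
  exact (LinearMap.BilinForm.mem_orthogonal_iff.1 hX.2) _ hY'

/-- `B` is an `Ad(K)`-invariant pairing. -/
def IsAdPairing (K : Subgroup (U N)) (B : W₁ →ₗ[ℝ] W₂ →ₗ[ℝ] ℝ) : Prop :=
  ∀ u ∈ K, ∀ (X X' : W₁) (Y Y' : W₂), (X' : Mat N) = Ad u X → (Y' : Mat N) = Ad u Y →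
    B X' Y' = B X Y

/-- Schur's lemma for invariant symmetric forms. -/
theorem IsAdIrreducible.eq_smul (hQ : IsBackground G Q) (hKG : K ≤ G) (hW : W ≤ lieAlg G)
    (h : IsAdIrreducible K W) {B : LinearMap.BilinForm ℝ W} (hB : ∀ X Y, B X Y = B Y X)
    (hinv : IsAdPairing K B) : ∃ c : ℝ, ∀ X Y : W, B X Y = c * Q X Y := by
  obtain ⟨hI, hne, hirr⟩ := h
  have : Nontrivial W := Submodule.nontrivial_iff_ne_bot.2 hne
  obtain ⟨c, v, hv, hvw⟩ := exists_eigenvector (V := W) (Q.compl₁₂ W.subtype W.subtype) B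
    (fun x y => hQ.symm _ (hW x.2) _ (hW y.2))
    (fun x hx => hQ.pos _ (hW x.2) (by simpa using hx)) hB
  refine ⟨c, ?_⟩
  -- The `c`-eigenspace of `B` relative to `Q` is an `Ad(K)`-submodule and contains `v`, so
  -- irreducibility makes it all of `W`.
  let S : Submodule ℝ W := LinearMap.ker (B - c • Q.compl₁₂ W.subtype W.subtype)
  have hS : ∀ X, X ∈ S ↔ ∀ Y, B X Y = c * Q X Y := fun X => by
    rw [LinearMap.mem_ker, LinearMap.ext_iff]
    refine forall_congr' fun Y => ?_
    simp [sub_eq_zero]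
  have hinvS : IsAdInvariant K (S.map W.subtype) := by
    rintro u hu _ ⟨X, hX, rfl⟩
    refine ⟨⟨Ad u X, hI u hu _ X.2⟩, (hS _).2 fun Y => ?_, rfl⟩
    have e1 := hinv u hu X ⟨Ad u X, hI u hu _ X.2⟩ ⟨Ad u⁻¹ Y, hI _ (K.inv_mem hu) _ Y.2⟩ Y rfl
      (Ad_Ad_inv u _).symm
    have e2 := hQ.inv u (hKG hu) X (hW X.2) (Ad u⁻¹ Y) (hW (hI _ (K.inv_mem hu) _ Y.2))
    rw [Ad_Ad_inv] at e2
    rw [e1, (hS X).1 hX]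
    simp only [e2]
  rcases hirr _ (Submodule.map_subtype_le W S) hinvS with h0 | h1
  · exfalso
    apply hv
    have : (v : Mat N) ∈ S.map W.subtype := ⟨v, (hS v).2 hvw, rfl⟩
    rw [h0] at this
    simpa using this
  · intro X
    have : (X : Mat N) ∈ S.map W.subtype := by rw [h1]; exact X.2
    obtain ⟨X', hX', e⟩ := this
    have : X' = X := Subtype.ext e
    subst this
    exact (hS _).1 hX'

/-- Schur's lemma for invariant pairings of inequivalent modules. -/
theorem IsAdPairing.eq_zero (hQ : IsBackground G Q) (hKG : K ≤ G) (hW₂ : W₂ ≤ lieAlg G)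
    (h₁ : IsAdIrreducible K W₁) (h₂ : IsAdIrreducible K W₂) (hne : ¬ AdEquivalent K W₁ W₂)
    {B : W₁ →ₗ[ℝ] W₂ →ₗ[ℝ] ℝ} (hinv : IsAdPairing K B) (X : W₁) (Y : W₂) : B X Y = 0 := by
  obtain ⟨f, hf⟩ := hQ.exists_isONBasis hW₂
  -- `φ` represents the pairing through `Q` and is equivariant. Its kernel and range are submodules,
  -- so `φ` is zero or an equivalence, and the latter is excluded.
  let φ : W₁ →ₗ[ℝ] W₂ := ∑ i, (B.flip ⟨f i, hf.mem i⟩).smulRight ⟨f i, hf.mem i⟩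
  have hφ : ∀ (X : W₁) (Y : W₂), Q (φ X) Y = B X Y := fun X Y => by
    have e : Y = ∑ i, Q Y (f i) • (⟨f i, hf.mem i⟩ : W₂) := by
      apply Subtype.ext
      simpa using hf.expand Y Y.2
    conv_rhs => rw [e]
    simp only [φ, LinearMap.sum_apply, LinearMap.smulRight_apply, LinearMap.flip_apply, map_sum,
      map_smul, smul_eq_mul, Submodule.coe_sum, Submodule.coe_smul, LinearMap.smul_apply]
    exact Finset.sum_congr rfl fun i _ => by
      rw [hQ.symm _ (hW₂ (hf.mem i)) _ (hW₂ Y.2), mul_comm]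
  have heq : ∀ u ∈ K, ∀ X Y : W₁, (Y : Mat N) = Ad u (X : Mat N) →
      ((φ Y : W₂) : Mat N) = Ad u (φ X : Mat N) := by
    intro u hu X Y hXY
    have hm : Ad u (φ X : Mat N) ∈ W₂ := h₂.1 u hu _ (φ X).2
    have hd : ((φ Y : W₂) : Mat N) - Ad u (φ X : Mat N) ∈ W₂ := W₂.sub_mem (φ Y).2 hm
    have key : ∀ Z : W₂, Q ((φ Y : W₂) - Ad u (φ X : Mat N) : Mat N) Z = 0 := fun Z => by
      have hZ' := h₂.1 _ (K.inv_mem hu) _ Z.2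
      have e1 := hinv u hu X Y ⟨Ad u⁻¹ Z, hZ'⟩ Z hXY (Ad_Ad_inv u _).symm
      have e2 := hQ.inv u (hKG hu) (φ X) (hW₂ (φ X).2) (Ad u⁻¹ Z) (hW₂ hZ')
      rw [Ad_Ad_inv] at e2
      rw [map_sub, LinearMap.sub_apply, hφ, e1, e2, ← hφ, sub_self]
    exact sub_eq_zero.1 (hQ.eq_zero (hW₂ hd) (key ⟨_, hd⟩))
  by_cases h0 : φ = 0
  · rw [← hφ, h0]; simp
  exfalso
  have hkerI : IsAdInvariant K ((LinearMap.ker φ).map W₁.subtype) := by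
    rintro u hu _ ⟨X, hX, rfl⟩
    refine ⟨⟨Ad u X, h₁.1 u hu _ X.2⟩, ?_, rfl⟩
    rw [SetLike.mem_coe, LinearMap.mem_ker] at hX ⊢
    apply Subtype.ext
    rw [heq u hu X _ rfl, hX]
    simp [Ad]
  have hranI : IsAdInvariant K ((LinearMap.range φ).map W₂.subtype) := by
    rintro u hu _ ⟨_, ⟨X, rfl⟩, rfl⟩
    exact ⟨φ ⟨Ad u X, h₁.1 u hu _ X.2⟩, ⟨_, rfl⟩, heq u hu X _ rfl⟩
  have hinj : Function.Injective φ := by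
    rw [← LinearMap.ker_eq_bot]
    rcases h₁.2.2 _ (Submodule.map_subtype_le _ _) hkerI with h | h
    · exact Submodule.map_injective_of_injective W₁.injective_subtype (h.trans (Submodule.map_bot _).symm)
    · exfalso
      apply h0
      ext1 X
      have : (X : Mat N) ∈ (LinearMap.ker φ).map W₁.subtype := by rw [h]; exact X.2
      obtain ⟨X', hX', e⟩ := this
      rw [← show X' = X from Subtype.ext e]
      exact hX'
  have hsurj : Function.Surjective φ := by
    rcases h₂.2.2 _ (Submodule.map_subtype_le _ _) hranI with h | h
    · exfalso
      apply h0
      have h' := Submodule.map_injective_of_injective W₂.injective_subtype (h.trans (Submodule.map_bot _).symm)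
      exact LinearMap.range_eq_bot.1 h'
    · intro Y
      have : (Y : Mat N) ∈ (LinearMap.range φ).map W₂.subtype := by rw [h]; exact Y.2
      obtain ⟨Y', ⟨X, hX⟩, e⟩ := this
      exact ⟨X, hX.trans (Subtype.ext e)⟩
  exact hne ⟨LinearEquiv.ofBijective φ ⟨hinj, hsurj⟩, heq⟩

/-- Equivariance of the projection. -/
theorem proj_Ad {k p : Submodule ℝ (Mat N)} (hd : Disjoint k p) (hk : IsAdInvariant H k)
    (hp : IsAdInvariant H p) {u : U N} (hu : u ∈ H) {X : Mat N} (hX : X ∈ k ⊔ p) :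
    (proj k p (Ad u X) : Mat N) = Ad u (proj k p X) := by
  obtain ⟨A, hA, B, hB, rfl⟩ := Submodule.mem_sup.1 hX
  have e : Ad u (A + B) = Ad u A + Ad u B := (adLin u).map_add A B
  rw [e, map_add, map_add, proj_apply_left hd hA, proj_apply_left hd (hk u hu A hA), zero_add,
    zero_add, proj_apply_right hd ⟨B, hB⟩, proj_apply_right hd ⟨Ad u B, hp u hu B hB⟩]

end

/-! ## The decomposition of the Lie algebra -/

section

variable {N : ℕ} {G H K : Subgroup (U N)} {Q : LinearMap.BilinForm ℝ (Mat N)}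
  {p₁ p₂ : Submodule ℝ (Mat N)}

theorem proj_sub_mem {k p : Submodule ℝ (Mat N)} (hd : Disjoint k p) {X : Mat N}
    (hX : X ∈ k ⊔ p) : X - proj k p X ∈ k := by
  obtain ⟨A, hA, B, hB, rfl⟩ := Submodule.mem_sup.1 hX
  rw [map_add, proj_apply_left hd hA, proj_apply_right hd ⟨B, hB⟩]
  simpa using hA

theorem IsBackground.disjoint_of_orthogonal (hQ : IsBackground G Q) {W W' : Submodule ℝ (Mat N)}
    (hW : W ≤ lieAlg G) (h : ∀ X ∈ W, ∀ Y ∈ W', Q X Y = 0) : Disjoint W W' := by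
  rw [Submodule.disjoint_def]
  exact fun X hX hX' => hQ.eq_zero (hW hX) (h X hX X hX')

/-- The bracket as a bilinear map. -/
noncomputable def commLin (N : ℕ) : Mat N →ₗ[ℝ] Mat N →ₗ[ℝ] Mat N :=
  LinearMap.mk₂ ℝ comm (fun X Y Z => by simp only [comm]; noncomm_ring)
    (fun c X Y => by simp only [comm, smul_mul_assoc, mul_smul_comm, smul_sub])
    (fun X Y Z => by simp only [comm]; noncomm_ring)
    (fun c X Y => by simp only [comm, smul_mul_assoc, mul_smul_comm, smul_sub])

@[simp] theorem commLin_apply (X Y : Mat N) : commLin N X Y = comm X Y := rfl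

@[simp] theorem comm_neg_left (X Y : Mat N) : comm (-X) Y = -comm X Y := by
  rw [← commLin_apply, map_neg]; rfl

@[simp] theorem comm_smul_left (c : ℝ) (X Y : Mat N) : comm (c • X) Y = c • comm X Y := by
  rw [← commLin_apply, map_smul]; rfl

@[simp] theorem comm_smul_right (c : ℝ) (X Y : Mat N) : comm X (c • Y) = c • comm X Y := by
  rw [← commLin_apply, map_smul]; rfl

theorem comm_add_left (X Y Z : Mat N) : comm (X + Y) Z = comm X Z + comm Y Z := by
  rw [← commLin_apply, map_add]; rfl

theorem comm_add_right (X Y Z : Mat N) : comm X (Y + Z) = comm X Y + comm X Z := by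
  rw [← commLin_apply, map_add]; rfl

@[simp] theorem comm_self (X : Mat N) : comm X X = 0 := by simp [comm]

@[simp] theorem comm_zero_left (X : Mat N) : comm 0 X = 0 := by simp [comm]

@[simp] theorem comm_zero_right (X : Mat N) : comm X 0 = 0 := by simp [comm]

/-- With `tri_cycle`, this makes `Q([X, Y], Z)` a totally antisymmetric trilinear form on `𝔤`; the
connection and curvature computations rest on it. -/
theorem IsBackground.tri_swap (hQ : IsBackground G Q) {X Y Z : Mat N} (hX : X ∈ lieAlg G)
    (hY : Y ∈ lieAlg G) (hZ : Z ∈ lieAlg G) : Q (comm X Y) Z = - Q (comm X Z) Y := by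
  rw [hQ.ad_skew hX hY hZ, hQ.symm _ hY _ (comm_mem_lieAlg hX hZ)]

theorem IsBackground.tri_cycle (hQ : IsBackground G Q) {X Y Z : Mat N} (hX : X ∈ lieAlg G)
    (hY : Y ∈ lieAlg G) (hZ : Z ∈ lieAlg G) : Q (comm X Y) Z = Q (comm Y Z) X := by
  rw [comm_swap X Y, map_neg, LinearMap.neg_apply, hQ.tri_swap hY hX hZ, neg_neg]

namespace NonMaximalTwoSummand

variable (h : NonMaximalTwoSummand G H K Q p₁ p₂)
include h

theorem K_le_G : K ≤ G := h.K_le_H.trans h.H_le_G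

theorem k_le : lieAlg K ≤ lieAlg G := lieAlg_mono h.K_le_G

theorem p₁_le : p₁ ≤ lieAlg G := h.le₁.trans inf_le_left

theorem p₂_le : p₂ ≤ lieAlg G := h.le₂.trans inf_le_left

theorem orth_k {X Y : Mat N} (hX : X ∈ lieAlg K) (hY : Y ∈ isotropy Q G K) : Q X Y = 0 :=
  (LinearMap.BilinForm.mem_orthogonal_iff.1 hY.2) X hX

theorem orth_k' {X Y : Mat N} (hX : X ∈ lieAlg K) (hY : Y ∈ isotropy Q G K) : Q Y X = 0 := by
  rw [h.background.symm _ hY.1 _ (h.k_le hX), h.orth_k hX hY]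

/-- `Q` itself is an invariant pairing of the inequivalent modules `p₁` and `p₂`. The hypotheses
give only disjointness. -/
theorem orth₁₂ {X Y : Mat N} (hX : X ∈ p₁) (hY : Y ∈ p₂) : Q X Y = 0 := by
  refine IsAdPairing.eq_zero h.background h.K_le_G h.p₂_le h.irreducible₁ h.irreducible₂
    h.inequivalent (B := Q.compl₁₂ p₁.subtype p₂.subtype) ?_ ⟨X, hX⟩ ⟨Y, hY⟩
  intro u hu X X' Y Y' e e'
  simp only [LinearMap.compl₁₂_apply, Submodule.subtype_apply, e, e']
  exact h.background.inv u (h.K_le_G hu) _ (h.p₁_le X.2) _ (h.p₂_le Y.2)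

theorem orth₂₁ {X Y : Mat N} (hX : X ∈ p₁) (hY : Y ∈ p₂) : Q Y X = 0 := by
  rw [h.background.symm _ (h.p₂_le hY) _ (h.p₁_le hX), h.orth₁₂ hX hY]

theorem disjoint_k_p : Disjoint (lieAlg K) (isotropy Q G K) :=
  h.background.disjoint_of_orthogonal h.k_le fun _ hX _ hY => h.orth_k hX hY

theorem k_sup_p : lieAlg K ⊔ isotropy Q G K = lieAlg G := by
  refine le_antisymm (sup_le h.k_le inf_le_left) fun X hX => ?_
  obtain ⟨A, hA, hXA⟩ := h.background.exists_add h.k_le hX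
  exact Submodule.mem_sup.2 ⟨A, hA, X - A, hXA, by simp⟩

theorem lieAlg_H_le : lieAlg H ≤ lieAlg G := lieAlg_mono h.H_le_G

theorem orth_H {X Y : Mat N} (hX : X ∈ lieAlg H) (hY : Y ∈ p₂) : Q X Y = 0 := by
  rw [h.lieAlg_H] at hX
  obtain ⟨A, hA, B, hB, rfl⟩ := Submodule.mem_sup.1 hX
  rw [map_add, LinearMap.add_apply, h.orth_k hA (h.le₂ hY), h.orth₁₂ hB hY, add_zero]

theorem H_sup_p₂ : lieAlg H ⊔ p₂ = lieAlg G := by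
  rw [h.lieAlg_H, sup_assoc, h.sum, h.k_sup_p]

theorem disjoint_H_p₂ : Disjoint (lieAlg H) p₂ :=
  h.background.disjoint_of_orthogonal h.lieAlg_H_le fun _ hX _ hY => h.orth_H hX hY

/-- As `𝔥 + p₂ = 𝔤` and `𝔥 ⟂ p₂`, the summand `p₂` is the isotropy representation of `G/H`. This
upgrades its assumed `Ad(K)`-invariance to `Ad(H)`-invariance. -/
theorem p₂_eq : p₂ = isotropy Q G H := by
  refine le_antisymm (fun X hX => ⟨h.p₂_le hX,
    LinearMap.BilinForm.mem_orthogonal_iff.2 fun Y hY => h.orth_H hY hX⟩) fun X hX => ?_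
  have hXG : X ∈ lieAlg H ⊔ p₂ := by rw [h.H_sup_p₂]; exact hX.1
  obtain ⟨A, hA, B, hB, rfl⟩ := Submodule.mem_sup.1 hXG
  have h1 : Q A (A + B) = 0 := LinearMap.BilinForm.mem_orthogonal_iff.1 hX.2 A hA
  rw [map_add, h.orth_H hA hB, add_zero] at h1
  rwa [h.background.eq_zero (h.lieAlg_H_le hA) h1, zero_add]

theorem p₂_adInvariant : IsAdInvariant H p₂ := by
  rw [h.p₂_eq]
  exact IsAdInvariant.orthogonal h.background h.H_le_G h.lieAlg_H_le (isAdInvariant_lieAlg le_rfl)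

theorem p_adInvariant : IsAdInvariant K (isotropy Q G K) :=
  IsAdInvariant.orthogonal h.background h.K_le_G h.k_le (isAdInvariant_lieAlg le_rfl)

theorem disjoint_kp₂_p₁ : Disjoint (lieAlg K ⊔ p₂) p₁ := by
  refine h.background.disjoint_of_orthogonal (sup_le h.k_le h.p₂_le) fun X hX Y hY => ?_
  obtain ⟨A, hA, B, hB, rfl⟩ := Submodule.mem_sup.1 hX
  rw [map_add, LinearMap.add_apply, h.orth_k hA (h.le₁ hY), h.orth₂₁ hY hB, add_zero]

theorem kp₂_sup_p₁ : (lieAlg K ⊔ p₂) ⊔ p₁ = lieAlg G := by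
  rw [sup_assoc, sup_comm p₂, h.sum, h.k_sup_p]

theorem comm₁₁ {X Y : Mat N} (hX : X ∈ p₁) (hY : Y ∈ p₁) : comm X Y ∈ lieAlg H :=
  comm_mem_lieAlg (by rw [h.lieAlg_H]; exact Submodule.mem_sup_right hX)
    (by rw [h.lieAlg_H]; exact Submodule.mem_sup_right hY)

/-- Infinitesimal `Ad(H)`-invariance of `p₂`. Together with `[p₁, p₁] ⊆ 𝔥` it leaves, up to order,
only the structure constants `[111]`, `[122]` and `[222]`. -/
theorem comm₁₂ {X Y : Mat N} (hX : X ∈ p₁) (hY : Y ∈ p₂) : comm X Y ∈ p₂ :=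
  h.p₂_adInvariant.comm_mem (by rw [h.lieAlg_H]; exact Submodule.mem_sup_right hX) hY

theorem comm₂₁ {X Y : Mat N} (hX : X ∈ p₂) (hY : Y ∈ p₁) : comm X Y ∈ p₂ := by
  rw [comm_swap]; exact p₂.neg_mem (h.comm₁₂ hY hX)

end NonMaximalTwoSummand

/-- The component in `p₁`. -/
noncomputable def cp₁ (K : Subgroup (U N)) (p₁ p₂ : Submodule ℝ (Mat N)) : Mat N →ₗ[ℝ] Mat N :=
  p₁.subtype ∘ₗ proj (lieAlg K ⊔ p₂) p₁

/-- The component in `p₂`. -/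
noncomputable def cp₂ (H : Subgroup (U N)) (p₂ : Submodule ℝ (Mat N)) : Mat N →ₗ[ℝ] Mat N :=
  p₂.subtype ∘ₗ proj (lieAlg H) p₂

theorem cp₁_mem (X : Mat N) : cp₁ K p₁ p₂ X ∈ p₁ := (proj (lieAlg K ⊔ p₂) p₁ X).2

theorem cp₂_mem (X : Mat N) : cp₂ H p₂ X ∈ p₂ := (proj (lieAlg H) p₂ X).2

/-- The invariant metric `x₁ Q|p₁ + x₂ Q|p₂`. -/
noncomputable def diagForm (Q : LinearMap.BilinForm ℝ (Mat N)) (G H K : Subgroup (U N))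
    (p₁ p₂ : Submodule ℝ (Mat N)) (x₁ x₂ : ℝ) : LinearMap.BilinForm ℝ (isotropy Q G K) :=
  x₁ • Q.compl₁₂ (cp₁ K p₁ p₂ ∘ₗ (isotropy Q G K).subtype)
      (cp₁ K p₁ p₂ ∘ₗ (isotropy Q G K).subtype) +
    x₂ • Q.compl₁₂ (cp₂ H p₂ ∘ₗ (isotropy Q G K).subtype) (cp₂ H p₂ ∘ₗ (isotropy Q G K).subtype)

theorem diagForm_apply (x₁ x₂ : ℝ) (X Y : isotropy Q G K) :
    diagForm Q G H K p₁ p₂ x₁ x₂ X Y = x₁ * Q (cp₁ K p₁ p₂ X) (cp₁ K p₁ p₂ Y) +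
      x₂ * Q (cp₂ H p₂ X) (cp₂ H p₂ Y) := by
  simp [diagForm, LinearMap.add_apply, LinearMap.smul_apply]

/-- The Levi-Civita connection of `diagForm Q G H K p₁ p₂ x₁ x₂`, where `y = x₁ / x₂`. -/
noncomputable def diagConn (Q : LinearMap.BilinForm ℝ (Mat N)) (G H K : Subgroup (U N))
    (p₁ p₂ : Submodule ℝ (Mat N)) (y : ℝ) :
    isotropy Q G K →ₗ[ℝ] isotropy Q G K →ₗ[ℝ] isotropy Q G K :=
  ((1 / 2 : ℝ) • (commLin N).compl₁₂ (cp₁ K p₁ p₂ ∘ₗ (isotropy Q G K).subtype)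
      (cp₁ K p₁ p₂ ∘ₗ (isotropy Q G K).subtype) +
    (1 - y / 2) • (commLin N).compl₁₂ (cp₁ K p₁ p₂ ∘ₗ (isotropy Q G K).subtype)
      (cp₂ H p₂ ∘ₗ (isotropy Q G K).subtype) +
    (y / 2) • (commLin N).compl₁₂ (cp₂ H p₂ ∘ₗ (isotropy Q G K).subtype)
      (cp₁ K p₁ p₂ ∘ₗ (isotropy Q G K).subtype) +
    (1 / 2 : ℝ) • (commLin N).compl₁₂ (cp₂ H p₂ ∘ₗ (isotropy Q G K).subtype)
      (cp₂ H p₂ ∘ₗ (isotropy Q G K).subtype)).compr₂ (proj (lieAlg K) (isotropy Q G K))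

theorem diagConn_apply (y : ℝ) (X Y : isotropy Q G K) :
    diagConn Q G H K p₁ p₂ y X Y = proj (lieAlg K) (isotropy Q G K)
      ((1 / 2 : ℝ) • comm (cp₁ K p₁ p₂ X) (cp₁ K p₁ p₂ Y) +
        (1 - y / 2) • comm (cp₁ K p₁ p₂ X) (cp₂ H p₂ Y) +
        (y / 2) • comm (cp₂ H p₂ X) (cp₁ K p₁ p₂ Y) +
        (1 / 2 : ℝ) • comm (cp₂ H p₂ X) (cp₂ H p₂ Y)) := rfl

namespace NonMaximalTwoSummand

variable (h : NonMaximalTwoSummand G H K Q p₁ p₂)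
include h

theorem cp₁_of_mem {X : Mat N} (hX : X ∈ p₁) : cp₁ K p₁ p₂ X = X :=
  congrArg Subtype.val (proj_apply_right h.disjoint_kp₂_p₁ ⟨X, hX⟩)

theorem cp₂_of_mem {X : Mat N} (hX : X ∈ p₂) : cp₂ H p₂ X = X :=
  congrArg Subtype.val (proj_apply_right h.disjoint_H_p₂ ⟨X, hX⟩)

theorem cp₁_of_mem₂ {X : Mat N} (hX : X ∈ p₂) : cp₁ K p₁ p₂ X = 0 :=
  congrArg Subtype.val (proj_apply_left h.disjoint_kp₂_p₁ (Submodule.mem_sup_right hX))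

theorem cp₁_of_mem_k {X : Mat N} (hX : X ∈ lieAlg K) : cp₁ K p₁ p₂ X = 0 :=
  congrArg Subtype.val (proj_apply_left h.disjoint_kp₂_p₁ (Submodule.mem_sup_left hX))

theorem cp₂_of_mem_H {X : Mat N} (hX : X ∈ lieAlg H) : cp₂ H p₂ X = 0 :=
  congrArg Subtype.val (proj_apply_left h.disjoint_H_p₂ hX)

theorem cp₂_of_mem₁ {X : Mat N} (hX : X ∈ p₁) : cp₂ H p₂ X = 0 :=
  h.cp₂_of_mem_H (by rw [h.lieAlg_H]; exact Submodule.mem_sup_right hX)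

theorem cp₂_of_mem_k {X : Mat N} (hX : X ∈ lieAlg K) : cp₂ H p₂ X = 0 :=
  h.cp₂_of_mem_H (lieAlg_mono h.K_le_H hX)

theorem exists_decomp {X : Mat N} (hX : X ∈ lieAlg G) :
    ∃ A ∈ lieAlg K, ∃ B ∈ p₁, ∃ C ∈ p₂, X = A + (B + C) := by
  rw [← h.k_sup_p, ← h.sum] at hX
  obtain ⟨A, hA, W, hW, rfl⟩ := Submodule.mem_sup.1 hX
  obtain ⟨B, hB, C, hC, rfl⟩ := Submodule.mem_sup.1 hW
  exact ⟨A, hA, B, hB, C, hC, rfl⟩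

theorem proj_eq {X : Mat N} (hX : X ∈ lieAlg G) :
    (proj (lieAlg K) (isotropy Q G K) X : Mat N) = cp₁ K p₁ p₂ X + cp₂ H p₂ X := by
  obtain ⟨A, hA, B, hB, C, hC, rfl⟩ := h.exists_decomp hX
  have hBC : B + C ∈ isotropy Q G K := Submodule.add_mem _ (h.le₁ hB) (h.le₂ hC)
  rw [map_add, proj_apply_left h.disjoint_k_p hA, zero_add,
    proj_apply_right h.disjoint_k_p ⟨B + C, hBC⟩]
  simp only [map_add, h.cp₁_of_mem hB, h.cp₁_of_mem₂ hC, h.cp₁_of_mem_k hA, h.cp₂_of_mem hC,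
    h.cp₂_of_mem₁ hB, h.cp₂_of_mem_k hA]
  abel

theorem cp_add {X : Mat N} (hX : X ∈ isotropy Q G K) : cp₁ K p₁ p₂ X + cp₂ H p₂ X = X := by
  rw [← h.proj_eq hX.1, proj_apply_right h.disjoint_k_p ⟨X, hX⟩]

theorem sub_proj_mem {X : Mat N} (hX : X ∈ lieAlg G) :
    X - proj (lieAlg K) (isotropy Q G K) X ∈ lieAlg K :=
  proj_sub_mem h.disjoint_k_p (by rwa [h.k_sup_p])

theorem Q_proj {X Y : Mat N} (hX : X ∈ lieAlg G) (hY : Y ∈ isotropy Q G K) :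
    Q (proj (lieAlg K) (isotropy Q G K) X) Y = Q X Y := by
  have := h.orth_k (h.sub_proj_mem hX) hY
  rw [map_sub, LinearMap.sub_apply] at this
  linarith

theorem Q_cp₁ {X Y : Mat N} (hX : X ∈ lieAlg G) (hY : Y ∈ p₁) :
    Q (cp₁ K p₁ p₂ X) Y = Q X Y := by
  obtain ⟨A, hA, B, hB, C, hC, rfl⟩ := h.exists_decomp hX
  simp only [map_add, h.cp₁_of_mem hB, h.cp₁_of_mem₂ hC, h.cp₁_of_mem_k hA, LinearMap.add_apply,
    h.orth_k hA (h.le₁ hY), h.orth₂₁ hY hC, map_zero, LinearMap.zero_apply]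

theorem Q_cp₂ {X Y : Mat N} (hX : X ∈ lieAlg G) (hY : Y ∈ p₂) :
    Q (cp₂ H p₂ X) Y = Q X Y := by
  obtain ⟨A, hA, B, hB, C, hC, rfl⟩ := h.exists_decomp hX
  simp only [map_add, h.cp₂_of_mem hC, h.cp₂_of_mem₁ hB, h.cp₂_of_mem_k hA, LinearMap.add_apply,
    h.orth_k hA (h.le₂ hY), h.orth₁₂ hB hY, map_zero, LinearMap.zero_apply]

theorem cp₁_Ad {u : U N} (hu : u ∈ K) {X : Mat N} (hX : X ∈ lieAlg G) :
    cp₁ K p₁ p₂ (Ad u X) = Ad u (cp₁ K p₁ p₂ X) := by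
  refine proj_Ad (H := K) h.disjoint_kp₂_p₁ ?_ h.irreducible₁.1 hu (by rwa [h.kp₂_sup_p₁])
  intro u hu X hX
  obtain ⟨A, hA, B, hB, rfl⟩ := Submodule.mem_sup.1 hX
  have e : Ad u (A + B) = Ad u A + Ad u B := (adLin u).map_add A B
  rw [e]
  exact Submodule.add_mem_sup (Ad_mem_lieAlg hu hA) (h.irreducible₂.1 u hu B hB)

theorem cp₂_Ad {u : U N} (hu : u ∈ H) {X : Mat N} (hX : X ∈ lieAlg G) :
    cp₂ H p₂ (Ad u X) = Ad u (cp₂ H p₂ X) :=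
  proj_Ad (H := H) h.disjoint_H_p₂ (isAdInvariant_lieAlg le_rfl) h.p₂_adInvariant hu
    (by rwa [h.H_sup_p₂])

theorem projp_Ad {u : U N} (hu : u ∈ K) {X : Mat N} (hX : X ∈ lieAlg G) :
    (proj (lieAlg K) (isotropy Q G K) (Ad u X) : Mat N) =
      Ad u (proj (lieAlg K) (isotropy Q G K) X) :=
  proj_Ad (H := K) h.disjoint_k_p (isAdInvariant_lieAlg le_rfl) h.p_adInvariant hu
    (by rwa [h.k_sup_p])

/-! ## Diagonal metrics and their Levi-Civita connections -/

theorem isInvariantMetric_diagForm {x₁ x₂ : ℝ} (h₁ : 0 < x₁) (h₂ : 0 < x₂) :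
    IsInvariantMetric K (isotropy Q G K) (diagForm Q G H K p₁ p₂ x₁ x₂) where
  symm X Y := by
    rw [diagForm_apply, diagForm_apply, h.background.symm _ (h.p₁_le (cp₁_mem X)) _
      (h.p₁_le (cp₁_mem Y)), h.background.symm _ (h.p₂_le (cp₂_mem X)) _ (h.p₂_le (cp₂_mem Y))]
  pos X hX := by
    rw [diagForm_apply]
    have n1 := h.background.nonneg (h.p₁_le (cp₁_mem (K := K) (p₂ := p₂) X))
    have n2 := h.background.nonneg (h.p₂_le (cp₂_mem (H := H) X))
    refine lt_of_le_of_ne (by positivity) fun h0 => hX ?_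
    have z1 : Q (cp₁ K p₁ p₂ X) (cp₁ K p₁ p₂ X) = 0 := by
      have := mul_nonneg h₂.le n2
      have := mul_nonneg h₁.le n1
      exact (mul_eq_zero.1 (by linarith : x₁ * Q (cp₁ K p₁ p₂ X) (cp₁ K p₁ p₂ X) = 0)).resolve_left
        h₁.ne'
    have z2 : Q (cp₂ H p₂ X) (cp₂ H p₂ X) = 0 := by
      rw [z1] at h0
      exact (mul_eq_zero.1 (by linarith : x₂ * Q (cp₂ H p₂ X) (cp₂ H p₂ X) = 0)).resolve_left h₂.ne'
    have := h.cp_add X.2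
    rw [h.background.eq_zero (h.p₁_le (cp₁_mem _)) z1,
      h.background.eq_zero (h.p₂_le (cp₂_mem _)) z2, add_zero] at this
    exact Subtype.ext this.symm
  inv u hu X Y X' Y' e e' := by
    rw [diagForm_apply, diagForm_apply, e, e', h.cp₁_Ad hu X.2.1, h.cp₁_Ad hu Y.2.1,
      h.cp₂_Ad (h.K_le_H hu) X.2.1, h.cp₂_Ad (h.K_le_H hu) Y.2.1,
      h.background.inv u (h.K_le_G hu) _ (h.p₁_le (cp₁_mem _)) _ (h.p₁_le (cp₁_mem _)),
      h.background.inv u (h.K_le_G hu) _ (h.p₂_le (cp₂_mem _)) _ (h.p₂_le (cp₂_mem _))]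

/-- Every invariant metric is diagonal. -/
theorem exists_eq_diagForm {g : LinearMap.BilinForm ℝ (isotropy Q G K)}
    (hg : IsInvariantMetric K (isotropy Q G K) g) :
    ∃ x₁ x₂ : ℝ, 0 < x₁ ∧ 0 < x₂ ∧ g = diagForm Q G H K p₁ p₂ x₁ x₂ := by
  obtain ⟨c₁, hc₁⟩ := h.irreducible₁.eq_smul h.background h.K_le_G h.p₁_le
    (B := restrictForm h.le₁ g) (fun X Y => hg.symm _ _)
    (fun u hu X X' Y Y' e e' => hg.inv u hu _ _ _ _ e e')
  obtain ⟨c₂, hc₂⟩ := h.irreducible₂.eq_smul h.background h.K_le_G h.p₂_le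
    (B := restrictForm h.le₂ g) (fun X Y => hg.symm _ _)
    (fun u hu X X' Y Y' e e' => hg.inv u hu _ _ _ _ e e')
  -- The mixed block of `g` is an invariant pairing of inequivalent modules, hence zero.
  have hcr := IsAdPairing.eq_zero h.background h.K_le_G h.p₂_le h.irreducible₁ h.irreducible₂
    h.inequivalent (B := g.compl₁₂ (Submodule.inclusion h.le₁) (Submodule.inclusion h.le₂))
    (fun u hu X X' Y Y' e e' => hg.inv u hu _ _ _ _ e e')
  have pos₁ : 0 < c₁ := by
    obtain ⟨X, hX, hX0⟩ := Submodule.exists_mem_ne_zero_of_ne_bot h.irreducible₁.2.1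
    have e := hc₁ ⟨X, hX⟩ ⟨X, hX⟩
    have p := hg.pos ⟨X, h.le₁ hX⟩ (fun h0 => hX0 (congrArg Subtype.val h0))
    have q := h.background.pos X (h.p₁_le hX) hX0
    have e' : g ⟨X, h.le₁ hX⟩ ⟨X, h.le₁ hX⟩ = c₁ * Q X X := e
    rw [e'] at p
    exact pos_of_mul_pos_left p q.le
  have pos₂ : 0 < c₂ := by
    obtain ⟨X, hX, hX0⟩ := Submodule.exists_mem_ne_zero_of_ne_bot h.irreducible₂.2.1
    have e := hc₂ ⟨X, hX⟩ ⟨X, hX⟩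
    have p := hg.pos ⟨X, h.le₂ hX⟩ (fun h0 => hX0 (congrArg Subtype.val h0))
    have q := h.background.pos X (h.p₂_le hX) hX0
    have e' : g ⟨X, h.le₂ hX⟩ ⟨X, h.le₂ hX⟩ = c₂ * Q X X := e
    rw [e'] at p
    exact pos_of_mul_pos_left p q.le
  refine ⟨c₁, c₂, pos₁, pos₂, ?_⟩
  ext X Y
  have d : ∀ X : isotropy Q G K, X = Submodule.inclusion h.le₁ ⟨_, cp₁_mem X⟩ +
      Submodule.inclusion h.le₂ ⟨_, cp₂_mem X⟩ := fun X => Subtype.ext (h.cp_add X.2).symm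
  have hcr' : ∀ (A : p₁) (B : p₂), g (Submodule.inclusion h.le₁ A) (Submodule.inclusion h.le₂ B) = 0 :=
    fun A B => hcr A B
  have hc₁' : ∀ (A B : p₁), g (Submodule.inclusion h.le₁ A) (Submodule.inclusion h.le₁ B) = c₁ * Q A B :=
    fun A B => hc₁ A B
  have hc₂' : ∀ (A B : p₂), g (Submodule.inclusion h.le₂ A) (Submodule.inclusion h.le₂ B) = c₂ * Q A B :=
    fun A B => hc₂ A B
  conv_lhs => rw [d X, d Y]
  simp only [map_add, LinearMap.add_apply, hcr', hg.symm (Submodule.inclusion h.le₂ _)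
    (Submodule.inclusion h.le₁ _), hc₁', hc₂', diagForm_apply]
  ring

theorem diagForm_inj {x₁ x₂ y₁ y₂ : ℝ}
    (e : diagForm Q G H K p₁ p₂ x₁ x₂ = diagForm Q G H K p₁ p₂ y₁ y₂) : x₁ = y₁ ∧ x₂ = y₂ := by
  constructor
  · obtain ⟨X, hX, hX0⟩ := Submodule.exists_mem_ne_zero_of_ne_bot h.irreducible₁.2.1
    have e1 := LinearMap.congr_fun₂ e ⟨X, h.le₁ hX⟩ ⟨X, h.le₁ hX⟩
    simp only [diagForm_apply, h.cp₁_of_mem hX, h.cp₂_of_mem₁ hX, map_zero, mul_zero,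
      add_zero] at e1
    exact mul_right_cancel₀ (h.background.pos X (h.p₁_le hX) hX0).ne' e1
  · obtain ⟨X, hX, hX0⟩ := Submodule.exists_mem_ne_zero_of_ne_bot h.irreducible₂.2.1
    have e1 := LinearMap.congr_fun₂ e ⟨X, h.le₂ hX⟩ ⟨X, h.le₂ hX⟩
    simp only [diagForm_apply, h.cp₂_of_mem hX, h.cp₁_of_mem₂ hX, map_zero, mul_zero,
      zero_add] at e1
    exact mul_right_cancel₀ (h.background.pos X (h.p₂_le hX) hX0).ne' e1

/-- The coefficients in `diagConn` are those of Koszul's formula: vanishing torsion makes the two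
mixed coefficients sum to `1`, and compatibility with the metric requires `x₁ / 2 = x₂ (y / 2)`,
that is `y = x₁ / x₂`. -/
theorem isLeviCivita_diagConn {x₁ x₂ : ℝ} (h₂ : 0 < x₂) :
    IsLeviCivita (lieAlg K) (isotropy Q G K) (diagForm Q G H K p₁ p₂ x₁ x₂)
      (diagConn Q G H K p₁ p₂ (x₁ / x₂)) where
  metric X Y Z := by
    have hQ := h.background
    -- After discarding the brackets that are orthogonal to their partner, total antisymmetry makes
    -- what remains skew in `Y` and `Z`.
    have key : ∀ X Y Z : isotropy Q G K, diagForm Q G H K p₁ p₂ x₁ x₂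
        (diagConn Q G H K p₁ p₂ (x₁ / x₂) X Y) Z =
        x₁ * (1 / 2 * Q (comm (cp₁ K p₁ p₂ X) (cp₁ K p₁ p₂ Y)) (cp₁ K p₁ p₂ Z) +
          1 / 2 * Q (comm (cp₂ H p₂ X) (cp₂ H p₂ Y)) (cp₁ K p₁ p₂ Z)) +
        x₂ * ((1 - x₁ / x₂ / 2) * Q (comm (cp₁ K p₁ p₂ X) (cp₂ H p₂ Y)) (cp₂ H p₂ Z) +
          (x₁ / x₂ / 2) * Q (comm (cp₂ H p₂ X) (cp₁ K p₁ p₂ Y)) (cp₂ H p₂ Z) +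
          1 / 2 * Q (comm (cp₂ H p₂ X) (cp₂ H p₂ Y)) (cp₂ H p₂ Z)) := by
      intro X Y Z
      have m1 : ∀ X : Mat N, cp₁ K p₁ p₂ X ∈ p₁ := cp₁_mem
      have m2 : ∀ X : Mat N, cp₂ H p₂ X ∈ p₂ := cp₂_mem
      have z1 : Q (comm (cp₁ K p₁ p₂ X) (cp₁ K p₁ p₂ Y)) (cp₂ H p₂ Z) = 0 :=
        h.orth_H (h.comm₁₁ (m1 X) (m1 Y)) (m2 Z)
      have z2 : Q (comm (cp₁ K p₁ p₂ X) (cp₂ H p₂ Y)) (cp₁ K p₁ p₂ Z) = 0 :=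
        h.orth₂₁ (m1 Z) (h.comm₁₂ (m1 X) (m2 Y))
      have z3 : Q (comm (cp₂ H p₂ X) (cp₁ K p₁ p₂ Y)) (cp₁ K p₁ p₂ Z) = 0 :=
        h.orth₂₁ (m1 Z) (h.comm₂₁ (m2 X) (m1 Y))
      have hW := (diagConn Q G H K p₁ p₂ (x₁ / x₂) X Y).2
      have hin : (1 / 2 : ℝ) • comm (cp₁ K p₁ p₂ X) (cp₁ K p₁ p₂ Y) +
          (1 - x₁ / x₂ / 2) • comm (cp₁ K p₁ p₂ X) (cp₂ H p₂ Y) +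
          (x₁ / x₂ / 2) • comm (cp₂ H p₂ X) (cp₁ K p₁ p₂ Y) +
          (1 / 2 : ℝ) • comm (cp₂ H p₂ X) (cp₂ H p₂ Y) ∈ lieAlg G := by
        have g1 := fun X => h.p₁_le (m1 X)
        have g2 := fun X => h.p₂_le (m2 X)
        refine add_mem (add_mem (add_mem ?_ ?_) ?_) ?_ <;>
          refine Submodule.smul_mem _ _ (comm_mem_lieAlg ?_ ?_) <;> first | exact g1 _ | exact g2 _
      rw [diagForm_apply, h.Q_cp₁ hW.1 (m1 Z), h.Q_cp₂ hW.1 (m2 Z), diagConn_apply,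
        h.Q_proj hin (h.le₁ (m1 Z)), h.Q_proj hin (h.le₂ (m2 Z))]
      simp only [map_add, LinearMap.add_apply, map_smul, LinearMap.smul_apply, smul_eq_mul, z1, z2,
        z3]
      ring
    have hsymm : diagForm Q G H K p₁ p₂ x₁ x₂ Y (diagConn Q G H K p₁ p₂ (x₁ / x₂) X Z) =
        diagForm Q G H K p₁ p₂ x₁ x₂ (diagConn Q G H K p₁ p₂ (x₁ / x₂) X Z) Y := by
      rw [diagForm_apply, diagForm_apply, hQ.symm _ (h.p₁_le (cp₁_mem Y)) _
        (h.p₁_le (cp₁_mem _)), hQ.symm _ (h.p₂_le (cp₂_mem Y)) _ (h.p₂_le (cp₂_mem _))]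
    rw [hsymm, key, key]
    have m1 : ∀ X : Mat N, cp₁ K p₁ p₂ X ∈ lieAlg G := fun X => h.p₁_le (cp₁_mem X)
    have m2 : ∀ X : Mat N, cp₂ H p₂ X ∈ lieAlg G := fun X => h.p₂_le (cp₂_mem X)
    rw [hQ.tri_swap (m1 X) (m1 Z) (m1 Y), hQ.tri_swap (m2 X) (m2 Z) (m1 Y),
      hQ.tri_swap (m1 X) (m2 Z) (m2 Y), hQ.tri_swap (m2 X) (m1 Z) (m2 Y),
      hQ.tri_swap (m2 X) (m2 Z) (m2 Y)]
    field_simp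
    ring
  torsion_free X Y := by
    rw [diagConn_apply, diagConn_apply, ← map_sub]
    congr 1
    have e : ∀ X : isotropy Q G K, (X : Mat N) = cp₁ K p₁ p₂ X + cp₂ H p₂ X :=
      fun X => (h.cp_add X.2).symm
    conv_rhs => rw [e X, e Y, comm_add_left, comm_add_right, comm_add_right]
    rw [comm_swap (cp₁ K p₁ p₂ Y) (cp₁ K p₁ p₂ X), comm_swap (cp₁ K p₁ p₂ Y) (cp₂ H p₂ X),
      comm_swap (cp₂ H p₂ Y) (cp₁ K p₁ p₂ X), comm_swap (cp₂ H p₂ Y) (cp₂ H p₂ X)]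
    module

end NonMaximalTwoSummand

/-- The Levi-Civita connection is unique. -/
theorem IsLeviCivita.unique {k p : Submodule ℝ (Mat N)} {g : LinearMap.BilinForm ℝ p}
    (hs : ∀ X Y : p, g X Y = g Y X) (hp : ∀ X : p, X ≠ 0 → 0 < g X X)
    {Λ Λ' : p →ₗ[ℝ] p →ₗ[ℝ] p} (h : IsLeviCivita k p g Λ) (h' : IsLeviCivita k p g Λ') :
    Λ = Λ' := by
  let D : p → p → p := fun X Y => Λ X Y - Λ' X Y
  have a : ∀ X Y Z, g (D X Y) Z = - g (D X Z) Y := fun X Y Z => by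
    have e1 := h.metric X Y Z
    have e2 := h'.metric X Y Z
    rw [hs Y] at e1 e2
    simp only [D, map_sub, LinearMap.sub_apply]
    linarith
  have b : ∀ X Y, D X Y = D Y X := fun X Y => by
    have e3 := (h.torsion_free X Y).trans (h'.torsion_free X Y).symm
    rw [← sub_eq_zero] at e3 ⊢
    rw [← e3]
    simp only [D]
    abel
  -- A trilinear form symmetric in its first two arguments and skew in its last two vanishes.
  have c : ∀ X Y Z, g (D X Y) Z = 0 := fun X Y Z => by
    have e1 := a X Y Z
    have e2 := a Z X Y
    have e3 := a Y Z X
    rw [b X Z] at e1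
    rw [b Z Y] at e2
    rw [b Y X] at e3
    linarith
  refine LinearMap.ext₂ fun X Y => ?_
  by_contra hne
  exact (hp _ (sub_ne_zero.2 hne)).ne' (c X Y _)

end

/-! ## The Ricci tensor of a diagonal metric -/

section

variable {N : ℕ} {G H K : Subgroup (U N)} {Q : LinearMap.BilinForm ℝ (Mat N)}
  {p₁ p₂ : Submodule ℝ (Mat N)}

/-- The Ricci tensor as a bilinear form. -/
noncomputable def ricciForm (k p : Submodule ℝ (Mat N)) (Λ : p →ₗ[ℝ] p →ₗ[ℝ] p) :
    LinearMap.BilinForm ℝ p :=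
  LinearMap.mk₂ ℝ (ricci k p Λ)
    (fun Y Y' Z => by
      rw [ricci, ricci, ricci, ← map_add]
      congr 1
      ext1 X
      have e : comm (comm (X : Mat N) Y + comm (X : Mat N) Y' -
          ((proj k p (comm X Y) : Mat N) + (proj k p (comm X Y') : Mat N))) Z =
          comm (comm (X : Mat N) Y - (proj k p (comm X Y) : Mat N)) Z +
          comm (comm (X : Mat N) Y' - (proj k p (comm X Y') : Mat N)) Z := by
        rw [← comm_add_left]; congr 1; abel
      simp only [curvature, LinearMap.coe_mk, AddHom.coe_mk, LinearMap.add_apply, map_add,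
        Submodule.coe_add, comm_add_right, e]
      abel)
    (fun c Y Z => by
      rw [ricci, ricci, ← map_smul]
      congr 1
      ext1 X
      simp only [curvature, LinearMap.coe_mk, AddHom.coe_mk, LinearMap.smul_apply, map_smul,
        Submodule.coe_smul, comm_smul_right, ← smul_sub, comm_smul_left]
      simp only [smul_sub])
    (fun Y Z Z' => by
      rw [ricci, ricci, ricci, ← map_add]
      congr 1
      ext1 X
      simp only [curvature, LinearMap.coe_mk, AddHom.coe_mk, LinearMap.add_apply, map_add,
        Submodule.coe_add, comm_add_right]
      abel)
    (fun c Y Z => by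
      rw [ricci, ricci, ← map_smul]
      congr 1
      ext1 X
      simp only [curvature, LinearMap.coe_mk, AddHom.coe_mk, LinearMap.smul_apply, map_smul,
        Submodule.coe_smul, comm_smul_right]
      simp only [smul_sub])

theorem ricciForm_apply (k p : Submodule ℝ (Mat N)) (Λ : p →ₗ[ℝ] p →ₗ[ℝ] p) (Y Z : p) :
    ricciForm k p Λ Y Z = ricci k p Λ Y Z := rfl

/-- The part of `[X, Y]` in the isotropy algebra. -/
noncomputable def commK (Q : LinearMap.BilinForm ℝ (Mat N)) (G K : Subgroup (U N))
    (X Y : Mat N) : Mat N :=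
  comm X Y - proj (lieAlg K) (isotropy Q G K) (comm X Y)

/-- `∑ Q([Y, eᵢ], [Z, eᵢ])`. -/
noncomputable def crossForm (Q : LinearMap.BilinForm ℝ (Mat N)) {ι : Type*} [Fintype ι]
    (e : ι → Mat N) (Y Z : Mat N) : ℝ :=
  ∑ i, Q (comm Y (e i)) (comm Z (e i))

/-- `∑ (Q([Y, eᵢ]_c, [Z, eᵢ]_c) / 4 + Q([Y, eᵢ]_k, [Z, eᵢ]_k))` where `c` is a projection. -/
noncomputable def selfForm (Q : LinearMap.BilinForm ℝ (Mat N)) (G K : Subgroup (U N))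
    (c : Mat N →ₗ[ℝ] Mat N) {ι : Type*} [Fintype ι] (e : ι → Mat N) (Y Z : Mat N) : ℝ :=
  ∑ i, (1 / 4 * Q (c (comm Y (e i))) (c (comm Z (e i))) +
    Q (commK Q G K Y (e i)) (commK Q G K Z (e i)))

namespace NonMaximalTwoSummand

variable (h : NonMaximalTwoSummand G H K Q p₁ p₂)
include h

theorem diagConn₁₁ (y : ℝ) {X Y : isotropy Q G K} (hX : (X : Mat N) ∈ p₁)
    (hY : (Y : Mat N) ∈ p₁) :
    (diagConn Q G H K p₁ p₂ y X Y : Mat N) = (1 / 2 : ℝ) • cp₁ K p₁ p₂ (comm X Y) := by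
  have hG := comm_mem_lieAlg (h.p₁_le hX) (h.p₁_le hY)
  simp only [diagConn_apply, h.cp₁_of_mem hX, h.cp₁_of_mem hY, h.cp₂_of_mem₁ hX,
    h.cp₂_of_mem₁ hY, comm_zero_left, comm_zero_right, smul_zero, add_zero, map_smul,
    Submodule.coe_smul, h.proj_eq hG, h.cp₂_of_mem_H (h.comm₁₁ hX hY)]

theorem diagConn₁₂ (y : ℝ) {X Y : isotropy Q G K} (hX : (X : Mat N) ∈ p₁)
    (hY : (Y : Mat N) ∈ p₂) :
    (diagConn Q G H K p₁ p₂ y X Y : Mat N) = (1 - y / 2) • comm (X : Mat N) Y := by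
  have hG := comm_mem_lieAlg (h.p₁_le hX) (h.p₂_le hY)
  simp only [diagConn_apply, h.cp₁_of_mem hX, h.cp₁_of_mem₂ hY, h.cp₂_of_mem₁ hX,
    h.cp₂_of_mem hY, comm_zero_left, comm_zero_right, smul_zero, add_zero, zero_add, map_smul,
    Submodule.coe_smul, h.proj_eq hG, h.cp₂_of_mem (h.comm₁₂ hX hY),
    h.cp₁_of_mem₂ (h.comm₁₂ hX hY)]

theorem diagConn₂₁ (y : ℝ) {X Y : isotropy Q G K} (hX : (X : Mat N) ∈ p₂)
    (hY : (Y : Mat N) ∈ p₁) :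
    (diagConn Q G H K p₁ p₂ y X Y : Mat N) = (y / 2) • comm (X : Mat N) Y := by
  have hG := comm_mem_lieAlg (h.p₂_le hX) (h.p₁_le hY)
  simp only [diagConn_apply, h.cp₁_of_mem hY, h.cp₁_of_mem₂ hX, h.cp₂_of_mem₁ hY,
    h.cp₂_of_mem hX, comm_zero_left, comm_zero_right, smul_zero, add_zero, zero_add, map_smul,
    Submodule.coe_smul, h.proj_eq hG, h.cp₂_of_mem (h.comm₂₁ hX hY),
    h.cp₁_of_mem₂ (h.comm₂₁ hX hY)]

theorem diagConn₂₂ (y : ℝ) {X Y : isotropy Q G K} (hX : (X : Mat N) ∈ p₂)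
    (hY : (Y : Mat N) ∈ p₂) :
    (diagConn Q G H K p₁ p₂ y X Y : Mat N) =
      (1 / 2 : ℝ) • (cp₁ K p₁ p₂ (comm X Y) + cp₂ H p₂ (comm X Y)) := by
  have hG := comm_mem_lieAlg (h.p₂_le hX) (h.p₂_le hY)
  simp only [diagConn_apply, h.cp₁_of_mem₂ hX, h.cp₁_of_mem₂ hY, h.cp₂_of_mem hX,
    h.cp₂_of_mem hY, comm_zero_left, comm_zero_right, smul_zero, zero_add, map_smul,
    Submodule.coe_smul, h.proj_eq hG]

theorem Q_cp₁_cp₁ {X Y : Mat N} (hX : X ∈ lieAlg G) :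
    Q X (cp₁ K p₁ p₂ Y) = Q (cp₁ K p₁ p₂ X) (cp₁ K p₁ p₂ Y) :=
  (h.Q_cp₁ hX (cp₁_mem Y)).symm

theorem Q_cp₂_cp₂ {X Y : Mat N} (hX : X ∈ lieAlg G) :
    Q X (cp₂ H p₂ Y) = Q (cp₂ H p₂ X) (cp₂ H p₂ Y) :=
  (h.Q_cp₂ hX (cp₂_mem Y)).symm

/-- Every component of the bracket paired with `X` dies by skewness. This removes the term `Λ E (Λ Y
Z)` from the Ricci trace. -/
theorem diagConn_self₁ (y : ℝ) {X : isotropy Q G K} (hX : (X : Mat N) ∈ p₁)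
    (W : isotropy Q G K) : Q (diagConn Q G H K p₁ p₂ y X W) X = 0 := by
  have hW : W = ⟨_, h.le₁ (cp₁_mem (W : Mat N))⟩ + ⟨_, h.le₂ (cp₂_mem (W : Mat N))⟩ :=
    Subtype.ext (h.cp_add W.2).symm
  have g1 := h.p₁_le (cp₁_mem (K := K) (p₂ := p₂) (W : Mat N))
  rw [hW, map_add, Submodule.coe_add, h.diagConn₁₁ y hX (cp₁_mem _),
    h.diagConn₁₂ y hX (cp₂_mem _)]
  simp only [map_add, map_smul, LinearMap.add_apply, LinearMap.smul_apply, smul_eq_mul]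
  rw [h.Q_cp₁ (comm_mem_lieAlg X.2.1 g1) hX, h.orth₂₁ hX (h.comm₁₂ hX (cp₂_mem _)),
    h.background.tri_swap X.2.1 g1 X.2.1]
  simp

theorem diagConn_self₂ (y : ℝ) {X : isotropy Q G K} (hX : (X : Mat N) ∈ p₂)
    (W : isotropy Q G K) : Q (diagConn Q G H K p₁ p₂ y X W) X = 0 := by
  have hW : W = ⟨_, h.le₁ (cp₁_mem (W : Mat N))⟩ + ⟨_, h.le₂ (cp₂_mem (W : Mat N))⟩ :=
    Subtype.ext (h.cp_add W.2).symm
  have g1 := h.p₁_le (cp₁_mem (K := K) (p₂ := p₂) (W : Mat N))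
  have g2 := h.p₂_le (cp₂_mem (H := H) (W : Mat N))
  rw [hW, map_add, Submodule.coe_add, h.diagConn₂₁ y hX (cp₁_mem _),
    h.diagConn₂₂ y hX (cp₂_mem _)]
  simp only [map_add, map_smul, LinearMap.add_apply, LinearMap.smul_apply, smul_eq_mul]
  rw [h.Q_cp₂ (comm_mem_lieAlg X.2.1 g2) hX, h.orth₁₂ (cp₁_mem _) hX,
    h.background.tri_swap X.2.1 g1 X.2.1, h.background.tri_swap X.2.1 g2 X.2.1]
  simp

/-- The contribution of the isotropy part of the bracket to the Ricci tensor. -/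
theorem Q_isotropy_term {E Y Z : isotropy Q G K} :
    Q (proj (lieAlg K) (isotropy Q G K) (comm (comm (E : Mat N) Y -
      (proj (lieAlg K) (isotropy Q G K) (comm (E : Mat N) Y) : Mat N)) Z)) E =
      - Q (commK Q G K Y E) (commK Q G K Z E) := by
  have hu := comm_mem_lieAlg Y.2.1 E.2.1
  have hv := comm_mem_lieAlg Z.2.1 E.2.1
  have hk : commK Q G K (Y : Mat N) E ∈ lieAlg K := h.sub_proj_mem hu
  have e : comm (E : Mat N) Y - (proj (lieAlg K) (isotropy Q G K) (comm (E : Mat N) Y) : Mat N) =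
      - commK Q G K Y E := by
    rw [commK, comm_swap (E : Mat N) Y]
    simp only [map_neg, Submodule.coe_neg]
    abel
  rw [e, h.Q_proj (comm_mem_lieAlg (neg_mem (h.k_le hk)) Z.2.1) E.2, comm_neg_left, map_neg,
    LinearMap.neg_apply, h.background.tri_cycle (h.k_le hk) Z.2.1 E.2.1]
  have e2 : comm (Z : Mat N) E = commK Q G K Z E +
      proj (lieAlg K) (isotropy Q G K) (comm (Z : Mat N) E) := by simp [commK]
  rw [e2, map_add, LinearMap.add_apply, h.orth_k' hk (proj _ _ (comm (Z : Mat N) E)).2, add_zero,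
    h.background.symm (commK Q G K Z E) (h.k_le (h.sub_proj_mem hv)) _ (h.k_le hk)]

/-- The four curvature lemmas compute the diagonal of the Ricci trace, with `E` in the summand of
the first index and `Y`, `Z` in that of the other two. In each, the terms `Λ Y (Λ E Z)` and `Λ [E,
Y] Z` are turned by antisymmetry into pairings of components of `[Y, E]` and `[Z, E]`, and the
isotropy term adds the `𝔨`-parts. -/
theorem curvature₁₁₁ (y : ℝ) {E Y Z : isotropy Q G K} (hE : (E : Mat N) ∈ p₁)
    (hY : (Y : Mat N) ∈ p₁) (hZ : (Z : Mat N) ∈ p₁) :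
    Q (curvature (lieAlg K) (isotropy Q G K) (diagConn Q G H K p₁ p₂ y) Y Z E) E =
      1 / 4 * Q (cp₁ K p₁ p₂ (comm Y E)) (cp₁ K p₁ p₂ (comm Z E)) +
        Q (commK Q G K Y E) (commK Q G K Z E) := by
  have hu := comm_mem_lieAlg Y.2.1 E.2.1
  have hv := comm_mem_lieAlg Z.2.1 E.2.1
  have gu := h.p₁_le (cp₁_mem (K := K) (p₂ := p₂) (comm (Y : Mat N) E))
  have gv := h.p₁_le (cp₁_mem (K := K) (p₂ := p₂) (comm (Z : Mat N) E))
  have hV : (diagConn Q G H K p₁ p₂ y E Z : Mat N) =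
      (-(1 / 2) : ℝ) • cp₁ K p₁ p₂ (comm (Z : Mat N) E) := by
    rw [h.diagConn₁₁ y hE hZ, comm_swap, map_neg, smul_neg, neg_smul]
  have hVm : (diagConn Q G H K p₁ p₂ y E Z : Mat N) ∈ p₁ := by
    rw [hV]; exact p₁.smul_mem _ (cp₁_mem _)
  have t2 : Q (diagConn Q G H K p₁ p₂ y Y (diagConn Q G H K p₁ p₂ y E Z)) E =
      1 / 4 * Q (cp₁ K p₁ p₂ (comm Y E)) (cp₁ K p₁ p₂ (comm Z E)) := by
    rw [h.diagConn₁₁ y hY hVm, map_smul, LinearMap.smul_apply,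
      h.Q_cp₁ (comm_mem_lieAlg Y.2.1 (h.p₁_le hVm)) hE, hV, comm_smul_right, map_smul,
      LinearMap.smul_apply, h.background.tri_swap Y.2.1 gv E.2.1, h.Q_cp₁_cp₁ hu]
    simp only [smul_eq_mul]
    ring
  have hU : (proj (lieAlg K) (isotropy Q G K) (comm (E : Mat N) Y) : Mat N) =
      - cp₁ K p₁ p₂ (comm (Y : Mat N) E) := by
    rw [h.proj_eq (comm_mem_lieAlg E.2.1 Y.2.1), h.cp₂_of_mem_H (h.comm₁₁ hE hY), comm_swap,
      map_neg, add_zero]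
  have t3 : Q (diagConn Q G H K p₁ p₂ y (proj (lieAlg K) (isotropy Q G K) (comm (E : Mat N) Y)) Z) E
      = - (1 / 2) * Q (cp₁ K p₁ p₂ (comm Y E)) (cp₁ K p₁ p₂ (comm Z E)) := by
    have hUm : (proj (lieAlg K) (isotropy Q G K) (comm (E : Mat N) Y) : Mat N) ∈ p₁ := by
      rw [hU]; exact p₁.neg_mem (cp₁_mem _)
    rw [h.diagConn₁₁ y hUm hZ, map_smul, LinearMap.smul_apply,
      h.Q_cp₁ (comm_mem_lieAlg (h.p₁_le hUm) Z.2.1) hE, hU, comm_neg_left, map_neg,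
      LinearMap.neg_apply, h.background.tri_cycle gu Z.2.1 E.2.1, h.Q_cp₁_cp₁ hv,
      h.background.symm _ gv _ gu]
    simp only [smul_eq_mul]
    ring
  simp only [curvature, LinearMap.coe_mk, AddHom.coe_mk, Submodule.coe_sub, map_sub,
    LinearMap.sub_apply, h.diagConn_self₁ y hE, t2, t3, h.Q_isotropy_term]
  ring

theorem curvature₂₁₁ (y : ℝ) {E Y Z : isotropy Q G K} (hE : (E : Mat N) ∈ p₂)
    (hY : (Y : Mat N) ∈ p₁) (hZ : (Z : Mat N) ∈ p₁) :
    Q (curvature (lieAlg K) (isotropy Q G K) (diagConn Q G H K p₁ p₂ y) Y Z E) E =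
      y ^ 2 / 4 * Q (comm Y E) (comm Z E) := by
  have hu := comm_mem_lieAlg Y.2.1 E.2.1
  have hv := comm_mem_lieAlg Z.2.1 E.2.1
  have hV : (diagConn Q G H K p₁ p₂ y E Z : Mat N) = (-(y / 2) : ℝ) • comm (Z : Mat N) E := by
    rw [h.diagConn₂₁ y hE hZ, comm_swap, smul_neg, neg_smul]
  have hVm : (diagConn Q G H K p₁ p₂ y E Z : Mat N) ∈ p₂ := by
    rw [hV]; exact p₂.smul_mem _ (h.comm₁₂ hZ hE)
  have t2 : Q (diagConn Q G H K p₁ p₂ y Y (diagConn Q G H K p₁ p₂ y E Z)) E =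
      (y / 2) * (1 - y / 2) * Q (comm Y E) (comm Z E) := by
    rw [h.diagConn₁₂ y hY hVm, map_smul, LinearMap.smul_apply, hV, comm_smul_right, map_smul,
      LinearMap.smul_apply, h.background.tri_swap Y.2.1 hv E.2.1]
    simp only [smul_eq_mul]
    ring
  have hU : (proj (lieAlg K) (isotropy Q G K) (comm (E : Mat N) Y) : Mat N) =
      - comm (Y : Mat N) E := by
    rw [h.proj_eq (comm_mem_lieAlg E.2.1 Y.2.1), h.cp₂_of_mem (h.comm₂₁ hE hY),
      h.cp₁_of_mem₂ (h.comm₂₁ hE hY), comm_swap, zero_add]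
  have hUm : (proj (lieAlg K) (isotropy Q G K) (comm (E : Mat N) Y) : Mat N) ∈ p₂ := by
    rw [hU]; exact p₂.neg_mem (h.comm₁₂ hY hE)
  have t3 : Q (diagConn Q G H K p₁ p₂ y (proj (lieAlg K) (isotropy Q G K) (comm (E : Mat N) Y)) Z) E
      = - (y / 2) * Q (comm Y E) (comm Z E) := by
    rw [h.diagConn₂₁ y hUm hZ, map_smul, LinearMap.smul_apply, hU, comm_neg_left, map_neg,
      LinearMap.neg_apply, h.background.tri_cycle hu Z.2.1 E.2.1, h.background.symm _ hv _ hu]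
    simp only [smul_eq_mul]
    ring
  have hK : commK Q G K (Y : Mat N) E = 0 := by
    rw [commK, h.proj_eq hu, h.cp₂_of_mem (h.comm₁₂ hY hE), h.cp₁_of_mem₂ (h.comm₁₂ hY hE)]
    simp
  simp only [curvature, LinearMap.coe_mk, AddHom.coe_mk, Submodule.coe_sub, map_sub,
    LinearMap.sub_apply, h.diagConn_self₂ y hE, t2, t3, h.Q_isotropy_term, hK, map_zero,
    LinearMap.zero_apply]
  ring

theorem curvature₁₂₂ (y : ℝ) {E Y Z : isotropy Q G K} (hE : (E : Mat N) ∈ p₁)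
    (hY : (Y : Mat N) ∈ p₂) (hZ : (Z : Mat N) ∈ p₂) :
    Q (curvature (lieAlg K) (isotropy Q G K) (diagConn Q G H K p₁ p₂ y) Y Z E) E =
      y / 4 * Q (comm Y E) (comm Z E) := by
  have hu := comm_mem_lieAlg Y.2.1 E.2.1
  have hv := comm_mem_lieAlg Z.2.1 E.2.1
  have hV : (diagConn Q G H K p₁ p₂ y E Z : Mat N) = (-(1 - y / 2) : ℝ) • comm (Z : Mat N) E := by
    rw [h.diagConn₁₂ y hE hZ, comm_swap, smul_neg, neg_smul]
  have hVm : (diagConn Q G H K p₁ p₂ y E Z : Mat N) ∈ p₂ := by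
    rw [hV]; exact p₂.smul_mem _ (h.comm₂₁ hZ hE)
  have t2 : Q (diagConn Q G H K p₁ p₂ y Y (diagConn Q G H K p₁ p₂ y E Z)) E =
      1 / 2 * (1 - y / 2) * Q (comm Y E) (comm Z E) := by
    rw [h.diagConn₂₂ y hY hVm, map_smul, LinearMap.smul_apply, map_add, LinearMap.add_apply,
      h.Q_cp₁ (comm_mem_lieAlg Y.2.1 (h.p₂_le hVm)) hE, h.orth₂₁ hE (cp₂_mem _), hV,
      comm_smul_right, map_smul,
      LinearMap.smul_apply, h.background.tri_swap Y.2.1 hv E.2.1]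
    simp only [smul_eq_mul]
    ring
  have hU : (proj (lieAlg K) (isotropy Q G K) (comm (E : Mat N) Y) : Mat N) =
      - comm (Y : Mat N) E := by
    rw [h.proj_eq (comm_mem_lieAlg E.2.1 Y.2.1), h.cp₂_of_mem (h.comm₁₂ hE hY),
      h.cp₁_of_mem₂ (h.comm₁₂ hE hY), comm_swap, zero_add]
  have hUm : (proj (lieAlg K) (isotropy Q G K) (comm (E : Mat N) Y) : Mat N) ∈ p₂ := by
    rw [hU]; exact p₂.neg_mem (h.comm₂₁ hY hE)
  have t3 : Q (diagConn Q G H K p₁ p₂ y (proj (lieAlg K) (isotropy Q G K) (comm (E : Mat N) Y)) Z) E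
      = - (1 / 2) * Q (comm Y E) (comm Z E) := by
    rw [h.diagConn₂₂ y hUm hZ, map_smul, LinearMap.smul_apply, map_add, LinearMap.add_apply,
      h.Q_cp₁ (comm_mem_lieAlg (h.p₂_le hUm) Z.2.1) hE, h.orth₂₁ hE (cp₂_mem _), hU, comm_neg_left,
      map_neg,
      LinearMap.neg_apply, h.background.tri_cycle hu Z.2.1 E.2.1, h.background.symm _ hv _ hu]
    simp only [smul_eq_mul]
    ring
  have hK : commK Q G K (Y : Mat N) E = 0 := by
    rw [commK, h.proj_eq hu, h.cp₂_of_mem (h.comm₂₁ hY hE), h.cp₁_of_mem₂ (h.comm₂₁ hY hE)]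
    simp
  simp only [curvature, LinearMap.coe_mk, AddHom.coe_mk, Submodule.coe_sub, map_sub,
    LinearMap.sub_apply, h.diagConn_self₁ y hE, t2, t3, h.Q_isotropy_term, hK, map_zero,
    LinearMap.zero_apply]
  ring

theorem curvature₂₂₂ (y : ℝ) {E Y Z : isotropy Q G K} (hE : (E : Mat N) ∈ p₂)
    (hY : (Y : Mat N) ∈ p₂) (hZ : (Z : Mat N) ∈ p₂) :
    Q (curvature (lieAlg K) (isotropy Q G K) (diagConn Q G H K p₁ p₂ y) Y Z E) E =
      1 / 4 * Q (cp₂ H p₂ (comm Y E)) (cp₂ H p₂ (comm Z E)) +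
        Q (commK Q G K Y E) (commK Q G K Z E) +
        (1 - 3 / 4 * y) * Q (cp₁ K p₁ p₂ (comm Y E)) (cp₁ K p₁ p₂ (comm Z E)) := by
  have hu := comm_mem_lieAlg Y.2.1 E.2.1
  have hv := comm_mem_lieAlg Z.2.1 E.2.1
  have m1 : ∀ X : Mat N, cp₁ K p₁ p₂ X ∈ p₁ := cp₁_mem
  have m2 : ∀ X : Mat N, cp₂ H p₂ X ∈ p₂ := cp₂_mem
  have g1 := fun X => h.p₁_le (m1 X)
  have g2 := fun X => h.p₂_le (m2 X)
  have hV : diagConn Q G H K p₁ p₂ y E Z =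
      (-(1 / 2) : ℝ) • (⟨_, h.le₁ (m1 (comm (Z : Mat N) E))⟩ +
        ⟨_, h.le₂ (m2 (comm (Z : Mat N) E))⟩) := by
    apply Subtype.ext
    rw [h.diagConn₂₂ y hE hZ, comm_swap]
    simp only [map_neg, Submodule.coe_smul, Submodule.coe_add]
    module
  have t2 : Q (diagConn Q G H K p₁ p₂ y Y (diagConn Q G H K p₁ p₂ y E Z)) E =
      y / 4 * Q (cp₁ K p₁ p₂ (comm Y E)) (cp₁ K p₁ p₂ (comm Z E)) +
      1 / 4 * Q (cp₂ H p₂ (comm Y E)) (cp₂ H p₂ (comm Z E)) := by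
    rw [hV, map_smul, map_add, Submodule.coe_smul, Submodule.coe_add,
      h.diagConn₂₁ y hY (m1 _), h.diagConn₂₂ y hY (m2 _)]
    simp only [map_smul, LinearMap.smul_apply, map_add, LinearMap.add_apply, smul_eq_mul]
    rw [h.orth₁₂ (m1 _) hE, h.Q_cp₂ (comm_mem_lieAlg Y.2.1 (g2 _)) hE,
      h.background.tri_swap Y.2.1 (g1 _) E.2.1, h.background.tri_swap Y.2.1 (g2 _) E.2.1,
      h.Q_cp₁_cp₁ hu, h.Q_cp₂_cp₂ hu]
    ring
  have hU : proj (lieAlg K) (isotropy Q G K) (comm (E : Mat N) Y) =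
      - (⟨_, h.le₁ (m1 (comm (Y : Mat N) E))⟩ + ⟨_, h.le₂ (m2 (comm (Y : Mat N) E))⟩) := by
    apply Subtype.ext
    rw [h.proj_eq (comm_mem_lieAlg E.2.1 Y.2.1), comm_swap]
    simp only [map_neg, Submodule.coe_neg, Submodule.coe_add]
    abel
  have t3 : Q (diagConn Q G H K p₁ p₂ y (proj (lieAlg K) (isotropy Q G K) (comm (E : Mat N) Y)) Z) E
      = - (1 - y / 2) * Q (cp₁ K p₁ p₂ (comm Y E)) (cp₁ K p₁ p₂ (comm Z E))
        - 1 / 2 * Q (cp₂ H p₂ (comm Y E)) (cp₂ H p₂ (comm Z E)) := by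
    rw [hU, map_neg, map_add, LinearMap.neg_apply, LinearMap.add_apply, Submodule.coe_neg,
      Submodule.coe_add, h.diagConn₁₂ y (m1 _) hZ, h.diagConn₂₂ y (m2 _) hZ]
    simp only [map_smul, LinearMap.smul_apply, map_add, LinearMap.add_apply, smul_eq_mul, map_neg,
      LinearMap.neg_apply]
    rw [h.orth₁₂ (m1 _) hE, h.Q_cp₂ (comm_mem_lieAlg (g2 _) Z.2.1) hE,
      h.background.tri_cycle (g1 _) Z.2.1 E.2.1, h.background.tri_cycle (g2 _) Z.2.1 E.2.1,
      h.Q_cp₁_cp₁ hv, h.Q_cp₂_cp₂ hv, h.background.symm _ (g1 (comm (Z : Mat N) E)) _ (g1 _),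
      h.background.symm _ (g2 (comm (Z : Mat N) E)) _ (g2 _)]
    ring
  simp only [curvature, LinearMap.coe_mk, AddHom.coe_mk, Submodule.coe_sub, map_sub,
    LinearMap.sub_apply, h.diagConn_self₂ y hE, t2, t3, h.Q_isotropy_term]
  ring

variable {ι κ : Type*} [Fintype ι] [Fintype κ] [DecidableEq ι] [DecidableEq κ]
  {e : ι → Mat N} {f : κ → Mat N} (he : IsONBasis Q p₁ e) (hf : IsONBasis Q p₂ f)
include he hf

/-- The trace does not depend on the metric, so bases orthonormal for `Q` serve for all `x₁`, `x₂`
at once. -/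
theorem ricci_eq_sum (Λ : isotropy Q G K →ₗ[ℝ] isotropy Q G K →ₗ[ℝ] isotropy Q G K)
    (Y Z : isotropy Q G K) : ricci (lieAlg K) (isotropy Q G K) Λ Y Z =
      ∑ i, Q (curvature (lieAlg K) (isotropy Q G K) Λ Y Z ⟨e i, h.le₁ (he.mem i)⟩) (e i) +
      ∑ j, Q (curvature (lieAlg K) (isotropy Q G K) Λ Y Z ⟨f j, h.le₂ (hf.mem j)⟩) (f j) := by
  rw [ricci, trace_eq_sum_of_expansion (ι := ι ⊕ κ)
    (Sum.elim (fun i => ⟨e i, h.le₁ (he.mem i)⟩) (fun j => ⟨f j, h.le₂ (hf.mem j)⟩))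
    (Sum.elim (fun i => Q.flip (e i) ∘ₗ (isotropy Q G K).subtype)
      (fun j => Q.flip (f j) ∘ₗ (isotropy Q G K).subtype))]
  · simp [Fintype.sum_sum_type]
  · intro X
    apply Subtype.ext
    simp only [Fintype.sum_sum_type, Sum.elim_inl, Sum.elim_inr, Submodule.coe_add,
      Submodule.coe_sum, Submodule.coe_smul, LinearMap.comp_apply, Submodule.subtype_apply]
    conv_lhs => rw [← h.cp_add X.2, he.expand _ (cp₁_mem (X : Mat N)),
      hf.expand _ (cp₂_mem (X : Mat N))]
    congr 1
    · exact Finset.sum_congr rfl fun i _ => by rw [h.Q_cp₁ X.2.1 (he.mem i)]; rfl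
    · exact Finset.sum_congr rfl fun i _ => by rw [h.Q_cp₂ X.2.1 (hf.mem i)]; rfl

theorem ricci₁₁ (y : ℝ) {Y Z : isotropy Q G K} (hY : (Y : Mat N) ∈ p₁) (hZ : (Z : Mat N) ∈ p₁) :
    ricci (lieAlg K) (isotropy Q G K) (diagConn Q G H K p₁ p₂ y) Y Z =
      selfForm Q G K (cp₁ K p₁ p₂) e Y Z + y ^ 2 / 4 * crossForm Q f Y Z := by
  rw [h.ricci_eq_sum he hf, selfForm, crossForm, Finset.mul_sum]
  congr 1
  · exact Finset.sum_congr rfl fun i _ => h.curvature₁₁₁ y (E := ⟨e i, _⟩) (he.mem i) hY hZ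
  · exact Finset.sum_congr rfl fun i _ => h.curvature₂₁₁ y (E := ⟨f i, _⟩) (hf.mem i) hY hZ

/-- By Parseval both sides equal the double sum of `Q([Y, eᵢ], fⱼ) Q([Z, eᵢ], fⱼ)`. This lets the
`p₁`-part of `[p₂, p₂]` be absorbed into the cross term. -/
theorem sum_cp₁ {Y Z : Mat N} (hY : Y ∈ p₂) (hZ : Z ∈ p₂) :
    ∑ j, Q (cp₁ K p₁ p₂ (comm Y (f j))) (cp₁ K p₁ p₂ (comm Z (f j))) = crossForm Q e Y Z := by
  have gY := h.p₂_le hY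
  have gZ := h.p₂_le hZ
  have ge := fun i => h.p₁_le (he.mem i)
  have gf := fun i => h.p₂_le (hf.mem i)
  have e1 : ∀ j, Q (cp₁ K p₁ p₂ (comm Y (f j))) (cp₁ K p₁ p₂ (comm Z (f j))) =
      ∑ i, Q (comm Y (e i)) (f j) * Q (comm Z (e i)) (f j) := fun j => by
    rw [he.parseval (cp₁_mem _)]
    refine Finset.sum_congr rfl fun i _ => ?_
    rw [h.background.symm _ (ge i) _ (h.p₁_le (cp₁_mem _)), h.Q_cp₁ (comm_mem_lieAlg gY (gf j))
      (he.mem i), h.Q_cp₁ (comm_mem_lieAlg gZ (gf j)) (he.mem i),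
      h.background.tri_swap gY (gf j) (ge i), h.background.tri_swap gZ (gf j) (ge i)]
    ring
  simp only [e1, crossForm]
  rw [Finset.sum_comm]
  refine Finset.sum_congr rfl fun i _ => ?_
  rw [hf.parseval (h.comm₂₁ hY (he.mem i))]
  exact Finset.sum_congr rfl fun j _ => by
    rw [h.background.symm _ (gf j) _ (comm_mem_lieAlg gZ (ge i))]

theorem ricci₂₂ (y : ℝ) {Y Z : isotropy Q G K} (hY : (Y : Mat N) ∈ p₂) (hZ : (Z : Mat N) ∈ p₂) :
    ricci (lieAlg K) (isotropy Q G K) (diagConn Q G H K p₁ p₂ y) Y Z =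
      selfForm Q G K (cp₂ H p₂) f Y Z + (1 - y / 2) * crossForm Q e Y Z := by
  have e1 : ∑ i, Q (curvature (lieAlg K) (isotropy Q G K) (diagConn Q G H K p₁ p₂ y) Y Z
      ⟨e i, h.le₁ (he.mem i)⟩) (e i) = y / 4 * crossForm Q e Y Z := by
    rw [crossForm, Finset.mul_sum]
    exact Finset.sum_congr rfl fun i _ => h.curvature₁₂₂ y (E := ⟨e i, _⟩) (he.mem i) hY hZ
  have e2 : ∑ i, Q (curvature (lieAlg K) (isotropy Q G K) (diagConn Q G H K p₁ p₂ y) Y Z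
      ⟨f i, h.le₂ (hf.mem i)⟩) (f i) = selfForm Q G K (cp₂ H p₂) f Y Z +
        (1 - 3 / 4 * y) * crossForm Q e Y Z := by
    rw [← h.sum_cp₁ he hf hY hZ, selfForm, Finset.mul_sum, ← Finset.sum_add_distrib]
    exact Finset.sum_congr rfl fun i _ => h.curvature₂₂₂ y (E := ⟨f i, _⟩) (hf.mem i) hY hZ
  rw [h.ricci_eq_sum he hf, e1, e2]
  ring

end NonMaximalTwoSummand

end

section

variable {N : ℕ} {G H K : Subgroup (U N)} {Q : LinearMap.BilinForm ℝ (Mat N)}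
  {p₁ p₂ : Submodule ℝ (Mat N)}

theorem Ad_sub (u : U N) (X Y : Mat N) : Ad u (X - Y) = Ad u X - Ad u Y :=
  (adLin u).map_sub X Y

namespace NonMaximalTwoSummand

variable (h : NonMaximalTwoSummand G H K Q p₁ p₂)
include h

/-! ## Invariance of the Ricci tensor -/

theorem diagConn_Ad (y : ℝ) {u : U N} (hu : u ∈ K) {X Y X' Y' : isotropy Q G K}
    (hX : (X' : Mat N) = Ad u X) (hY : (Y' : Mat N) = Ad u Y) :
    (diagConn Q G H K p₁ p₂ y X' Y' : Mat N) = Ad u (diagConn Q G H K p₁ p₂ y X Y) := by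
  have hin : (1 / 2 : ℝ) • comm (cp₁ K p₁ p₂ X) (cp₁ K p₁ p₂ Y) +
      (1 - y / 2) • comm (cp₁ K p₁ p₂ X) (cp₂ H p₂ Y) +
      (y / 2) • comm (cp₂ H p₂ X) (cp₁ K p₁ p₂ Y) +
      (1 / 2 : ℝ) • comm (cp₂ H p₂ X) (cp₂ H p₂ Y) ∈ lieAlg G := by
    have g1 : ∀ X : Mat N, cp₁ K p₁ p₂ X ∈ lieAlg G := fun X => h.p₁_le (cp₁_mem X)
    have g2 : ∀ X : Mat N, cp₂ H p₂ X ∈ lieAlg G := fun X => h.p₂_le (cp₂_mem X)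
    refine add_mem (add_mem (add_mem ?_ ?_) ?_) ?_ <;>
      refine Submodule.smul_mem _ _ (comm_mem_lieAlg ?_ ?_) <;> first | exact g1 _ | exact g2 _
  rw [diagConn_apply, diagConn_apply, ← h.projp_Ad hu hin, hX, hY]
  simp only [← adLin_apply, map_add, map_smul]
  simp only [adLin_apply, Ad_comm, h.cp₁_Ad hu X.2.1, h.cp₁_Ad hu Y.2.1,
    h.cp₂_Ad (h.K_le_H hu) X.2.1, h.cp₂_Ad (h.K_le_H hu) Y.2.1]

/-- `Ad u` conjugates the curvature endomorphism for `Y`, `Z` into the one for `Ad u Y`, `Ad u Z`,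
and the trace is invariant under conjugation. Invariance is what makes Schur's lemma available for
Ricci. -/
theorem ricci_Ad (y : ℝ) {u : U N} (hu : u ∈ K) {Y Z Y' Z' : isotropy Q G K}
    (hY : (Y' : Mat N) = Ad u Y) (hZ : (Z' : Mat N) = Ad u Z) :
    ricci (lieAlg K) (isotropy Q G K) (diagConn Q G H K p₁ p₂ y) Y' Z' =
      ricci (lieAlg K) (isotropy Q G K) (diagConn Q G H K p₁ p₂ y) Y Z := by
  let A : isotropy Q G K ≃ₗ[ℝ] isotropy Q G K := LinearEquiv.ofLinearMap
    ((adLin u).restrict (h.p_adInvariant u hu))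
    ((adLin u⁻¹).restrict (h.p_adInvariant _ (K.inv_mem hu)))
    (LinearMap.ext fun X => Subtype.ext (Ad_Ad_inv u X))
    (LinearMap.ext fun X => Subtype.ext (Ad_inv_Ad u X))
  have hA : ∀ X, (A X : Mat N) = Ad u X := fun X => rfl
  have hL : ∀ X Y, diagConn Q G H K p₁ p₂ y (A X) (A Y) = A (diagConn Q G H K p₁ p₂ y X Y) :=
    fun X Y => Subtype.ext (h.diagConn_Ad y hu (hA X) (hA Y))
  have hP : ∀ X ∈ lieAlg G, proj (lieAlg K) (isotropy Q G K) (Ad u X) =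
      A (proj (lieAlg K) (isotropy Q G K) X) := fun X hX => Subtype.ext (h.projp_Ad hu hX)
  have e1 : Y' = A Y := Subtype.ext (hY.trans (hA Y).symm)
  have e2 : Z' = A Z := Subtype.ext (hZ.trans (hA Z).symm)
  subst e1 e2
  refine Eq.trans ?_ (LinearMap.trace_conj' (curvature _ _ _ Y Z) A)
  rw [ricci]
  congr 1
  ext1 X
  obtain ⟨X, rfl⟩ := A.surjective X
  rw [LinearEquiv.conj_apply_apply, A.symm_apply_apply]
  have hXY : comm (A X : Mat N) (A Y) = Ad u (comm X Y) := by rw [hA, hA, Ad_comm]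
  have c1 := comm_mem_lieAlg X.2.1 Y.2.1
  have c2 : comm (comm (X : Mat N) Y - (proj (lieAlg K) (isotropy Q G K) (comm X Y) : Mat N)) Z ∈
      lieAlg G := comm_mem_lieAlg (h.k_le (h.sub_proj_mem c1)) Z.2.1
  have c3 : comm (Ad u (comm (X : Mat N) Y) -
      (A (proj (lieAlg K) (isotropy Q G K) (comm X Y)) : Mat N)) (A Z) =
      Ad u (comm (comm (X : Mat N) Y - (proj (lieAlg K) (isotropy Q G K) (comm X Y) : Mat N)) Z) := by
    rw [hA, hA, ← Ad_sub, ← Ad_comm]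
  set D := diagConn Q G H K p₁ p₂ y
  set P := proj (lieAlg K) (isotropy Q G K)
  change D (A X) (D (A Y) (A Z)) - D (A Y) (D (A X) (A Z)) -
      D (P (comm (A X : Mat N) (A Y))) (A Z) -
      P (comm (comm (A X : Mat N) (A Y) - (P (comm (A X : Mat N) (A Y)) : Mat N)) (A Z)) =
    A (D X (D Y Z) - D Y (D X Z) - D (P (comm X Y)) Z -
      P (comm (comm (X : Mat N) Y - (P (comm X Y) : Mat N)) Z))
  rw [hXY, hP _ c1, c3, hP _ c2]
  simp only [hL, map_sub]

/-! ## The structure constants -/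

theorem selfForm_symm {c : Mat N →ₗ[ℝ] Mat N} (hc : ∀ X, c X ∈ lieAlg G) {ι : Type*} [Fintype ι]
    {e : ι → Mat N} (he : ∀ i, e i ∈ lieAlg G) {Y Z : Mat N} (hY : Y ∈ lieAlg G)
    (hZ : Z ∈ lieAlg G) : selfForm Q G K c e Y Z = selfForm Q G K c e Z Y := by
  refine Finset.sum_congr rfl fun i _ => ?_
  rw [h.background.symm _ (hc (comm Y (e i))) _ (hc _),
    h.background.symm (commK Q G K Y (e i))
      (h.k_le (h.sub_proj_mem (comm_mem_lieAlg hY (he i)))) (commK Q G K Z (e i))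
      (h.k_le (h.sub_proj_mem (comm_mem_lieAlg hZ (he i))))]

theorem crossForm_symm {ι : Type*} [Fintype ι]
    {e : ι → Mat N} (he : ∀ i, e i ∈ lieAlg G) {Y Z : Mat N} (hY : Y ∈ lieAlg G)
    (hZ : Z ∈ lieAlg G) : crossForm Q e Y Z = crossForm Q e Z Y :=
  Finset.sum_congr rfl fun i _ => h.background.symm _ (comm_mem_lieAlg hY (he i)) _
    (comm_mem_lieAlg hZ (he i))

theorem crossForm_nonneg {ι : Type*} [Fintype ι] {e : ι → Mat N} (he : ∀ i, e i ∈ lieAlg G)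
    {Y : Mat N} (hY : Y ∈ lieAlg G) : 0 ≤ crossForm Q e Y Y :=
  Finset.sum_nonneg fun i _ => h.background.nonneg (comm_mem_lieAlg hY (he i))

theorem selfForm_nonneg {c : Mat N →ₗ[ℝ] Mat N} (hc : ∀ X, c X ∈ lieAlg G) {ι : Type*}
    [Fintype ι] {e : ι → Mat N} (he : ∀ i, e i ∈ lieAlg G) {Y : Mat N} (hY : Y ∈ lieAlg G) :
    0 ≤ selfForm Q G K c e Y Y := by
  refine Finset.sum_nonneg fun i _ => add_nonneg (mul_nonneg (by norm_num)
    (h.background.nonneg (hc _))) (h.background.nonneg ?_)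
  exact h.k_le (h.sub_proj_mem (comm_mem_lieAlg hY (he i)))

variable {ι κ : Type*} [Fintype ι] [Fintype κ] [DecidableEq ι] [DecidableEq κ]
  {e : ι → Mat N} {f : κ → Mat N} (he : IsONBasis Q p₁ e) (hf : IsONBasis Q p₂ f)
include he hf

theorem exists_smul₁ (y : ℝ) : ∃ c : ℝ, ∀ X Y : isotropy Q G K, (X : Mat N) ∈ p₁ →
    (Y : Mat N) ∈ p₁ → ricci (lieAlg K) (isotropy Q G K) (diagConn Q G H K p₁ p₂ y) X Y =
      c * Q X Y := by
  obtain ⟨c, hc⟩ := h.irreducible₁.eq_smul h.background h.K_le_G h.p₁_le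
    (B := restrictForm h.le₁ (ricciForm (lieAlg K) _ (diagConn Q G H K p₁ p₂ y)))
    (fun X Y => by
      change ricci _ _ _ (Submodule.inclusion h.le₁ X) (Submodule.inclusion h.le₁ Y) =
        ricci _ _ _ (Submodule.inclusion h.le₁ Y) (Submodule.inclusion h.le₁ X)
      rw [h.ricci₁₁ he hf y X.2 Y.2, h.ricci₁₁ he hf y Y.2 X.2]
      simp only [Submodule.coe_inclusion]
      rw [h.selfForm_symm (fun X => h.p₁_le (cp₁_mem X)) (fun i => h.p₁_le (he.mem i))
        (h.p₁_le X.2) (h.p₁_le Y.2), h.crossForm_symm (fun i => h.p₂_le (hf.mem i))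
        (h.p₁_le X.2) (h.p₁_le Y.2)])
    (fun u hu X X' Y Y' e e' => h.ricci_Ad y hu e e')
  exact ⟨c, fun X Y hX hY => hc ⟨X, hX⟩ ⟨Y, hY⟩⟩

theorem exists_smul₂ (y : ℝ) : ∃ c : ℝ, ∀ X Y : isotropy Q G K, (X : Mat N) ∈ p₂ →
    (Y : Mat N) ∈ p₂ → ricci (lieAlg K) (isotropy Q G K) (diagConn Q G H K p₁ p₂ y) X Y =
      c * Q X Y := by
  obtain ⟨c, hc⟩ := h.irreducible₂.eq_smul h.background h.K_le_G h.p₂_le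
    (B := restrictForm h.le₂ (ricciForm (lieAlg K) _ (diagConn Q G H K p₁ p₂ y)))
    (fun X Y => by
      change ricci _ _ _ (Submodule.inclusion h.le₂ X) (Submodule.inclusion h.le₂ Y) =
        ricci _ _ _ (Submodule.inclusion h.le₂ Y) (Submodule.inclusion h.le₂ X)
      rw [h.ricci₂₂ he hf y X.2 Y.2, h.ricci₂₂ he hf y Y.2 X.2]
      simp only [Submodule.coe_inclusion]
      rw [h.selfForm_symm (fun X => h.p₂_le (cp₂_mem X)) (fun i => h.p₂_le (hf.mem i))
        (h.p₂_le X.2) (h.p₂_le Y.2), h.crossForm_symm (fun i => h.p₁_le (he.mem i))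
        (h.p₂_le X.2) (h.p₂_le Y.2)])
    (fun u hu X X' Y Y' e e' => h.ricci_Ad y hu e e')
  exact ⟨c, fun X Y hX hY => hc ⟨X, hX⟩ ⟨Y, hY⟩⟩

omit he hf in
theorem ricci₁₂ (y : ℝ) (X Y : isotropy Q G K) (hX : (X : Mat N) ∈ p₁) (hY : (Y : Mat N) ∈ p₂) :
    ricci (lieAlg K) (isotropy Q G K) (diagConn Q G H K p₁ p₂ y) X Y = 0 ∧
    ricci (lieAlg K) (isotropy Q G K) (diagConn Q G H K p₁ p₂ y) Y X = 0 := by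
  constructor
  · exact IsAdPairing.eq_zero h.background h.K_le_G h.p₂_le h.irreducible₁ h.irreducible₂
      h.inequivalent (B := (ricciForm (lieAlg K) _ (diagConn Q G H K p₁ p₂ y)).compl₁₂
        (Submodule.inclusion h.le₁) (Submodule.inclusion h.le₂))
      (fun u hu X X' Y Y' e e' => h.ricci_Ad y hu e e') ⟨X, hX⟩ ⟨Y, hY⟩
  · exact IsAdPairing.eq_zero h.background h.K_le_G h.p₂_le h.irreducible₁ h.irreducible₂
      h.inequivalent (B := (ricciForm (lieAlg K) _ (diagConn Q G H K p₁ p₂ y)).flip.compl₁₂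
        (Submodule.inclusion h.le₁) (Submodule.inclusion h.le₂))
      (fun u hu X X' Y Y' e e' => h.ricci_Ad y hu e' e) ⟨X, hX⟩ ⟨Y, hY⟩

/-- The Ricci tensor of a diagonal metric. -/
theorem exists_ricci_eq : ∃ a₁ b₁ a₂ b₂ : ℝ, 0 ≤ b₁ ∧ 0 < a₂ ∧ 0 < b₂ ∧
    (∀ Y ∈ p₁, selfForm Q G K (cp₁ K p₁ p₂) e Y Y = a₁ * Q Y Y) ∧
    (∀ Y ∈ p₁, crossForm Q f Y Y = 4 * b₁ * Q Y Y) ∧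
    (∀ Y ∈ p₂, selfForm Q G K (cp₂ H p₂) f Y Y + crossForm Q e Y Y = a₂ * Q Y Y) ∧
    (∀ Y ∈ p₂, crossForm Q e Y Y = 2 * b₂ * Q Y Y) ∧
    ∀ (y : ℝ) (X Y : isotropy Q G K),
      ricci (lieAlg K) (isotropy Q G K) (diagConn Q G H K p₁ p₂ y) X Y =
        diagForm Q G H K p₁ p₂ (a₁ + b₁ * y ^ 2) (a₂ - b₂ * y) X Y := by
  have hQ := h.background
  -- Schur gives `c₁` and `c₂` as unknown functions of `y`. Since `selfForm` and `crossForm` do not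
  -- depend on `y`, the values at `y = 0` and `y = 1` determine them.
  choose c₁ hc₁ using h.exists_smul₁ he hf
  choose c₂ hc₂ using h.exists_smul₂ he hf
  have r₁ : ∀ y, ∀ Y ∈ p₁, selfForm Q G K (cp₁ K p₁ p₂) e Y Y + y ^ 2 / 4 * crossForm Q f Y Y =
      c₁ y * Q Y Y := fun y Y hY => by
    rw [← hc₁ y ⟨Y, h.le₁ hY⟩ ⟨Y, h.le₁ hY⟩ hY hY, h.ricci₁₁ he hf y hY hY]
  have r₂ : ∀ y, ∀ Y ∈ p₂, selfForm Q G K (cp₂ H p₂) f Y Y + (1 - y / 2) * crossForm Q e Y Y =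
      c₂ y * Q Y Y := fun y Y hY => by
    rw [← hc₂ y ⟨Y, h.le₂ hY⟩ ⟨Y, h.le₂ hY⟩ hY hY, h.ricci₂₂ he hf y hY hY]
  have ge : ∀ i, e i ∈ lieAlg G := fun i => h.p₁_le (he.mem i)
  have gf : ∀ i, f i ∈ lieAlg G := fun i => h.p₂_le (hf.mem i)
  obtain ⟨E, hE, hE0⟩ := Submodule.exists_mem_ne_zero_of_ne_bot h.irreducible₁.2.1
  obtain ⟨F, hF, hF0⟩ := Submodule.exists_mem_ne_zero_of_ne_bot h.irreducible₂.2.1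
  have hEp := hQ.pos E (h.p₁_le hE) hE0
  have hFp := hQ.pos F (h.p₂_le hF) hF0
  have f1 : ∀ Y ∈ p₁, selfForm Q G K (cp₁ K p₁ p₂) e Y Y = c₁ 0 * Q Y Y := fun Y hY => by
    have := r₁ 0 Y hY; simpa using this
  have f2 : ∀ Y ∈ p₁, crossForm Q f Y Y = 4 * (c₁ 1 - c₁ 0) * Q Y Y := fun Y hY => by
    have := r₁ 1 Y hY; rw [f1 Y hY] at this; linarith
  have f3 : ∀ Y ∈ p₂, selfForm Q G K (cp₂ H p₂) f Y Y + crossForm Q e Y Y = c₂ 0 * Q Y Y :=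
    fun Y hY => by have := r₂ 0 Y hY; simpa using this
  have f4 : ∀ Y ∈ p₂, crossForm Q e Y Y = 2 * (c₂ 0 - c₂ 1) * Q Y Y := fun Y hY => by
    have h0 := f3 Y hY
    have h1 := r₂ 1 Y hY
    linarith
  have g1 : ∀ y, c₁ y = c₁ 0 + (c₁ 1 - c₁ 0) * y ^ 2 := fun y => by
    have := r₁ y E hE
    rw [f1 E hE, f2 E hE] at this
    refine mul_right_cancel₀ hEp.ne' ?_
    linarith
  have g2 : ∀ y, c₂ y = c₂ 0 - (c₂ 0 - c₂ 1) * y := fun y => by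
    have h0 := f3 F hF
    have h1 := r₂ y F hF
    have h2 := f4 F hF
    refine mul_right_cancel₀ hFp.ne' ?_
    rw [← h1]
    rw [h2] at h0 ⊢
    linear_combination h0
  have b1 : 0 ≤ c₁ 1 - c₁ 0 := by
    have h1 := h.crossForm_nonneg gf (h.p₁_le hE)
    rw [f2 E hE] at h1
    have := nonneg_of_mul_nonneg_left h1 hEp
    linarith
  -- If `b₂` vanished, all `[Y, eᵢ]` would vanish for the `Y` of the nonzero structure constant,
  -- hence `[X, Y] = 0`.
  have b2 : 0 < c₂ 0 - c₂ 1 := by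
    obtain ⟨X, hX, Y, hY, Z, hZ, hne⟩ := h.structureConstant_pos
    have hY0 : Y ≠ 0 := fun h0 => hne (by simp [h0])
    have hYp := hQ.pos Y (h.p₂_le hY) hY0
    have h1 := h.crossForm_nonneg ge (h.p₂_le hY)
    have h2 := f4 Y hY
    rw [h2] at h1
    have h3 := nonneg_of_mul_nonneg_left h1 hYp
    refine lt_of_le_of_ne (by linarith) fun h0 => ?_
    rw [← h0, mul_zero, zero_mul] at h2
    have h4 : ∀ i, comm Y (e i) = 0 := fun i => by
      refine hQ.eq_zero (comm_mem_lieAlg (h.p₂_le hY) (ge i)) ?_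
      exact (Finset.sum_eq_zero_iff_of_nonneg (fun i _ =>
        hQ.nonneg (comm_mem_lieAlg (h.p₂_le hY) (ge i)))).1 h2 i (Finset.mem_univ i)
    have h5 : comm Y X = 0 := by
      rw [he.expand X hX, ← commLin_apply, map_sum]
      refine Finset.sum_eq_zero fun i _ => ?_
      rw [map_smul, commLin_apply, h4, smul_zero]
    apply hne
    rw [comm_swap, h5, neg_zero, map_zero, LinearMap.zero_apply]
  have a2 : 0 < c₂ 0 := by
    have h1 := h.selfForm_nonneg (fun X => h.p₂_le (cp₂_mem (H := H) X)) gf (h.p₂_le hF)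
    have h2 := f3 F hF
    have h3 := f4 F hF
    have h4 : 0 < c₂ 0 * Q F F := by rw [← h2, h3]; positivity
    exact pos_of_mul_pos_left h4 hFp.le
  refine ⟨c₁ 0, c₁ 1 - c₁ 0, c₂ 0, c₂ 0 - c₂ 1, b1, a2, b2, f1, f2, f3, f4, fun y X Y => ?_⟩
  have m₁ : ∀ X : isotropy Q G K, cp₁ K p₁ p₂ X ∈ isotropy Q G K := fun X => h.le₁ (cp₁_mem _)
  have m₂ : ∀ X : isotropy Q G K, cp₂ H p₂ X ∈ isotropy Q G K := fun X => h.le₂ (cp₂_mem _)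
  have d : ∀ X : isotropy Q G K, X = ⟨_, m₁ X⟩ + ⟨_, m₂ X⟩ :=
    fun X => Subtype.ext (h.cp_add X.2).symm
  rw [diagForm_apply, ← g1, ← g2, ← ricciForm_apply]
  conv_lhs => rw [d X, d Y]
  have k₁ := hc₁ y ⟨_, m₁ X⟩ ⟨_, m₁ Y⟩ (cp₁_mem _) (cp₁_mem _)
  have k₂ := hc₂ y ⟨_, m₂ X⟩ ⟨_, m₂ Y⟩ (cp₂_mem _) (cp₂_mem _)
  have k₃ := (h.ricci₁₂ y ⟨_, m₁ X⟩ ⟨_, m₂ Y⟩ (cp₁_mem _) (cp₂_mem _)).1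
  have k₄ := (h.ricci₁₂ y ⟨_, m₁ Y⟩ ⟨_, m₂ X⟩ (cp₁_mem _) (cp₂_mem _)).2
  simp only [map_add, LinearMap.add_apply, ricciForm_apply, k₁, k₂, k₃, k₄]
  ring

end NonMaximalTwoSummand

end

namespace NonMaximalTwoSummand

variable {N : ℕ} {G H K : Subgroup (U N)} {Q : LinearMap.BilinForm ℝ (Mat N)}
  {p₁ p₂ : Submodule ℝ (Mat N)} (h : NonMaximalTwoSummand G H K Q p₁ p₂)
include h

/-! ## Reduction of the Ricci flow to a planar system -/

variable {a₁ b₁ a₂ b₂ : ℝ}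
  (hR : ∀ (y : ℝ) (X Y : isotropy Q G K),
    ricci (lieAlg K) (isotropy Q G K) (diagConn Q G H K p₁ p₂ y) X Y =
      diagForm Q G H K p₁ p₂ (a₁ + b₁ * y ^ 2) (a₂ - b₂ * y) X Y)
include hR

theorem isRicciFlowOn_of_isPlanarFlow {x₁ x₂ : ℝ → ℝ} {I : Set ℝ}
    (hx : IsPlanarFlow a₁ b₁ a₂ b₂ x₁ x₂ I) :
    IsRicciFlowOn K (isotropy Q G K) (fun t => diagForm Q G H K p₁ p₂ (x₁ t) (x₂ t)) I := by
  intro t ht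
  obtain ⟨h1, h2, d1, d2⟩ := hx t ht
  refine ⟨h.isInvariantMetric_diagForm h1 h2, _, h.isLeviCivita_diagConn h2, fun X Y => ?_⟩
  rw [hR]
  simp only [diagForm_apply]
  refine ((d1.mul_const _).add (d2.mul_const _)).congr_deriv ?_
  ring

/-- Evaluating `g t` on one fixed vector of each summand reads off differentiable coefficients.
Uniqueness of the Levi-Civita connection identifies the `Λ` hidden in the flow equation. -/
theorem exists_isPlanarFlow {g : ℝ → LinearMap.BilinForm ℝ (isotropy Q G K)} {I : Set ℝ}
    (hg : IsRicciFlowOn K (isotropy Q G K) g I) :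
    ∃ x₁ x₂ : ℝ → ℝ, IsPlanarFlow a₁ b₁ a₂ b₂ x₁ x₂ I ∧
      ∀ t ∈ I, g t = diagForm Q G H K p₁ p₂ (x₁ t) (x₂ t) := by
  obtain ⟨E, hE, hE0⟩ := Submodule.exists_mem_ne_zero_of_ne_bot h.irreducible₁.2.1
  obtain ⟨F, hF, hF0⟩ := Submodule.exists_mem_ne_zero_of_ne_bot h.irreducible₂.2.1
  have hEp := (h.background.pos E (h.p₁_le hE) hE0).ne'
  have hFp := (h.background.pos F (h.p₂_le hF) hF0).ne'
  set E' : isotropy Q G K := ⟨E, h.le₁ hE⟩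
  set F' : isotropy Q G K := ⟨F, h.le₂ hF⟩
  have eE : ∀ x₁ x₂, diagForm Q G H K p₁ p₂ x₁ x₂ E' E' = x₁ * Q E E := fun x₁ x₂ => by
    simp [diagForm_apply, E', h.cp₁_of_mem hE, h.cp₂_of_mem₁ hE]
  have eF : ∀ x₁ x₂, diagForm Q G H K p₁ p₂ x₁ x₂ F' F' = x₂ * Q F F := fun x₁ x₂ => by
    simp [diagForm_apply, F', h.cp₂_of_mem hF, h.cp₁_of_mem₂ hF]
  have key : ∀ t ∈ I, 0 < g t E' E' / Q E E ∧ 0 < g t F' F' / Q F F ∧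
      g t = diagForm Q G H K p₁ p₂ (g t E' E' / Q E E) (g t F' F' / Q F F) := by
    intro t ht
    obtain ⟨y₁, y₂, h1, h2, e⟩ := h.exists_eq_diagForm (hg t ht).1
    have e1 : g t E' E' / Q E E = y₁ := by rw [e, eE, mul_div_assoc, div_self hEp, mul_one]
    have e2 : g t F' F' / Q F F = y₂ := by rw [e, eF, mul_div_assoc, div_self hFp, mul_one]
    rw [e1, e2]
    exact ⟨h1, h2, e⟩
  refine ⟨fun t => g t E' E' / Q E E, fun t => g t F' F' / Q F F, fun t ht => ?_,
    fun t ht => (key t ht).2.2⟩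
  obtain ⟨h1, h2, e⟩ := key t ht
  obtain ⟨hm, Λ, hΛ, hd⟩ := hg t ht
  have eΛ : Λ = diagConn Q G H K p₁ p₂ ((g t E' E' / Q E E) / (g t F' F' / Q F F)) := by
    refine IsLeviCivita.unique hm.symm hm.pos hΛ ?_
    have := h.isLeviCivita_diagConn (x₁ := g t E' E' / Q E E) h2
    rwa [← e] at this
  refine ⟨h1, h2, ?_, ?_⟩
  · refine ((hd E' E').div_const (Q E E)).congr_deriv ?_
    rw [eΛ, hR, eE]
    field_simp
  · refine ((hd F' F').div_const (Q F F)).congr_deriv ?_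
    rw [eΛ, hR, eF]
    field_simp

theorem isEinstein_of_root {y : ℝ} (hy : 0 < y) (hP : einsteinPoly a₁ b₁ a₂ b₂ y = 0) :
    IsEinstein K (isotropy Q G K) (diagForm Q G H K p₁ p₂ y 1) := by
  refine ⟨h.isInvariantMetric_diagForm hy one_pos, _, h.isLeviCivita_diagConn one_pos,
    a₂ - b₂ * y, fun X Y => ?_⟩
  rw [hR, diagForm_apply, diagForm_apply, div_one]
  rw [einsteinPoly] at hP
  linear_combination Q (cp₁ K p₁ p₂ X) (cp₁ K p₁ p₂ Y) * hP

/-- Converse of `isEinstein_of_root`: equating the two coefficients of the Ricci tensor with `c x₁`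
and `c x₂` and eliminating `c` yields a root. Only the example uses it. -/
theorem not_isEinstein (hP : ∀ y, 0 < y → einsteinPoly a₁ b₁ a₂ b₂ y ≠ 0)
    (g : LinearMap.BilinForm ℝ (isotropy Q G K)) : ¬ IsEinstein K (isotropy Q G K) g := by
  rintro ⟨hm, Λ, hΛ, c, hc⟩
  obtain ⟨x₁, x₂, h1, h2, e⟩ := h.exists_eq_diagForm hm
  have eΛ : Λ = diagConn Q G H K p₁ p₂ (x₁ / x₂) := by
    refine IsLeviCivita.unique hm.symm hm.pos hΛ ?_
    rw [e]
    exact h.isLeviCivita_diagConn h2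
  have : diagForm Q G H K p₁ p₂ (a₁ + b₁ * (x₁ / x₂) ^ 2) (a₂ - b₂ * (x₁ / x₂)) =
      diagForm Q G H K p₁ p₂ (c * x₁) (c * x₂) := by
    refine LinearMap.ext₂ fun X Y => ?_
    rw [← hR, ← eΛ, hc, e, diagForm_apply, diagForm_apply]
    ring
  obtain ⟨e1, e2⟩ := h.diagForm_inj this
  refine hP (x₁ / x₂) (by positivity) ?_
  rw [einsteinPoly]
  have e3 : c * x₁ = c * x₂ * (x₁ / x₂) := by field_simp
  rw [← e1, ← e2] at e3
  linear_combination e3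

theorem noAncientSolution (hb₁ : 0 ≤ b₁) (hb₂ : 0 < b₂) (ha₂ : 0 < a₂)
    (hP : ∀ y, 0 < y → einsteinPoly a₁ b₁ a₂ b₂ y ≠ 0) :
    NoAncientSolution K (isotropy Q G K) := by
  intro T g hg
  obtain ⟨x₁, x₂, hx, -⟩ := h.exists_isPlanarFlow hR hg
  exact not_isPlanarFlow_Iio hb₁ hb₂ ha₂ hP x₁ x₂ T hx

theorem exists_ricciFlow (hb₁ : 0 ≤ b₁) (hb₂ : 0 < b₂) (ha₂ : 0 < a₂)
    (hP : ∀ y, 0 < y → einsteinPoly a₁ b₁ a₂ b₂ y ≠ 0)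
    {g₀ : LinearMap.BilinForm ℝ (isotropy Q G K)}
    (hg₀ : IsInvariantMetric K (isotropy Q G K) g₀) :
    ∃ (T : ℝ) (x₁ x₂ : ℝ → ℝ) (b : ℝ), 0 < T ∧ diagForm Q G H K p₁ p₂ (x₁ 0) (x₂ 0) = g₀ ∧
      IsRicciFlowOn K (isotropy Q G K) (fun t => diagForm Q G H K p₁ p₂ (x₁ t) (x₂ t))
        (Ico 0 T) ∧
      (∀ (T' : ℝ) (g' : ℝ → LinearMap.BilinForm ℝ (isotropy Q G K)), 0 < T' → g' 0 = g₀ →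
        IsRicciFlowOn K (isotropy Q G K) g' (Ico 0 T') →
          T' ≤ T ∧ ∀ t ∈ Ico 0 T', g' t = diagForm Q G H K p₁ p₂ (x₁ t) (x₂ t)) ∧
      (∀ t ∈ Ico 0 T, 0 < x₁ t ∧ 0 < x₂ t) ∧
      0 < b ∧ Tendsto x₁ (𝓝[<] T) (𝓝 0) ∧ Tendsto x₂ (𝓝[<] T) (𝓝 b) := by
  obtain ⟨c₁, c₂, h1, h2, e⟩ := h.exists_eq_diagForm hg₀
  obtain ⟨T, x₁, x₂, b, hT, i1, i2, hx, hu, hb, l1, l2⟩ :=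
    exists_planarFlow hb₁ hb₂ ha₂ hP h1 h2
  refine ⟨T, x₁, x₂, b, hT, by rw [i1, i2, e], h.isRicciFlowOn_of_isPlanarFlow hR hx, ?_,
    fun t ht => ⟨(hx t ht).1, (hx t ht).2.1⟩, hb, l1, l2⟩
  intro T' g' hT' hg' hf
  obtain ⟨y₁, y₂, hy, ey⟩ := h.exists_isPlanarFlow hR hf
  have e0 := ey 0 ⟨le_rfl, hT'⟩
  rw [hg', e] at e0
  obtain ⟨j1, j2⟩ := h.diagForm_inj e0
  obtain ⟨hle, hyx⟩ := hu T' y₁ y₂ hT' j1.symm j2.symm hy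
  exact ⟨hle, fun t ht => by rw [ey t ht, (hyx t ht).1, (hyx t ht).2]⟩

end NonMaximalTwoSummand

section

variable {N : ℕ} {G L : Subgroup (U N)}

/-! ## Lengths of curves and invariant speeds -/

/-- The left logarithmic derivative `γ⁻¹ γ'` of a curve in `G`. -/
noncomputable def logVel (γ : ℝ → G) (t : ℝ) : Mat N :=
  star ((γ t : U N) : Mat N) * velocity (fun s => ((γ s : U N) : Mat N)) t

/-- A curve in `G` is `C¹`. -/
abbrev IsC1 (γ : ℝ → G) : Prop := IsContDiff 1 (fun t => ((γ t : U N) : Mat N))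

/-- The length of a curve with respect to a left invariant speed. -/
noncomputable def speedLength (ν : Mat N → ℝ) (γ : ℝ → G) : ℝ := ∫ t in (0 : ℝ)..1, ν (logVel γ t)

/-- A left invariant speed on `G` that descends to `G/L`. -/
structure IsInvariantSpeed (G L : Subgroup (U N)) (ν : Mat N → ℝ) : Prop where
  continuous : Continuous ν
  nonneg : ∀ A, 0 ≤ ν A
  smul : ∀ (c : ℝ) A, ν (c • A) = |c| * ν A
  inv : ∀ u ∈ L, ∀ A ∈ lieAlg G, ν (Ad u A) = ν A

/-- The cosets `x` and `y` are joined by a `C¹` curve of length `r`. -/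
def JoinedBy (ν : Mat N → ℝ) (x y : CosetSpace G L) (r : ℝ) : Prop :=
  ∃ γ : ℝ → G, IsC1 γ ∧ (QuotientGroup.mk (γ 0) : CosetSpace G L) = x ∧
    (QuotientGroup.mk (γ 1) : CosetSpace G L) = y ∧ r = speedLength ν γ

theorem star_mul_self_coe (u : U N) : star (u : Mat N) * (u : Mat N) = 1 :=
  Unitary.coe_star_mul_self u

theorem continuous_logVel {γ : ℝ → G} (hγ : IsC1 γ) : Continuous (logVel γ) :=
  hγ.contDiff.continuous.matrix_conjTranspose.mul hγ.continuous_velocity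

theorem logVel_mem (hG : IsClosed (G : Set (U N))) {γ : ℝ → G} (hγ : IsC1 γ) (t : ℝ) :
    logVel γ t ∈ lieAlg G :=
  star_mul_velocity_mem hG (γ := fun s => (γ s : U N)) (fun s => (γ s).2) hγ t

/-- A left translation leaves `γ⁻¹ γ'` alone, a right translation conjugates it, a reparametrization
scales it. Equality near one time is enough because spliced curves have this form only piecewise. -/
theorem logVel_of_eventuallyEq {L : Subgroup (U N)} {γ : ℝ → L} (hγ : IsC1 γ) {η : ℝ → G}
    {σ : ℝ → ℝ} {s t : ℝ} (hσ : HasDerivAt σ s t) {a b : U N}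
    (he : (fun τ => (η τ : U N)) =ᶠ[𝓝 t] fun τ => a * γ (σ τ) * b) :
    logVel η t = s • Ad b⁻¹ (logVel γ (σ t)) := by
  have h1 := ((hγ.hasDerivAt_velocity (σ t)).scomp t hσ).const_mul (a : Mat N)
  have h2 : HasDerivAt (fun τ => ((η τ : U N) : Mat N))
      ((a : Mat N) * (s • velocity (fun r => ((γ r : U N) : Mat N)) (σ t)) * (b : Mat N)) t := by
    refine (h1.mul_const (b : Mat N)).congr_of_eventuallyEq ?_
    filter_upwards [he] with τ hτ
    simp [hτ]
  rw [logVel, velocity_eq h2, logVel, Ad, he.eq_of_nhds]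
  simp only [Submonoid.coe_mul, star_mul, UnitaryGroup.inv_val, star_star]
  simp only [mul_smul_comm, smul_mul_assoc, Matrix.mul_assoc]
  rw [← Matrix.mul_assoc (star (a : Mat N)), star_mul_self_coe, Matrix.one_mul]

theorem IsInvariantSpeed.continuous_comp {ν : Mat N → ℝ} (hν : IsInvariantSpeed G L ν)
    {L' : Subgroup (U N)} {γ : ℝ → L'} (hγ : IsC1 γ) : Continuous fun t => ν (logVel γ t) :=
  hν.continuous.comp (continuous_logVel hγ)

theorem IsInvariantSpeed.speedLength_nonneg {ν : Mat N → ℝ} (hν : IsInvariantSpeed G L ν)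
    {L' : Subgroup (U N)} (γ : ℝ → L') : 0 ≤ speedLength ν γ :=
  intervalIntegral.integral_nonneg zero_le_one fun _ _ => hν.nonneg _

theorem JoinedBy.nonneg {ν : Mat N → ℝ} (hν : IsInvariantSpeed G L ν) {x y : CosetSpace G L}
    {r : ℝ} (h : JoinedBy ν x y r) : 0 ≤ r := by
  obtain ⟨γ, -, -, -, rfl⟩ := h
  exact hν.speedLength_nonneg γ

theorem JoinedBy.symm {ν : Mat N → ℝ} (hν : IsInvariantSpeed G L ν) {x y : CosetSpace G L}
    {r : ℝ} (h : JoinedBy ν x y r) : JoinedBy ν y x r := by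
  obtain ⟨γ, hγ, rfl, rfl, rfl⟩ := h
  refine ⟨fun t => γ (1 - t), ?_, by simp, by simp, ?_⟩
  · exact contDiff_entry (hγ.contDiff.comp (contDiff_const.sub contDiff_id))
  · have e : ∀ t, logVel (fun t => γ (1 - t)) t = (-1 : ℝ) • Ad 1 (logVel γ (1 - t)) := fun t => by
      have hd : HasDerivAt (fun τ : ℝ => 1 - τ) (-1) t := by
        simpa using (hasDerivAt_id t).const_sub 1
      have := logVel_of_eventuallyEq hγ (η := fun t => γ (1 - t)) (a := 1) (b := 1) hd
        (Eventually.of_forall fun τ => by simp)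
      simpa using this
    simp only [speedLength, e, hν.smul, abs_neg, abs_one, one_mul, Ad_one]
    rw [intervalIntegral.integral_comp_sub_left (fun t => ν (logVel γ t)) 1]
    simp

/-- The speed is invariant under `Ad(L)`, so it does not matter that the end of one curve and the
start of the next agree only modulo `L`. -/
theorem JoinedBy.trans (hG : IsClosed (G : Set (U N))) {ν : Mat N → ℝ}
    (hν : IsInvariantSpeed G L ν) {x y z : CosetSpace G L} {r s : ℝ} (h : JoinedBy ν x y r)
    (h' : JoinedBy ν y z s) : JoinedBy ν x z (r + s) := by
  obtain ⟨γ, hγ, rfl, hy, rfl⟩ := h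
  obtain ⟨δ, hδ, rfl, rfl, rfl⟩ := h'
  have hl := QuotientGroup.eq.1 hy
  have hl' : (((γ 1)⁻¹ * δ 0 : G) : U N) ∈ L := hl
  have hS : ContDiff ℝ 1 Real.smoothTransition := Real.smoothTransition.contDiff (n := 1)
  set σ₁ : ℝ → ℝ := fun t => Real.smoothTransition (2 * t)
  set σ₂ : ℝ → ℝ := fun t => Real.smoothTransition (2 * t - 1)
  have c₁ : ContDiff ℝ 1 σ₁ := hS.comp (contDiff_const.mul contDiff_id)
  have c₂ : ContDiff ℝ 1 σ₂ := hS.comp ((contDiff_const.mul contDiff_id).sub contDiff_const)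
  have m₁ : Monotone σ₁ := fun a b hab => Real.smoothTransition.monotone (by linarith)
  have m₂ : Monotone σ₂ := fun a b hab => Real.smoothTransition.monotone (by linarith)
  have d₁ : ∀ t, HasDerivAt σ₁ (deriv σ₁ t) t := fun t =>
    (c₁.differentiable (by simp)).differentiableAt.hasDerivAt
  have d₂ : ∀ t, HasDerivAt σ₂ (deriv σ₂ t) t := fun t =>
    (c₂.differentiable (by simp)).differentiableAt.hasDerivAt
  have p₁ : ∀ t, 0 ≤ deriv σ₁ t := fun t => m₁.deriv_nonneg
  have p₂ : ∀ t, 0 ≤ deriv σ₂ t := fun t => m₂.deriv_nonneg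
  -- `σ₁` runs from `0` to `1` on `[0, 1/2]` and `σ₂` on `[1/2, 1]`, each stationary elsewhere, so
  -- the product is `C¹` through the joint. On the first half it is `γ` right-translated by an
  -- element of `L`, on the second half it is `δ`.
  set η : ℝ → G := fun t => γ (σ₁ t) * (γ 1)⁻¹ * δ (σ₂ t) with hη_def
  have hη : IsC1 η := by
    refine contDiff_entry ?_
    exact ((hγ.contDiff.comp c₁).mul contDiff_const).mul (hδ.contDiff.comp c₂)
  have e0 : η 0 = γ 0 * ((γ 1)⁻¹ * δ 0) := by
    simp only [hη_def, σ₁, σ₂, mul_zero, Real.smoothTransition.zero, mul_assoc]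
    rw [Real.smoothTransition.zero_of_nonpos (by norm_num)]
  have e1 : η 1 = δ 1 := by
    simp only [hη_def, σ₁, σ₂]
    rw [Real.smoothTransition.one_of_one_le (by norm_num),
      Real.smoothTransition.one_of_one_le (by norm_num)]
    simp
  refine ⟨η, hη, ?_, by rw [e1], ?_⟩
  · rw [e0, QuotientGroup.eq]
    simpa using inv_mem hl
  have i1 : ∫ t in (0 : ℝ)..(1 / 2), ν (logVel η t) = speedLength ν γ := by
    have : ∫ t in (0 : ℝ)..(1 / 2), ν (logVel η t) =
        ∫ t in (0 : ℝ)..(1 / 2), ((fun t => ν (logVel γ t)) ∘ σ₁) t * deriv σ₁ t := by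
      refine intervalIntegral.integral_congr_Ioo_of_le (by norm_num) fun t ht => ?_
      have := logVel_of_eventuallyEq hγ (η := η) (a := 1) (b := ((γ 1)⁻¹ * δ 0 : G)) (d₁ t) (by
        filter_upwards [Iio_mem_nhds ht.2] with τ hτ
        have : σ₂ τ = 0 := Real.smoothTransition.zero_of_nonpos (by linarith [mem_Iio.1 hτ])
        simp [hη_def, this, mul_assoc])
      simp only [Function.comp]
      rw [this, hν.smul, hν.inv _ (inv_mem hl') _ (logVel_mem hG hγ _), abs_of_nonneg (p₁ t),
        mul_comm]
    rw [this, intervalIntegral.integral_comp_mul_deriv (fun t _ => d₁ t)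
      (c₁.continuous_deriv le_rfl).continuousOn (hν.continuous_comp hγ)]
    simp only [σ₁]
    norm_num [speedLength]
  have i2 : ∫ t in (1 / 2 : ℝ)..1, ν (logVel η t) = speedLength ν δ := by
    have : ∫ t in (1 / 2 : ℝ)..1, ν (logVel η t) =
        ∫ t in (1 / 2 : ℝ)..1, ((fun t => ν (logVel δ t)) ∘ σ₂) t * deriv σ₂ t := by
      refine intervalIntegral.integral_congr_Ioo_of_le (by norm_num) fun t ht => ?_
      have := logVel_of_eventuallyEq hδ (η := η) (a := 1) (b := 1) (d₂ t) (by
        filter_upwards [Ioi_mem_nhds ht.1] with τ hτ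
        have : σ₁ τ = 1 := Real.smoothTransition.one_of_one_le (by linarith [mem_Ioi.1 hτ])
        simp [hη_def, this])
      simp only [Function.comp]
      rw [this, hν.smul, inv_one, Ad_one, abs_of_nonneg (p₂ t), mul_comm]
    rw [this, intervalIntegral.integral_comp_mul_deriv (fun t _ => d₂ t)
      (c₂.continuous_deriv le_rfl).continuousOn (hν.continuous_comp hδ)]
    simp only [σ₂]
    norm_num [speedLength]
  rw [← i1, ← i2, speedLength]
  exact intervalIntegral.integral_add_adjacent_intervals (μ := MeasureTheory.volume)
    ((hν.continuous_comp hη).intervalIntegrable _ _)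
    ((hν.continuous_comp hη).intervalIntegrable _ _)

/-- The curve `a exp(tX)` has constant logarithmic velocity `X`, so its length is exactly `ν X`. -/
theorem joinedBy_mul_exp (hG : IsClosed (G : Set (U N))) {ν : Mat N → ℝ} {X : Mat N}
    (hX : X ∈ lieAlg G) (a b : G) (hb : NormedSpace.exp X = ((b : U N) : Mat N)) :
    JoinedBy ν (QuotientGroup.mk a : CosetSpace G L) (QuotientGroup.mk (a * b)) (ν X) := by
  obtain ⟨γ, hγ, e⟩ := exists_curve_of_exp ((mem_lieAlg_iff_exp hG).1 hX)
  have hsm : IsContDiff 1 (fun t => ((γ t : U N) : Mat N)) := by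
    simp only [e]; exact contDiff_entry (contDiff_expMat X)
  have e0 : γ 0 = 1 := Subtype.ext (by simp [e])
  have e1 : γ 1 = b := Subtype.ext (by simp [e, hb])
  set γ' : ℝ → G := fun t => ⟨γ t, hγ t⟩
  have hl : ∀ t, logVel γ' t = X := fun t => by
    have hd : HasDerivAt (fun s => ((γ s : U N) : Mat N)) ((γ t : Mat N) * X) t := by
      simp only [e]; exact hasDerivAt_expMat X t
    rw [logVel]
    change star (γ t : Mat N) * velocity (fun s => ((γ s : U N) : Mat N)) t = X
    rw [velocity_eq hd, ← Matrix.mul_assoc, star_mul_self_coe, Matrix.one_mul]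
  have hl' : ∀ t, logVel (fun t => a * γ' t) t = X := fun t => by
    have := logVel_of_eventuallyEq (γ := γ') hsm (η := fun t => a * γ' t) (a := a) (b := 1)
      (hasDerivAt_id t) (Eventually.of_forall fun τ => by simp)
    simpa [Ad_one, hl] using this
  refine ⟨fun t => a * γ' t, ?_, ?_, ?_, ?_⟩
  · exact contDiff_entry (contDiff_const.mul hsm.contDiff)
  · have : γ' 0 = 1 := Subtype.ext e0
    simp [this]
  · have : γ' 1 = b := Subtype.ext e1
    simp [this]
  · simp [speedLength, hl']

/-- Small balls around the identity consist of exponentials of short vectors. -/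
theorem eventually_joinedBy (hG : IsClosed (G : Set (U N))) {ν : Mat N → ℝ} {ε : ℝ} (hε : 0 < ε)
    (hν : Continuous ν) (h0 : ν 0 = 0) (a : G) :
    ∀ᶠ b in 𝓝 a, ∃ X ∈ lieAlg G, ν X < ε ∧ NormedSpace.exp X = ((a⁻¹ * b : G) : Mat N) := by
  obtain ⟨δ, hδ, hδε⟩ := Metric.continuousAt_iff.1 (hν.continuousAt (x := 0)) ε hε
  have ht : Tendsto (fun b : G => ((a⁻¹ * b : G) : U N)) (𝓝 a) (𝓝 1) := by
    have : Continuous (fun b : G => ((a⁻¹ * b : G) : U N)) :=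
      continuous_subtype_val.comp (continuous_const.mul continuous_id)
    simpa using this.tendsto a
  filter_upwards [ht.eventually (eventually_exists_exp hG hδ)] with b hb
  obtain ⟨X, hX, hXδ, e⟩ := hb (a⁻¹ * b).2
  refine ⟨X, hX, ?_, e⟩
  have := hδε (x := X) (by simpa using hXδ)
  rw [h0, Real.dist_eq, sub_zero] at this
  exact (le_abs_self _).trans_lt this

theorem IsInvariantSpeed.zero {ν : Mat N → ℝ} (hν : IsInvariantSpeed G L ν) : ν 0 = 0 := by
  simpa using hν.smul 0 0

/-- In a compact connected coset space any two points are joined by a curve of bounded length. -/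
theorem IsInvariantSpeed.exists_bound (hG : IsClosed (G : Set (U N)))
    [ConnectedSpace (CosetSpace G L)] {ν : Mat N → ℝ} (hν : IsInvariantSpeed G L ν) :
    ∃ C, ∀ x y : CosetSpace G L, ∃ r ≤ C, JoinedBy ν x y r := by
  have : CompactSpace G := isCompact_iff_compactSpace.1 hG.isCompact
  have hnear : ∀ x : CosetSpace G L, ∀ᶠ y in 𝓝 x, ∃ r ≤ 1, JoinedBy ν x y r := by
    intro x
    obtain ⟨a, rfl⟩ := QuotientGroup.mk_surjective x
    have := (QuotientGroup.isOpenMap_coe (N := L.subgroupOf G)).image_mem_nhds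
      (eventually_joinedBy hG one_pos hν.continuous hν.zero a)
    refine mem_of_superset this ?_
    rintro _ ⟨b, ⟨X, hX, hlt, e⟩, rfl⟩
    refine ⟨ν X, hlt.le, ?_⟩
    have := joinedBy_mul_exp (L := L) (ν := ν) hG hX a (a⁻¹ * b) e
    rwa [mul_inv_cancel_left] at this
  set o : CosetSpace G L := QuotientGroup.mk 1
  set S : Set (CosetSpace G L) := {x | ∃ r, JoinedBy ν o x r}
  -- Points near `x` are joined to `x` by exponential arcs of length at most `1`, so being reachable
  -- from `o` is an open condition, and so is being unreachable.
  have hS : IsClopen S := by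
    constructor
    · rw [← isOpen_compl_iff, isOpen_iff_mem_nhds]
      intro x hx
      filter_upwards [hnear x] with y ⟨r, _, hr⟩ ⟨s, hs⟩
      exact hx ⟨_, hs.trans hG hν (hr.symm hν)⟩
    · rw [isOpen_iff_mem_nhds]
      rintro x ⟨s, hs⟩
      filter_upwards [hnear x] with y ⟨r, _, hr⟩
      exact ⟨_, hs.trans hG hν hr⟩
  have hSu : S = univ := by
    refine hS.eq_univ ⟨o, ν 0, ?_⟩
    have := joinedBy_mul_exp (L := L) (ν := ν) hG (zero_mem (lieAlg G)) 1 1 (by simp)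
    simpa using this
  -- A length bound at `x` gives a bound larger by `1` on a neighbourhood; finitely many of these
  -- cover the compact space.
  have key : ∃ C, ∀ x ∈ (univ : Set (CosetSpace G L)), ∃ r ≤ C, JoinedBy ν o x r := by
    refine isCompact_univ.induction_on (p := fun s => ∃ C, ∀ x ∈ s, ∃ r ≤ C, JoinedBy ν o x r)
      ⟨0, by simp⟩ ?_ ?_ ?_
    · rintro s t hst ⟨C, hC⟩
      exact ⟨C, fun x hx => hC x (hst hx)⟩
    · rintro s t ⟨C, hC⟩ ⟨D, hD⟩
      refine ⟨max C D, fun x hx => ?_⟩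
      rcases hx with hx | hx
      · obtain ⟨r, hr, hj⟩ := hC x hx
        exact ⟨r, hr.trans (le_max_left _ _), hj⟩
      · obtain ⟨r, hr, hj⟩ := hD x hx
        exact ⟨r, hr.trans (le_max_right _ _), hj⟩
    · intro x _
      obtain ⟨s, hs⟩ : x ∈ S := hSu ▸ mem_univ x
      refine ⟨_, mem_nhdsWithin_of_mem_nhds (hnear x), s + 1, ?_⟩
      rintro y ⟨r, hr, hj⟩
      exact ⟨s + r, by linarith, hs.trans hG hν hj⟩
  obtain ⟨C, hC⟩ := key
  refine ⟨C + C, fun x y => ?_⟩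
  obtain ⟨r, hr, hj⟩ := hC x (mem_univ x)
  obtain ⟨s, hs, hj'⟩ := hC y (mem_univ y)
  exact ⟨r + s, by linarith, (hj.symm hν).trans hG hν hj'⟩

/-- Left translates of curves in a smaller group. -/
theorem JoinedBy.mul_left {H K : Subgroup (U N)} (hHG : H ≤ G) {ν : Mat N → ℝ} {u v : H} {r : ℝ}
    (h : JoinedBy ν (QuotientGroup.mk u : CosetSpace H K) (QuotientGroup.mk v) r) (a : G) :
    JoinedBy ν (QuotientGroup.mk (a * ⟨u, hHG u.2⟩) : CosetSpace G K)
      (QuotientGroup.mk (a * ⟨v, hHG v.2⟩)) r := by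
  obtain ⟨γ, hγ, hu, hv, rfl⟩ := h
  refine ⟨fun t => a * ⟨γ t, hHG (γ t).2⟩, ?_, ?_, ?_, ?_⟩
  · exact contDiff_entry (contDiff_const.mul hγ.contDiff)
  · have h1 : ((γ 0)⁻¹ * u : H) ∈ K.subgroupOf H := QuotientGroup.eq.1 hu
    rw [QuotientGroup.eq, _root_.mul_inv_rev, mul_assoc, inv_mul_cancel_left]
    exact h1
  · have h1 : ((γ 1)⁻¹ * v : H) ∈ K.subgroupOf H := QuotientGroup.eq.1 hv
    rw [QuotientGroup.eq, _root_.mul_inv_rev, mul_assoc, inv_mul_cancel_left]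
    exact h1
  · have e : ∀ t, logVel (fun t => a * (⟨γ t, hHG (γ t).2⟩ : G)) t = logVel γ t := fun t => by
      have := logVel_of_eventuallyEq hγ (η := fun t => a * (⟨γ t, hHG (γ t).2⟩ : G)) (a := a)
        (b := 1) (hasDerivAt_id t) (Eventually.of_forall fun τ => by simp)
      simpa [Ad_one] using this
    simp only [speedLength, e]

end

/-! ### The distance defined by an invariant speed -/

section

variable {N : ℕ} {G L : Subgroup (U N)} {ν : Mat N → ℝ}

/-- The distance on `G/L` given by an invariant speed. -/
noncomputable def speedDist (ν : Mat N → ℝ) (x y : CosetSpace G L) : ℝ := sInf {r | JoinedBy ν x y r}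

theorem IsInvariantSpeed.speedDist_le (hν : IsInvariantSpeed G L ν) {x y : CosetSpace G L} {r : ℝ}
    (h : JoinedBy ν x y r) : speedDist ν x y ≤ r :=
  csInf_le ⟨0, fun _ hs => JoinedBy.nonneg hν hs⟩ h

/-- The given curve guards against `sInf ∅ = 0`; lower estimates of the distance need at least one
joining curve. -/
theorem exists_joinedBy_lt {x y : CosetSpace G L} {r : ℝ} (h : JoinedBy ν x y r) {ε : ℝ}
    (hε : 0 < ε) : ∃ s < speedDist ν x y + ε, JoinedBy ν x y s := by
  obtain ⟨s, hs, hlt⟩ := Real.lt_sInf_add_pos (s := {r | JoinedBy ν x y r}) ⟨r, h⟩ hε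
  exact ⟨s, hlt, hs⟩

theorem le_speedDist {x y : CosetSpace G L} {r c : ℝ} (h : JoinedBy ν x y r)
    (hc : ∀ s, JoinedBy ν x y s → c ≤ s) : c ≤ speedDist ν x y :=
  le_csInf ⟨r, h⟩ hc

theorem IsInvariantSpeed.speedDist_triangle (hG : IsClosed (G : Set (U N)))
    (hν : IsInvariantSpeed G L ν) {x y z : CosetSpace G L} {r s : ℝ} (h : JoinedBy ν x y r)
    (h' : JoinedBy ν y z s) : speedDist ν x z ≤ speedDist ν x y + speedDist ν y z := by
  refine le_of_forall_pos_le_add fun ε hε => ?_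
  obtain ⟨r', hr', hj⟩ := exists_joinedBy_lt h (half_pos hε)
  obtain ⟨s', hs', hj'⟩ := exists_joinedBy_lt h' (half_pos hε)
  have := hν.speedDist_le (hj.trans hG hν hj')
  linarith

end

theorem sqrt_add_le_add_sqrt {a b : ℝ} (ha : 0 ≤ a) (hb : 0 ≤ b) :
    Real.sqrt (a + b) ≤ Real.sqrt a + Real.sqrt b := by
  refine Real.sqrt_le_iff.2 ⟨by positivity, ?_⟩
  nlinarith [Real.sq_sqrt ha, Real.sq_sqrt hb, Real.sqrt_nonneg a, Real.sqrt_nonneg b,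
    mul_nonneg (Real.sqrt_nonneg a) (Real.sqrt_nonneg b)]

/-- The speed of the invariant metric `x₁ Q|p₁ + x₂ Q|p₂`. -/
noncomputable def diagSpeed {N : ℕ} (Q : LinearMap.BilinForm ℝ (Mat N)) (H K : Subgroup (U N))
    (p₁ p₂ : Submodule ℝ (Mat N)) (x₁ x₂ : ℝ) (A : Mat N) : ℝ :=
  Real.sqrt (x₁ * Q (cp₁ K p₁ p₂ A) (cp₁ K p₁ p₂ A) + x₂ * Q (cp₂ H p₂ A) (cp₂ H p₂ A))

theorem continuous_bilin {E : Type*} [NormedAddCommGroup E] [NormedSpace ℝ E]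
    [FiniteDimensional ℝ E] (Q : LinearMap.BilinForm ℝ E) (c : E →ₗ[ℝ] E) :
    Continuous fun A => Q (c A) (c A) := by
  let B : E →L[ℝ] E →L[ℝ] ℝ :=
    LinearMap.toContinuousLinearMap (LinearMap.toContinuousLinearMap.toLinearMap ∘ₗ Q)
  have hc : Continuous c := c.continuous_of_finiteDimensional
  exact (B.continuous.comp hc).clm_apply hc

namespace NonMaximalTwoSummand

variable {N : ℕ} {G H K : Subgroup (U N)} {Q : LinearMap.BilinForm ℝ (Mat N)}
  {p₁ p₂ : Submodule ℝ (Mat N)} (h : NonMaximalTwoSummand G H K Q p₁ p₂)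
include h

/-! ## Comparison of the distances on `G/K`, `G/H` and `H/K` -/

theorem Q₁_nonneg (A : Mat N) : 0 ≤ Q (cp₁ K p₁ p₂ A) (cp₁ K p₁ p₂ A) :=
  h.background.nonneg (h.p₁_le (cp₁_mem A))

theorem Q₂_nonneg (A : Mat N) : 0 ≤ Q (cp₂ H p₂ A) (cp₂ H p₂ A) :=
  h.background.nonneg (h.p₂_le (cp₂_mem A))

omit h in
theorem continuous_diagSpeed (x₁ x₂ : ℝ) : Continuous (diagSpeed Q H K p₁ p₂ x₁ x₂) :=
  Real.continuous_sqrt.comp ((continuous_const.mul (continuous_bilin Q _)).add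
    (continuous_const.mul (continuous_bilin Q _)))

omit h in
theorem diagSpeed_smul (x₁ x₂ c : ℝ) (A : Mat N) :
    diagSpeed Q H K p₁ p₂ x₁ x₂ (c • A) = |c| * diagSpeed Q H K p₁ p₂ x₁ x₂ A := by
  rw [diagSpeed, diagSpeed, ← Real.sqrt_sq_eq_abs, ← Real.sqrt_mul (sq_nonneg c)]
  simp only [map_smul, LinearMap.smul_apply, smul_eq_mul]
  congr 1
  ring

theorem isInvariantSpeed (x₁ x₂ : ℝ) :
    IsInvariantSpeed G K (diagSpeed Q H K p₁ p₂ x₁ x₂) where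
  continuous := continuous_diagSpeed x₁ x₂
  nonneg _ := Real.sqrt_nonneg _
  smul := diagSpeed_smul x₁ x₂
  inv u hu A hA := by
    rw [diagSpeed, diagSpeed, h.cp₁_Ad hu hA, h.cp₂_Ad (h.K_le_H hu) hA,
      h.background.inv u (h.K_le_G hu) _ (h.p₁_le (cp₁_mem _)) _ (h.p₁_le (cp₁_mem _)),
      h.background.inv u (h.K_le_G hu) _ (h.p₂_le (cp₂_mem _)) _ (h.p₂_le (cp₂_mem _))]

/-- With first coefficient `0` only the `p₂`-component is seen, and that projection commutes with
all of `Ad(H)`. -/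
theorem isInvariantSpeed_base (x₂ : ℝ) :
    IsInvariantSpeed G H (diagSpeed Q H K p₁ p₂ 0 x₂) where
  continuous := continuous_diagSpeed 0 x₂
  nonneg _ := Real.sqrt_nonneg _
  smul := diagSpeed_smul 0 x₂
  inv u hu A hA := by
    rw [diagSpeed, diagSpeed, zero_mul, zero_mul, h.cp₂_Ad hu hA,
      h.background.inv u (h.H_le_G hu) _ (h.p₂_le (cp₂_mem _)) _ (h.p₂_le (cp₂_mem _))]

theorem isInvariantSpeed_fibre (x₁ x₂ : ℝ) :
    IsInvariantSpeed H K (diagSpeed Q H K p₁ p₂ x₁ x₂) where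
  continuous := continuous_diagSpeed x₁ x₂
  nonneg _ := Real.sqrt_nonneg _
  smul := diagSpeed_smul x₁ x₂
  inv u hu A hA := (h.isInvariantSpeed x₁ x₂).inv u hu A (h.lieAlg_H_le hA)

/-- The distances on `G/K`, `G/H` and `H/K` are all expressed through the one family `diagSpeed`, so
that a single curve in the group can be measured in several of them. Closedness of `G` places its
logarithmic velocity in `𝔤`, where the projections are meaningful. -/
theorem rdist_total (x₁ x₂ : ℝ) (x y : CosetSpace G K) :
    rdist G K (isotropy Q G K) (diagForm Q G H K p₁ p₂ x₁ x₂) x y =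
      speedDist (diagSpeed Q H K p₁ p₂ x₁ x₂) x y := by
  have key : ∀ γ : ℝ → G, IsC1 γ → curveLength K (isotropy Q G K)
      (diagForm Q G H K p₁ p₂ x₁ x₂) γ = speedLength (diagSpeed Q H K p₁ p₂ x₁ x₂) γ := by
    intro γ hγ
    refine intervalIntegral.integral_congr fun t _ => ?_
    change Real.sqrt (diagForm Q G H K p₁ p₂ x₁ x₂ (proj (lieAlg K) (isotropy Q G K) (logVel γ t))
      (proj (lieAlg K) (isotropy Q G K) (logVel γ t))) = _
    have hA := logVel_mem h.closed_G hγ t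
    have e₁ : cp₁ K p₁ p₂ (proj (lieAlg K) (isotropy Q G K) (logVel γ t)) =
        cp₁ K p₁ p₂ (logVel γ t) := by
      rw [h.proj_eq hA, map_add, h.cp₁_of_mem (cp₁_mem _), h.cp₁_of_mem₂ (cp₂_mem _), add_zero]
    have e₂ : cp₂ H p₂ (proj (lieAlg K) (isotropy Q G K) (logVel γ t)) =
        cp₂ H p₂ (logVel γ t) := by
      rw [h.proj_eq hA, map_add, h.cp₂_of_mem (cp₂_mem _), h.cp₂_of_mem₁ (cp₁_mem _), zero_add]
    rw [diagForm_apply, e₁, e₂, diagSpeed]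
  refine congrArg sInf (Set.ext fun r => ?_)
  constructor
  · rintro ⟨γ, hγ, hx, hy, hr⟩
    exact ⟨γ, hγ, hx, hy, hr.trans (key γ hγ)⟩
  · rintro ⟨γ, hγ, hx, hy, hr⟩
    exact ⟨γ, hγ, hx, hy, hr.trans (key γ hγ).symm⟩

omit h in
theorem rdist_base (b : ℝ) (x y : CosetSpace G H) :
    rdist G H p₂ (b • Q.compl₁₂ p₂.subtype p₂.subtype) x y =
      speedDist (diagSpeed Q H K p₁ p₂ 0 b) x y := by
  have key : ∀ γ : ℝ → G, curveLength H p₂ (b • Q.compl₁₂ p₂.subtype p₂.subtype) γ =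
      speedLength (diagSpeed Q H K p₁ p₂ 0 b) γ := by
    intro γ
    refine intervalIntegral.integral_congr fun t _ => ?_
    simp only [diagSpeed, zero_mul, zero_add]
    rfl
  refine congrArg sInf (Set.ext fun r => ?_)
  simp only [key]
  rfl

theorem rdist_fibre (x₁ x₂ : ℝ) (x y : CosetSpace H K) :
    rdist H K p₁ (restrictForm h.le₁ (diagForm Q G H K p₁ p₂ x₁ x₂)) x y =
      speedDist (diagSpeed Q H K p₁ p₂ x₁ x₂) x y := by
  have hd : Disjoint (lieAlg K) p₁ := h.disjoint_k_p.mono_right h.le₁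
  have key : ∀ γ : ℝ → H, IsC1 γ → curveLength K p₁ (restrictForm h.le₁
      (diagForm Q G H K p₁ p₂ x₁ x₂)) γ = speedLength (diagSpeed Q H K p₁ p₂ x₁ x₂) γ := by
    intro γ hγ
    refine intervalIntegral.integral_congr fun t _ => ?_
    change Real.sqrt (diagForm Q G H K p₁ p₂ x₁ x₂
      (Submodule.inclusion h.le₁ (proj (lieAlg K) p₁ (logVel γ t)))
      (Submodule.inclusion h.le₁ (proj (lieAlg K) p₁ (logVel γ t)))) = _
    have hA := logVel_mem h.closed_H hγ t
    rw [h.lieAlg_H] at hA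
    obtain ⟨A, hA, B, hB, e⟩ := Submodule.mem_sup.1 hA
    rw [← e, map_add, proj_apply_left hd hA, zero_add, proj_apply_right hd ⟨B, hB⟩, diagForm_apply,
      diagSpeed]
    simp only [Submodule.coe_inclusion, map_add, h.cp₁_of_mem_k hA, h.cp₂_of_mem_k hA,
      h.cp₁_of_mem hB, h.cp₂_of_mem₁ hB, zero_add]
  refine congrArg sInf (Set.ext fun r => ?_)
  constructor
  · rintro ⟨γ, hγ, hx, hy, hr⟩
    exact ⟨γ, hγ, hx, hy, hr.trans (key γ hγ)⟩
  · rintro ⟨γ, hγ, hx, hy, hr⟩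
    exact ⟨γ, hγ, hx, hy, hr.trans (key γ hγ).symm⟩

/-- Lengths in the fibre scale with `√x₁`. -/
theorem joinedBy_fibre_scale (x₁ x₂ : ℝ) {x y : CosetSpace H K} {r : ℝ}
    (hr : JoinedBy (diagSpeed Q H K p₁ p₂ 1 0) x y r) :
    JoinedBy (diagSpeed Q H K p₁ p₂ x₁ x₂) x y (Real.sqrt x₁ * r) := by
  obtain ⟨γ, hγ, hx, hy, rfl⟩ := hr
  refine ⟨γ, hγ, hx, hy, ?_⟩
  rw [speedLength, speedLength, ← intervalIntegral.integral_const_mul]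
  refine intervalIntegral.integral_congr fun t _ => ?_
  have hA := logVel_mem h.closed_H hγ t
  simp only [diagSpeed, h.cp₂_of_mem_H hA, map_zero, mul_zero, add_zero, one_mul]
  rw [Real.sqrt_mul' _ (h.Q₁_nonneg _)]

/-- Projecting curves to the base does not increase lengths. -/
theorem joinedBy_base {x₁ x₂ b : ℝ} (hx₁ : 0 ≤ x₁) (hb : 0 < b) {u v : G} {r : ℝ}
    (hr : JoinedBy (diagSpeed Q H K p₁ p₂ x₁ x₂) (QuotientGroup.mk u : CosetSpace G K)
      (QuotientGroup.mk v) r) :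
    ∃ s, JoinedBy (diagSpeed Q H K p₁ p₂ 0 b) (QuotientGroup.mk u : CosetSpace G H)
      (QuotientGroup.mk v) s ∧ Real.sqrt (x₂ / b) * s ≤ r := by
  obtain ⟨γ, hγ, hx, hy, rfl⟩ := hr
  refine ⟨_, ⟨γ, hγ, ?_, ?_, rfl⟩, ?_⟩
  · exact QuotientGroup.eq.2 (Subgroup.comap_mono h.K_le_H (QuotientGroup.eq.1 hx))
  · exact QuotientGroup.eq.2 (Subgroup.comap_mono h.K_le_H (QuotientGroup.eq.1 hy))
  · rw [speedLength, speedLength, ← intervalIntegral.integral_const_mul]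
    refine intervalIntegral.integral_mono zero_le_one
      ((continuous_const.mul ((h.isInvariantSpeed 0 b).continuous_comp hγ)).intervalIntegrable _ _)
      (((h.isInvariantSpeed x₁ x₂).continuous_comp hγ).intervalIntegrable _ _) fun t => ?_
    have q1 := h.Q₁_nonneg (logVel γ t)
    have q2 := h.Q₂_nonneg (logVel γ t)
    simp only [diagSpeed]
    rw [zero_mul, zero_add, ← Real.sqrt_mul' _ (mul_nonneg hb.le q2)]
    refine Real.sqrt_le_sqrt ?_
    have : x₂ / b * (b * Q (cp₂ H p₂ (logVel γ t)) (cp₂ H p₂ (logVel γ t))) =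
      x₂ * Q (cp₂ H p₂ (logVel γ t)) (cp₂ H p₂ (logVel γ t)) := by field_simp
    rw [this]
    have := mul_nonneg hx₁ q1
    linarith

/-- The length of a curve is bounded by its vertical and its horizontal length. -/
theorem speedLength_le {x₁ x₂ b : ℝ} (hx₁ : 0 ≤ x₁) (hx₂ : 0 ≤ x₂) (hb : 0 < b) {γ : ℝ → G} (hγ : IsC1 γ) :
    speedLength (diagSpeed Q H K p₁ p₂ x₁ x₂) γ ≤
      Real.sqrt x₁ * speedLength (diagSpeed Q H K p₁ p₂ 1 0) γ +
      Real.sqrt (x₂ / b) * speedLength (diagSpeed Q H K p₁ p₂ 0 b) γ := by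
  have c : ∀ y₁ y₂, Continuous fun t => diagSpeed Q H K p₁ p₂ y₁ y₂ (logVel γ t) :=
    fun y₁ y₂ => (h.isInvariantSpeed y₁ y₂).continuous_comp hγ
  have c₁ : Continuous fun t => Real.sqrt x₁ * diagSpeed Q H K p₁ p₂ 1 0 (logVel γ t) :=
    continuous_const.mul (c 1 0)
  have c₂ : Continuous fun t => Real.sqrt (x₂ / b) * diagSpeed Q H K p₁ p₂ 0 b (logVel γ t) :=
    continuous_const.mul (c 0 b)
  rw [speedLength, speedLength, speedLength, ← intervalIntegral.integral_const_mul,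
    ← intervalIntegral.integral_const_mul, ← intervalIntegral.integral_add
      (c₁.intervalIntegrable _ _) (c₂.intervalIntegrable _ _)]
  refine intervalIntegral.integral_mono zero_le_one ((c x₁ x₂).intervalIntegrable _ _)
    ((c₁.add c₂).intervalIntegrable _ _) fun t => ?_
  have q1 := h.Q₁_nonneg (logVel γ t)
  have q2 := h.Q₂_nonneg (logVel γ t)
  simp only [diagSpeed]
  rw [zero_mul, zero_mul, zero_add, add_zero, one_mul, ← Real.sqrt_mul' _ (mul_nonneg hb.le q2),
    ← Real.sqrt_mul' _ q1]
  have : x₂ / b * (b * Q (cp₂ H p₂ (logVel γ t)) (cp₂ H p₂ (logVel γ t))) =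
    x₂ * Q (cp₂ H p₂ (logVel γ t)) (cp₂ H p₂ (logVel γ t)) := by field_simp
  rw [this]
  exact sqrt_add_le_add_sqrt (mul_nonneg hx₁ q1) (mul_nonneg hx₂ q2)

theorem diagSpeed_mono {x₁ x₂ y₁ y₂ : ℝ} (h₁ : x₁ ≤ y₁) (h₂ : x₂ ≤ y₂) (A : Mat N) :
    diagSpeed Q H K p₁ p₂ x₁ x₂ A ≤ diagSpeed Q H K p₁ p₂ y₁ y₂ A :=
  Real.sqrt_le_sqrt (add_le_add (mul_le_mul_of_nonneg_right h₁ (h.Q₁_nonneg A))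
    (mul_le_mul_of_nonneg_right h₂ (h.Q₂_nonneg A)))

end NonMaximalTwoSummand

namespace NonMaximalTwoSummand

variable {N : ℕ} {G H K : Subgroup (U N)} {Q : LinearMap.BilinForm ℝ (Mat N)}
  {p₁ p₂ : Submodule ℝ (Mat N)} (h : NonMaximalTwoSummand G H K Q p₁ p₂)
include h

/-! ## Collapse -/

theorem restrictForm₁ (x₁ x₂ : ℝ) (X Y : p₁) :
    restrictForm h.le₁ (diagForm Q G H K p₁ p₂ x₁ x₂) X Y = x₁ * Q X Y := by
  change diagForm Q G H K p₁ p₂ x₁ x₂ (Submodule.inclusion h.le₁ X) (Submodule.inclusion h.le₁ Y) = _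
  rw [diagForm_apply]
  simp only [Submodule.coe_inclusion]
  rw [h.cp₁_of_mem X.2, h.cp₁_of_mem Y.2, h.cp₂_of_mem₁ X.2, map_zero, LinearMap.zero_apply,
    mul_zero, add_zero]

theorem restrictForm₂ (x₁ x₂ : ℝ) (X Y : p₂) :
    restrictForm h.le₂ (diagForm Q G H K p₁ p₂ x₁ x₂) X Y = x₂ * Q X Y := by
  change diagForm Q G H K p₁ p₂ x₁ x₂ (Submodule.inclusion h.le₂ X) (Submodule.inclusion h.le₂ Y) = _
  rw [diagForm_apply]
  simp only [Submodule.coe_inclusion]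
  rw [h.cp₂_of_mem X.2, h.cp₂_of_mem Y.2, h.cp₁_of_mem₂ X.2, map_zero, LinearMap.zero_apply,
    mul_zero, zero_add]

theorem exists_fibre_bound : ∃ C, 0 ≤ C ∧ ∀ (x₁ x₂ : ℝ) (x y : CosetSpace H K),
    ∃ r ≤ Real.sqrt x₁ * C, JoinedBy (diagSpeed Q H K p₁ p₂ x₁ x₂) x y r := by
  have := h.connected_fibre
  have hν := h.isInvariantSpeed_fibre 1 0
  obtain ⟨C, hC⟩ := hν.exists_bound h.closed_H
  refine ⟨max C 0, le_max_right _ _, fun x₁ x₂ x y => ?_⟩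
  obtain ⟨r, hr, hj⟩ := hC x y
  exact ⟨_, mul_le_mul_of_nonneg_left (hr.trans (le_max_left _ _)) (Real.sqrt_nonneg _),
    h.joinedBy_fibre_scale x₁ x₂ hj⟩

theorem fibreShrinks {x₁ x₂ : ℝ → ℝ} {T : ℝ} (hx₁ : Tendsto x₁ (𝓝[<] T) (𝓝 0)) :
    FibreShrinks H K h.le₁ (fun t => diagForm Q G H K p₁ p₂ (x₁ t) (x₂ t)) T := by
  constructor
  · intro X Y
    simp only [h.restrictForm₁]
    simpa using hx₁.mul_const (Q X Y)
  · intro ε hε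
    obtain ⟨C, -, hC⟩ := h.exists_fibre_bound
    have hs : Tendsto (fun t => Real.sqrt (x₁ t) * C) (𝓝[<] T) (𝓝 0) := by
      simpa using ((Real.continuous_sqrt.tendsto 0).comp hx₁).mul_const C
    filter_upwards [hs.eventually (gt_mem_nhds hε)] with t ht x y
    obtain ⟨r, hr, hj⟩ := hC (x₁ t) (x₂ t) x y
    rw [h.rdist_fibre]
    exact ((h.isInvariantSpeed_fibre (x₁ t) (x₂ t)).speedDist_le hj).trans_lt (hr.trans_lt ht)

theorem exists_total_bound {b : ℝ} (hb : 0 < b) : ∃ C, ∀ u v : G,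
    (∀ x₁ x₂, ∃ r, JoinedBy (diagSpeed Q H K p₁ p₂ x₁ x₂) (QuotientGroup.mk u : CosetSpace G K)
      (QuotientGroup.mk v) r) ∧
    ∃ r ≤ C, JoinedBy (diagSpeed Q H K p₁ p₂ 0 b) (QuotientGroup.mk u : CosetSpace G H)
      (QuotientGroup.mk v) r := by
  have := h.connected_total
  obtain ⟨C, hC⟩ := (h.isInvariantSpeed 1 b).exists_bound h.closed_G
  refine ⟨C, fun u v => ⟨fun x₁ x₂ => ?_, ?_⟩⟩
  · obtain ⟨r, -, γ, hγ, hu, hv, -⟩ := hC (QuotientGroup.mk u) (QuotientGroup.mk v)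
    exact ⟨_, γ, hγ, hu, hv, rfl⟩
  · obtain ⟨r, hr, hj⟩ := hC (QuotientGroup.mk u) (QuotientGroup.mk v)
    obtain ⟨s, hs, hle⟩ := h.joinedBy_base zero_le_one hb hj
    rw [div_self hb.ne', Real.sqrt_one, one_mul] at hle
    exact ⟨s, hle.trans hr, hs⟩

/-- Up to a small error, the distance on `G/K` is at most that on the base. -/
theorem eventually_total_le {x₁ x₂ : ℝ → ℝ} {T b : ℝ} (hb : 0 < b)
    (hpos : ∀ᶠ t in 𝓝[<] T, 0 < x₁ t ∧ 0 < x₂ t)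
    (hx₁ : Tendsto x₁ (𝓝[<] T) (𝓝 0)) (hx₂ : Tendsto x₂ (𝓝[<] T) (𝓝 b)) {ε : ℝ} (hε : 0 < ε) :
    ∀ᶠ t in 𝓝[<] T, ∀ z : G × G,
      speedDist (diagSpeed Q H K p₁ p₂ (x₁ t) (x₂ t)) (QuotientGroup.mk z.1 : CosetSpace G K)
        (QuotientGroup.mk z.2) <
      speedDist (diagSpeed Q H K p₁ p₂ 0 b) (QuotientGroup.mk z.1 : CosetSpace G H)
        (QuotientGroup.mk z.2) + ε := by
  have : CompactSpace G := isCompact_iff_compactSpace.1 h.closed_G.isCompact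
  have hG := h.closed_G
  have hνB := h.isInvariantSpeed_base b
  -- This speed eventually dominates the speed at time `t` and always dominates the base speed, so
  -- its small balls are small for both.
  have hνM := h.isInvariantSpeed 1 (b + 1)
  obtain ⟨C, hC0, hC⟩ := h.exists_fibre_bound
  obtain ⟨D, hD⟩ := h.exists_total_bound hb
  have hs₁ : Tendsto (fun t => Real.sqrt (x₁ t)) (𝓝[<] T) (𝓝 0) := by
    simpa [Function.comp_def] using (Real.continuous_sqrt.tendsto 0).comp hx₁
  have hs₂ : Tendsto (fun t => Real.sqrt (x₂ t / b)) (𝓝[<] T) (𝓝 1) := by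
    have := (Real.continuous_sqrt.tendsto (b / b)).comp (hx₂.div_const b)
    simpa [div_self hb.ne', Function.comp_def] using this
  -- The estimate is proved near each pair `(u, v)`, with a neighbourhood independent of `t`;
  -- compactness makes the time uniform over all pairs.
  have key := (isCompact_univ (X := G × G)).induction_on
    (p := fun S => ∀ᶠ t in 𝓝[<] T, ∀ z ∈ S,
      speedDist (diagSpeed Q H K p₁ p₂ (x₁ t) (x₂ t)) (QuotientGroup.mk z.1 : CosetSpace G K)
        (QuotientGroup.mk z.2) <
      speedDist (diagSpeed Q H K p₁ p₂ 0 b) (QuotientGroup.mk z.1 : CosetSpace G H)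
        (QuotientGroup.mk z.2) + ε)
    (by simp) (fun S S' hS hp => hp.mono fun t ht z hz => ht z (hS hz))
    (fun S S' hS hS' => by
      filter_upwards [hS, hS'] with t h1 h2 z hz
      exact hz.elim (h1 z) (h2 z)) ?_
  · simpa using key
  rintro ⟨u, v⟩ -
  -- Six errors of size `δ` accumulate: two short arcs at the ends in `G/K`, two in `G/H`, one for
  -- near-minimality of `γ` and one for the time limit.
  set δ := ε / 8 with hδ_def
  have hδ : 0 < δ := by positivity
  obtain ⟨r₀, -, hr₀⟩ := (hD u v).2
  obtain ⟨r, hr, γ, hγ, hu, hv, hrγ⟩ := exists_joinedBy_lt hr₀ hδ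
  set L₁ := speedLength (diagSpeed Q H K p₁ p₂ 1 0) γ
  have hnear := fun w : G => eventually_joinedBy hG hδ hνM.continuous hνM.zero w
  refine ⟨{z | (∃ X ∈ lieAlg G, diagSpeed Q H K p₁ p₂ 1 (b + 1) X < δ ∧
      NormedSpace.exp X = ((u⁻¹ * z.1 : G) : Mat N)) ∧
    ∃ X ∈ lieAlg G, diagSpeed Q H K p₁ p₂ 1 (b + 1) X < δ ∧
      NormedSpace.exp X = ((v⁻¹ * z.2 : G) : Mat N)},
    mem_nhdsWithin_of_mem_nhds ((hnear u).prod_inl_nhds v |>.and ((hnear v).prod_inr_nhds u)), ?_⟩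
  have l₁ : Tendsto (fun t => Real.sqrt (x₁ t) * (2 * C + L₁) + Real.sqrt (x₂ t / b) * r)
      (𝓝[<] T) (𝓝 r) := by
    simpa using (hs₁.mul_const (2 * C + L₁)).add (hs₂.mul_const r)
  filter_upwards [hpos, l₁.eventually (gt_mem_nhds (lt_add_of_pos_right r hδ)),
    hx₁.eventually (ge_mem_nhds one_pos),
    hx₂.eventually (ge_mem_nhds (lt_add_one b))] with t ⟨h1, h2⟩ hl hx₁1 hx₂1
  rintro ⟨u', v'⟩ ⟨⟨X, hX, hXδ, eX⟩, Y, hY, hYδ, eY⟩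
  set ν := diagSpeed Q H K p₁ p₂ (x₁ t) (x₂ t)
  have hν : IsInvariantSpeed G K ν := h.isInvariantSpeed (x₁ t) (x₂ t)
  have jX : ∀ {L : Subgroup (U N)} (μ : Mat N → ℝ), JoinedBy μ
      (QuotientGroup.mk u : CosetSpace G L) (QuotientGroup.mk u') (μ X) := fun {L} μ => by
    have := joinedBy_mul_exp (L := L) (ν := μ) hG hX u (u⁻¹ * u') eX
    rwa [mul_inv_cancel_left] at this
  have jY : ∀ {L : Subgroup (U N)} (μ : Mat N → ℝ), JoinedBy μ
      (QuotientGroup.mk v : CosetSpace G L) (QuotientGroup.mk v') (μ Y) := fun {L} μ => by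
    have := joinedBy_mul_exp (L := L) (ν := μ) hG hY v (v⁻¹ * v') eY
    rwa [mul_inv_cancel_left] at this
  have fib : ∀ w w' : G, (QuotientGroup.mk w : CosetSpace G H) = QuotientGroup.mk w' →
      ∃ ρ ≤ Real.sqrt (x₁ t) * C, JoinedBy ν (QuotientGroup.mk w : CosetSpace G K)
        (QuotientGroup.mk w') ρ := by
    intro w w' hw
    have hk' : w⁻¹ * w' ∈ H.subgroupOf G := QuotientGroup.eq.1 hw
    have hk : ((w⁻¹ * w' : G) : U N) ∈ H := hk'
    obtain ⟨ρ, hρ, hj⟩ := hC (x₁ t) (x₂ t) (QuotientGroup.mk 1) (QuotientGroup.mk ⟨_, hk⟩)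
    have := hj.mul_left h.H_le_G w
    refine ⟨ρ, hρ, ?_⟩
    convert this using 2
    · exact (mul_one w).symm
    · exact (mul_inv_cancel_left w w').symm
  obtain ⟨ρ, hρ, jρ⟩ := fib u (γ 0) hu.symm
  obtain ⟨ρ', hρ', jρ'⟩ := fib (γ 1) v hv
  have jγ : JoinedBy ν (QuotientGroup.mk (γ 0) : CosetSpace G K) (QuotientGroup.mk (γ 1))
    (speedLength ν γ) := ⟨γ, hγ, rfl, rfl, rfl⟩
  have lγ := h.speedLength_le h1.le h2.le hb hγ
  rw [← hrγ] at lγ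
  -- The route is `u'` to `u`, along the fibre to `γ 0`, along `γ`, along the fibre from `γ 1` to
  -- `v`, then to `v'`.
  have tot := (((((jX ν).symm hν).trans hG hν jρ).trans hG hν jγ).trans hG hν jρ').trans hG hν
    (jY ν)
  have d1 := hν.speedDist_le tot
  have bX : ν X < δ := (h.diagSpeed_mono hx₁1 hx₂1 X).trans_lt hXδ
  have bY : ν Y < δ := (h.diagSpeed_mono hx₁1 hx₂1 Y).trans_lt hYδ
  have bX' : diagSpeed Q H K p₁ p₂ 0 b X < δ :=
    (h.diagSpeed_mono zero_le_one (le_add_of_nonneg_right zero_le_one) X).trans_lt hXδ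
  have bY' : diagSpeed Q H K p₁ p₂ 0 b Y < δ :=
    (h.diagSpeed_mono zero_le_one (le_add_of_nonneg_right zero_le_one) Y).trans_lt hYδ
  obtain ⟨s₀, -, hs₀⟩ := (hD u' v').2
  obtain ⟨s₁, -, hs₁⟩ := (hD u v').2
  have t1 := hνB.speedDist_triangle hG hs₁ ((jY (L := H) _).symm hνB)
  have t2 := hνB.speedDist_triangle hG (jX (L := H) _) hs₀
  have t3 := hνB.speedDist_le ((jY (L := H) _).symm hνB)
  have t4 := hνB.speedDist_le (jX (L := H) (diagSpeed Q H K p₁ p₂ 0 b))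
  change speedDist ν _ _ < _
  simp only at d1 ⊢
  linarith

/-- Up to a small error, the distance on the base is at most that on `G/K`. -/
theorem eventually_base_le {x₁ x₂ : ℝ → ℝ} {T b : ℝ} (hb : 0 < b)
    (hpos : ∀ᶠ t in 𝓝[<] T, 0 < x₁ t ∧ 0 < x₂ t)
    (hx₂ : Tendsto x₂ (𝓝[<] T) (𝓝 b)) {ε : ℝ} (hε : 0 < ε) :
    ∀ᶠ t in 𝓝[<] T, ∀ u v : G,
      speedDist (diagSpeed Q H K p₁ p₂ 0 b) (QuotientGroup.mk u : CosetSpace G H)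
        (QuotientGroup.mk v) <
      speedDist (diagSpeed Q H K p₁ p₂ (x₁ t) (x₂ t)) (QuotientGroup.mk u : CosetSpace G K)
        (QuotientGroup.mk v) + ε := by
  obtain ⟨D, hD⟩ := h.exists_total_bound hb
  have hνB := h.isInvariantSpeed_base b
  have hs₂ : Tendsto (fun t => |1 - Real.sqrt (x₂ t / b)| * D) (𝓝[<] T) (𝓝 0) := by
    have := (Real.continuous_sqrt.tendsto (b / b)).comp (hx₂.div_const b)
    rw [div_self hb.ne', Real.sqrt_one] at this
    simpa [Function.comp_def] using ((tendsto_const_nhds (x := (1 : ℝ))).sub this).abs.mul_const D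
  filter_upwards [hpos, hs₂.eventually (gt_mem_nhds hε)] with t ⟨h1, h2⟩ hlt u v
  obtain ⟨r, hr⟩ := (hD u v).1 (x₁ t) (x₂ t)
  obtain ⟨s, hsD, hs⟩ := (hD u v).2
  set d := speedDist (diagSpeed Q H K p₁ p₂ 0 b) (QuotientGroup.mk u : CosetSpace G H)
    (QuotientGroup.mk v) with hd
  have hd0 : 0 ≤ d := le_speedDist hs fun s hs => JoinedBy.nonneg hνB hs
  have hdD : d ≤ D := (hνB.speedDist_le hs).trans hsD
  have hle : Real.sqrt (x₂ t / b) * d ≤ speedDist (diagSpeed Q H K p₁ p₂ (x₁ t) (x₂ t))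
      (QuotientGroup.mk u : CosetSpace G K) (QuotientGroup.mk v) := by
    refine le_speedDist hr fun s hs => ?_
    obtain ⟨s', hs', hle⟩ := h.joinedBy_base h1.le hb hs
    exact (mul_le_mul_of_nonneg_left (hνB.speedDist_le hs') (Real.sqrt_nonneg _)).trans hle
  -- Base distances are at most `D`, so the multiplicative error becomes a uniform additive one.
  have e1 : (1 - Real.sqrt (x₂ t / b)) * d ≤ |1 - Real.sqrt (x₂ t / b)| * D :=
    (mul_le_mul_of_nonneg_right (le_abs_self _) hd0).trans
      (mul_le_mul_of_nonneg_left hdD (abs_nonneg _))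
  linarith

theorem convergesToBase {x₁ x₂ : ℝ → ℝ} {T b : ℝ} (hb : 0 < b)
    (hpos : ∀ᶠ t in 𝓝[<] T, 0 < x₁ t ∧ 0 < x₂ t)
    (hx₁ : Tendsto x₁ (𝓝[<] T) (𝓝 0)) (hx₂ : Tendsto x₂ (𝓝[<] T) (𝓝 b)) :
    ConvergesToBase G H K h.le₂ (fun t => diagForm Q G H K p₁ p₂ (x₁ t) (x₂ t)) T := by
  refine ⟨b • Q.compl₁₂ p₂.subtype p₂.subtype, ⟨fun X Y => ?_, fun X hX => ?_, ?_⟩,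
    fun X Y => ?_, ?_⟩
  · change b * Q X Y = b * Q Y X
    rw [h.background.symm _ (h.p₂_le X.2) _ (h.p₂_le Y.2)]
  · exact mul_pos hb (h.background.pos _ (h.p₂_le X.2) (by simpa using hX))
  · intro u hu X Y X' Y' e e'
    change b * Q X' Y' = b * Q X Y
    rw [e, e', h.background.inv u (h.H_le_G hu) _ (h.p₂_le X.2) _ (h.p₂_le Y.2)]
  · simp only [h.restrictForm₂]
    exact hx₂.mul_const _
  · rw [ENNReal.tendsto_nhds_zero]
    intro ε hε
    obtain ⟨δ, -, hδ, hδε⟩ := ENNReal.lt_iff_exists_real_btwn.1 hε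
    have hδ' : 0 < δ := by simpa using hδ
    filter_upwards [h.eventually_total_le hb hpos hx₁ hx₂ hδ',
      h.eventually_base_le hb hpos hx₂ hδ'] with t ht ht'
    refine le_trans (iInf₂_le δ ?_) hδε.le
    -- The approximation relates `uK` to `uH`, that is, it is the graph of the projection `G/K →
    -- G/H`.
    refine ⟨Set.range fun u : G => (QuotientGroup.mk u, QuotientGroup.mk u), fun a => ?_,
      fun a => ?_, ?_⟩
    · obtain ⟨u, rfl⟩ := QuotientGroup.mk_surjective a
      exact ⟨_, u, rfl⟩
    · obtain ⟨u, rfl⟩ := QuotientGroup.mk_surjective a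
      exact ⟨_, u, rfl⟩
    · rintro _ ⟨u, rfl⟩ _ ⟨v, rfl⟩
      rw [h.rdist_total, rdist_base (K := K) (p₁ := p₁), abs_lt]
      constructor
      · linarith [ht' u v]
      · linarith [ht (u, v)]

/-! ## The main result -/

theorem everySolutionCollapses_of_planar {a₁ b₁ a₂ b₂ : ℝ}
    (hR : ∀ (y : ℝ) (X Y : isotropy Q G K),
      ricci (lieAlg K) (isotropy Q G K) (diagConn Q G H K p₁ p₂ y) X Y =
        diagForm Q G H K p₁ p₂ (a₁ + b₁ * y ^ 2) (a₂ - b₂ * y) X Y)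
    (hb₁ : 0 ≤ b₁) (hb₂ : 0 < b₂) (ha₂ : 0 < a₂)
    (hP : ∀ y, 0 < y → einsteinPoly a₁ b₁ a₂ b₂ y ≠ 0) :
    EverySolutionCollapses G H K h.le₁ h.le₂ := by
  intro g₀ hg₀
  obtain ⟨T, x₁, x₂, b, hT, h0, hf, hu, hpos, hb, l₁, l₂⟩ :=
    h.exists_ricciFlow hR hb₁ hb₂ ha₂ hP hg₀
  have hpos' : ∀ᶠ t in 𝓝[<] T, 0 < x₁ t ∧ 0 < x₂ t := by
    filter_upwards [Ico_mem_nhdsLT hT] with t ht using hpos t ht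
  exact ⟨T, _, hT, h0, hf, hu, h.fibreShrinks l₁, h.convergesToBase hb hpos' l₁ l₂⟩

theorem noAncientSolution_and_everySolutionCollapses
    (hE : ¬ ∃ g : LinearMap.BilinForm ℝ (isotropy Q G K), IsEinstein K (isotropy Q G K) g) :
    NoAncientSolution K (isotropy Q G K) ∧ EverySolutionCollapses G H K h.le₁ h.le₂ := by
  obtain ⟨e, he⟩ := h.background.exists_isONBasis h.p₁_le
  obtain ⟨f, hf⟩ := h.background.exists_isONBasis h.p₂_le
  obtain ⟨a₁, b₁, a₂, b₂, hb₁, ha₂, hb₂, -, -, -, -, hR⟩ := h.exists_ricci_eq he hf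
  have hP : ∀ y, 0 < y → einsteinPoly a₁ b₁ a₂ b₂ y ≠ 0 := fun y hy h0 =>
    hE ⟨_, h.isEinstein_of_root hR hy h0⟩
  exact ⟨h.noAncientSolution hR hb₁ hb₂ ha₂ hP,
    h.everySolutionCollapses_of_planar hR hb₁ hb₂ ha₂ hP⟩

end NonMaximalTwoSummand

/-! ## The Lie algebras of `SU(4)` and `Sp(2)` -/

/-- The determinant is differentiable, so its derivative at `1` may be computed along the line `1 +
t X`, where the first-order coefficient is the trace. -/
theorem hasDerivAt_det {N : ℕ} {c : ℝ → Mat N} {X : Mat N} (h0 : c 0 = 1)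
    (hc : HasDerivAt c X 0) : HasDerivAt (fun t => (c t).det) X.trace 0 := by
  have hd : DifferentiableAt ℝ (fun M : Mat N => M.det) 1 := by
    simp only [Matrix.det_apply]
    refine DifferentiableAt.fun_sum fun σ _ => DifferentiableAt.const_smul ?_ _
    have hp : ∀ i : Fin N, DifferentiableAt ℝ (fun M : Mat N => M (σ i) i) 1 := fun i =>
      ((Matrix.entryLinearMap ℝ ℂ (σ i) i).toContinuousLinearMap).differentiableAt
    exact (HasFDerivAt.finsetProd fun i _ => (hp i).hasFDerivAt).differentiableAt
  have hD := hd.hasFDerivAt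
  set D := fderiv ℝ (fun M : Mat N => M.det) 1
  have h1 : HasDerivAt (fun t => (c t).det) (D X) 0 :=
    HasFDerivAt.comp_hasDerivAt (l := fun M : Mat N => M.det) (f := c) 0 (by rwa [h0]) hc
  have hl : HasDerivAt (fun t : ℝ => (1 : Mat N) + t • X) X 0 := by
    have := ((hasDerivAt_id (0 : ℝ)).smul_const X).const_add (1 : Mat N)
    rwa [one_smul] at this
  have h2 : HasDerivAt (fun t : ℝ => ((1 : Mat N) + t • X).det) (D X) 0 :=
    HasFDerivAt.comp_hasDerivAt (l := fun M : Mat N => M.det)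
      (f := fun t : ℝ => (1 : Mat N) + t • X) 0 (by rwa [zero_smul, add_zero]) hl
  obtain ⟨P, hP⟩ : ∃ P : Polynomial ℂ, ∀ r : ℂ, ((1 : Mat N) + r • X).det =
      1 + X.trace * r + P.eval r * r ^ 2 := ⟨_, fun r => Matrix.det_one_add_smul r X⟩
  have h3 : HasDerivAt (fun r : ℂ => 1 + X.trace * r + P.eval r * r ^ 2) X.trace 0 := by
    have := (((hasDerivAt_id (0 : ℂ)).const_mul X.trace).const_add 1).add
      ((P.hasDerivAt 0).mul ((hasDerivAt_id (0 : ℂ)).pow 2))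
    refine this.congr_deriv ?_
    simp
  have h4 : HasDerivAt (fun t : ℝ => ((1 : Mat N) + t • X).det) X.trace 0 := by
    have := HasDerivAt.comp_ofReal (z := 0) (by simpa using h3)
    refine this.congr_of_eventuallyEq (Eventually.of_forall fun t => ?_)
    change ((1 : Mat N) + t • X).det = 1 + X.trace * (t : ℂ) + P.eval (t : ℂ) * (t : ℂ) ^ 2
    rw [← hP]
    rfl
  rwa [h2.unique h4] at h1

/-- By the one-parameter group law the derivative at any `t` is a multiple of the one at `0`, which
is the trace. -/
theorem det_exp_smul {N : ℕ} {X : Mat N} (hX : X.trace = 0) (t : ℝ) :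
    (NormedSpace.exp (t • X)).det = 1 := by
  have hd : ∀ t, HasDerivAt (fun t : ℝ => (NormedSpace.exp (t • X)).det) 0 t := by
    intro t
    have h0 : HasDerivAt (fun s : ℝ => (NormedSpace.exp (s • X)).det) 0 (t - t) := by
      have := hasDerivAt_det (c := fun s : ℝ => NormedSpace.exp (s • X)) (X := X) (by simp)
        (by simpa using hasDerivAt_expMat X 0)
      rwa [hX, ← sub_self t] at this
    have h1 := (h0.comp_sub_const t t).const_mul (NormedSpace.exp (t • X)).det
    rw [mul_zero] at h1
    refine h1.congr_of_eventuallyEq (Eventually.of_forall fun s => ?_)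
    change (NormedSpace.exp (s • X)).det =
      (NormedSpace.exp (t • X)).det * (NormedSpace.exp ((s - t) • X)).det
    rw [← Matrix.det_mul, ← exp_zero_smul_mul, add_sub_cancel]
  have := is_const_of_deriv_eq_zero (fun t => (hd t).differentiableAt) (fun t => (hd t).deriv) t 0
  simpa using this

theorem exp_smul_mem_unitary {N : ℕ} {X : Mat N} (hX : star X = -X) (t : ℝ) :
    NormedSpace.exp (t • X) ∈ Matrix.unitaryGroup (Fin N) ℂ := by
  have e : star (NormedSpace.exp (t • X)) = NormedSpace.exp ((-t) • X) := by
    rw [NormedSpace.star_exp, star_smul, hX]; simp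
  rw [Matrix.mem_unitaryGroup_iff, e, ← exp_zero_smul_mul]
  simp

theorem isClosed_SU4 : IsClosed (SU4 : Set (U 4)) :=
  isClosed_eq (continuous_subtype_val.matrix_det) continuous_const

theorem isClosed_Sp2 : IsClosed (Sp2 : Set (U 4)) :=
  isClosed_eq (((continuous_subtype_val (p := (· ∈ Matrix.unitaryGroup (Fin 4) ℂ))).matrix_transpose.mul
    continuous_const).mul continuous_subtype_val) continuous_const

theorem mem_lieAlg_SU4 {X : Mat 4} : X ∈ lieAlg SU4 ↔ star X = -X ∧ X.trace = 0 := by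
  constructor
  · intro h
    refine ⟨star_eq_neg_of_mem_lieAlg h, ?_⟩
    obtain ⟨γ, hγ, hs, h0, rfl⟩ := h
    have hd := hasDerivAt_det (c := fun t => (γ t : Mat 4)) (by simp [h0])
      (hasDerivAt_matrix_iff.2 fun i j => hs.hasDerivAt 0 i j)
    have hc : (fun t => (γ t : Mat 4).det) = fun _ => 1 := funext fun t => hγ t
    rw [hc] at hd
    exact hd.unique (hasDerivAt_const _ _)
  · rintro ⟨h1, h2⟩
    refine (mem_lieAlg_iff_exp isClosed_SU4).2 fun t => ?_
    exact ⟨⟨_, exp_smul_mem_unitary h1 t⟩, det_exp_smul h2 t, rfl⟩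

/-- One direction differentiates the group equation; for the other, `exp(tX)ᵀ J exp(tX)` has
derivative zero and equals `J` at `t = 0`. -/
theorem mem_lieAlg_Sp2 {X : Mat 4} : X ∈ lieAlg Sp2 ↔ star X = -X ∧ Xᵀ * J + J * X = 0 := by
  have tr : ∀ {c : ℝ → Mat 4} {Y : Mat 4} {t : ℝ}, HasDerivAt c Y t →
      HasDerivAt (fun t => (c t)ᵀ) Yᵀ t := fun h =>
    hasDerivAt_matrix_iff.2 fun i j => hasDerivAt_matrix_iff.1 h j i
  constructor
  · intro h
    refine ⟨star_eq_neg_of_mem_lieAlg h, ?_⟩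
    obtain ⟨γ, hγ, hs, h0, rfl⟩ := h
    set X := velocity (fun t => (γ t : Mat 4)) 0
    have hd : HasDerivAt (fun t => (γ t : Mat 4)) X 0 :=
      hasDerivAt_matrix_iff.2 fun i j => hs.hasDerivAt 0 i j
    have h1 := ((tr hd).mul_const J).mul hd
    have hc : ((fun t => (γ t : Mat 4)ᵀ * J) * fun t => (γ t : Mat 4)) = fun _ => J :=
      funext fun t => hγ t
    rw [hc] at h1
    simpa [h0] using h1.unique (hasDerivAt_const _ _)
  · rintro ⟨h1, h2⟩
    refine (mem_lieAlg_iff_exp isClosed_Sp2).2 fun t => ?_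
    refine ⟨⟨_, exp_smul_mem_unitary h1 t⟩, ?_, rfl⟩
    change (NormedSpace.exp (t • X))ᵀ * J * NormedSpace.exp (t • X) = J
    have hd : ∀ t, HasDerivAt
        (fun t : ℝ => (NormedSpace.exp (t • X))ᵀ * J * NormedSpace.exp (t • X)) 0 t := by
      intro t
      have h3 := ((tr (hasDerivAt_expMat X t)).mul_const J).mul (hasDerivAt_expMat' X t)
      refine h3.congr_deriv ?_
      have : (NormedSpace.exp (t • X) * X)ᵀ * J * NormedSpace.exp (t • X) +
          (NormedSpace.exp (t • X))ᵀ * J * (X * NormedSpace.exp (t • X)) = 0 := by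
        have e : NormedSpace.exp (t • X) * X = X * NormedSpace.exp (t • X) :=
          (hasDerivAt_expMat X t).unique (hasDerivAt_expMat' X t)
        rw [e, Matrix.transpose_mul]
        calc _ = (NormedSpace.exp (t • X))ᵀ * (Xᵀ * J + J * X) * NormedSpace.exp (t • X) := by
              noncomm_ring
          _ = 0 := by rw [h2]; simp
      exact this
    have := is_const_of_deriv_eq_zero (fun t => (hd t).differentiableAt) (fun t => (hd t).deriv) t 0
    simpa using this

/-! ## The symmetric cube -/

/-- `√3` as a complex number. -/
noncomputable def r3 : ℂ := (Real.sqrt 3 : ℂ)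

theorem r3_sq : r3 ^ 2 = 3 := by
  rw [r3, ← Complex.ofReal_pow, Real.sq_sqrt (by norm_num)]; norm_num

theorem r3_ne : r3 ≠ 0 := fun h => by
  have := r3_sq; rw [h] at this; norm_num at this

theorem conj_r3 : (starRingEnd ℂ) r3 = r3 := Complex.conj_ofReal _

/-- The symmetric cube of a `2 × 2` matrix, acting on `S³ ℂ² = ℂ⁴`. -/
noncomputable def sym3 (a : Mat 2) : Mat 4 :=
  !![a 0 0 ^ 3, r3 * (a 0 0 ^ 2 * a 0 1), r3 * (a 0 0 * a 0 1 ^ 2), a 0 1 ^ 3;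
    r3 * (a 0 0 ^ 2 * a 1 0), a 0 0 * (a 0 0 * a 1 1 + 2 * (a 0 1 * a 1 0)),
      a 0 1 * (2 * (a 0 0 * a 1 1) + a 0 1 * a 1 0), r3 * (a 0 1 ^ 2 * a 1 1);
    r3 * (a 0 0 * a 1 0 ^ 2), a 1 0 * (2 * (a 0 0 * a 1 1) + a 0 1 * a 1 0),
      a 1 1 * (a 0 0 * a 1 1 + 2 * (a 0 1 * a 1 0)), r3 * (a 0 1 * a 1 1 ^ 2);
    a 1 0 ^ 3, r3 * (a 1 0 ^ 2 * a 1 1), r3 * (a 1 0 * a 1 1 ^ 2), a 1 1 ^ 3]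

theorem sym3_mulVec_veronese (a : Mat 2) (v : Fin 2 → ℂ) :
    sym3 a *ᵥ veronese v = veronese (a *ᵥ v) := by
  have h := r3_sq
  have e : (Real.sqrt 3 : ℂ) = r3 := rfl
  ext i
  fin_cases i <;>
    simp [sym3, veronese, Matrix.mulVec, dotProduct, Fin.sum_univ_four, Fin.sum_univ_two, e]
  · linear_combination (a 0 0 ^ 2 * a 0 1 * v 0 ^ 2 * v 1 + a 0 0 * a 0 1 ^ 2 * v 0 * v 1 ^ 2) * h
  · ring
  · ring
  · linear_combination (a 1 0 ^ 2 * a 1 1 * v 0 ^ 2 * v 1 + a 1 0 * a 1 1 ^ 2 * v 0 * v 1 ^ 2) * h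

/-- The cubes of `(1, 0)`, `(0, 1)`, `(1, 1)` and `(1, -1)` span `ℂ⁴`. Hence a matrix is known from
its action on cubes, which makes `sym3` multiplicative without expanding products. -/
theorem eq_of_mulVec_veronese {M M' : Mat 4} (h : ∀ v, M *ᵥ veronese v = M' *ᵥ veronese v) :
    M = M' := by
  have e : (Real.sqrt 3 : ℂ) = r3 := rfl
  have hr := r3_ne
  ext i j
  have h1 := congrFun (h ![1, 0]) i
  have h2 := congrFun (h ![0, 1]) i
  have h3 := congrFun (h ![1, 1]) i
  have h4 := congrFun (h ![1, -1]) i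
  simp [veronese, Matrix.mulVec, dotProduct, Fin.sum_univ_four, e] at h1 h2 h3 h4
  fin_cases j
  · exact h1
  · refine mul_right_cancel₀ (mul_ne_zero two_ne_zero hr) ?_
    simp only [Fin.mk_one]
    linear_combination h3 - h4 - 2 * h2
  · refine mul_right_cancel₀ (mul_ne_zero two_ne_zero hr) ?_
    simp only [Fin.reduceFinMk]
    linear_combination h3 + h4 - 2 * h1
  · exact h2

theorem sym3_mul (a b : Mat 2) : sym3 (a * b) = sym3 a * sym3 b :=
  eq_of_mulVec_veronese fun v => by
    rw [← Matrix.mulVec_mulVec, sym3_mulVec_veronese, sym3_mulVec_veronese, sym3_mulVec_veronese,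
      Matrix.mulVec_mulVec]

theorem sym3_one : sym3 1 = 1 := by
  ext i j
  fin_cases i <;> fin_cases j <;> simp [sym3]

/-- The factors `√3` in the basis are chosen for this: `sym3` then takes unitary matrices to unitary
matrices. -/
theorem star_sym3 (a : Mat 2) : star (sym3 a) = sym3 (star a) := by
  ext i j
  fin_cases i <;> fin_cases j <;>
    simp [sym3, Matrix.star_apply, conj_r3, -mul_eq_mul_left_iff, -mul_eq_mul_right_iff] <;> ring

theorem sym3_mem_unitary (a : U 2) : sym3 a ∈ Matrix.unitaryGroup (Fin 4) ℂ := by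
  rw [Matrix.mem_unitaryGroup_iff, star_sym3, ← sym3_mul]
  have : (a : Mat 2) * star (a : Mat 2) = 1 := Unitary.coe_mul_star_self a
  rw [this, sym3_one]

/-- The cube of the area form on `ℂ²` is a symplectic form on `S³ ℂ²`, scaled by `(det a)³`. -/
theorem sym3_transpose_J (a : Mat 2) (ha : a.det = 1) : (sym3 a)ᵀ * J * sym3 a = J := by
  have h := r3_sq
  have hd : a 0 0 * a 1 1 - a 0 1 * a 1 0 = 1 := by rw [← ha, Matrix.det_fin_two]
  have key : (sym3 a)ᵀ * J * sym3 a = (a 0 0 * a 1 1 - a 0 1 * a 1 0) ^ 3 • J := by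
    ext i j
    fin_cases i <;> fin_cases j <;>
      simp [sym3, J, Matrix.mul_apply, Fin.sum_univ_four] <;> ring_nf <;>
      simp only [h] <;> ring
  rw [key, hd]; simp

theorem det_fin_four (u : Mat 4) : u.det =
    u 0 0 * (u 1 1 * (u 2 2 * u 3 3 - u 2 3 * u 3 2) - u 1 2 * (u 2 1 * u 3 3 - u 2 3 * u 3 1) +
      u 1 3 * (u 2 1 * u 3 2 - u 2 2 * u 3 1)) -
    u 0 1 * (u 1 0 * (u 2 2 * u 3 3 - u 2 3 * u 3 2) - u 1 2 * (u 2 0 * u 3 3 - u 2 3 * u 3 0) +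
      u 1 3 * (u 2 0 * u 3 2 - u 2 2 * u 3 0)) +
    u 0 2 * (u 1 0 * (u 2 1 * u 3 3 - u 2 3 * u 3 1) - u 1 1 * (u 2 0 * u 3 3 - u 2 3 * u 3 0) +
      u 1 3 * (u 2 0 * u 3 1 - u 2 1 * u 3 0)) -
    u 0 3 * (u 1 0 * (u 2 1 * u 3 2 - u 2 2 * u 3 1) - u 1 1 * (u 2 0 * u 3 2 - u 2 2 * u 3 0) +
      u 1 2 * (u 2 0 * u 3 1 - u 2 1 * u 3 0)) := by
  rw [Matrix.det_succ_row_zero]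
  simp [Fin.sum_univ_four, Matrix.det_fin_three, Fin.succAbove]
  ring

/-- The Pfaffian identity for `4 × 4` matrices. -/
theorem det_eq_of_transpose_J (u : Mat 4) (h : uᵀ * J * u = J) : u.det = 1 := by
  have e := fun i j => congrFun (congrFun h i) j
  have e' : ∀ i j, u 0 i * u 3 j - u 1 i * u 2 j + u 2 i * u 1 j - u 3 i * u 0 j = J i j :=
    fun i j => by
      rw [← e i j]
      simp [J, Matrix.mul_apply, Fin.sum_univ_four]
      ring
  have e03 := e' 0 3
  have e12 := e' 1 2
  have e01 := e' 0 1
  have e02 := e' 0 2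
  simp only [J, Matrix.of_apply, Matrix.cons_val] at e03 e12 e01 e02
  have key : u.det = -((u 0 0 * u 3 1 - u 1 0 * u 2 1 + u 2 0 * u 1 1 - u 3 0 * u 0 1) *
      (u 0 2 * u 3 3 - u 1 2 * u 2 3 + u 2 2 * u 1 3 - u 3 2 * u 0 3) -
      (u 0 0 * u 3 2 - u 1 0 * u 2 2 + u 2 0 * u 1 2 - u 3 0 * u 0 2) *
      (u 0 1 * u 3 3 - u 1 1 * u 2 3 + u 2 1 * u 1 3 - u 3 1 * u 0 3) +
      (u 0 0 * u 3 3 - u 1 0 * u 2 3 + u 2 0 * u 1 3 - u 3 0 * u 0 3) *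
      (u 0 1 * u 3 2 - u 1 1 * u 2 2 + u 2 1 * u 1 2 - u 3 1 * u 0 2)) := by
    rw [det_fin_four]
    ring
  rw [key, e03, e12, e01, e02]
  norm_num

/-! ## The subgroup `SU(2)` -/

/-- The determinant condition in the definition is automatic: the symmetric cube of a matrix of
determinant `1` is symplectic, and symplectic matrices have determinant `1`. -/
theorem mem_SU2_iff {u : U 4} : u ∈ SU2 ↔ ∃ a : U 2, (a : Mat 2).det = 1 ∧ (u : Mat 4) = sym3 a := by
  constructor
  · rintro ⟨-, a, ha, h⟩
    exact ⟨a, ha, eq_of_mulVec_veronese fun v => by rw [h, sym3_mulVec_veronese]⟩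
  · rintro ⟨a, ha, h⟩
    refine ⟨?_, a, ha, fun v => by rw [h, sym3_mulVec_veronese]⟩
    rw [h]
    exact det_eq_of_transpose_J _ (sym3_transpose_J _ ha)

theorem SU2_le_Sp2 : SU2 ≤ Sp2 := by
  intro u hu
  obtain ⟨a, ha, h⟩ := mem_SU2_iff.1 hu
  change (u : Mat 4)ᵀ * J * (u : Mat 4) = J
  rw [h]
  exact sym3_transpose_J _ ha

theorem Sp2_le_SU4 : Sp2 ≤ SU4 := fun u hu => det_eq_of_transpose_J (u : Mat 4) hu

theorem continuous_sym3 : Continuous sym3 := by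
  refine continuous_matrix fun i j => ?_
  have h : ∀ k l : Fin 2, Continuous fun a : Mat 2 => a k l := fun k l =>
    (continuous_apply l).comp (continuous_apply k)
  have h00 := h 0 0
  have h01 := h 0 1
  have h10 := h 1 0
  have h11 := h 1 1
  fin_cases i <;> fin_cases j <;> simp [sym3] <;> fun_prop

/-- It is the image of the compact group of `2 × 2` special unitary matrices under the continuous
map `sym3`. -/
theorem isClosed_SU2 : IsClosed (SU2 : Set (U 4)) := by
  have hc : IsCompact {a : U 2 | (a : Mat 2).det = 1} :=
    (isClosed_eq continuous_subtype_val.matrix_det continuous_const).isCompact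
  have hi := (hc.image (continuous_sym3.comp continuous_subtype_val)).isClosed
  have e : (SU2 : Set (U 4)) = Subtype.val ⁻¹'
      ((sym3 ∘ Subtype.val) '' {a : U 2 | (a : Mat 2).det = 1}) := by
    ext u
    constructor
    · intro hu
      obtain ⟨a, ha, h⟩ := mem_SU2_iff.1 hu
      exact ⟨a, ha, h.symm⟩
    · rintro ⟨a, ha, h⟩
      exact mem_SU2_iff.2 ⟨a, ha, h.symm⟩
  rw [e]
  exact hi.preimage continuous_subtype_val

/-! ## Parametrizations -/

local notation "conj" => starRingEnd ℂ

/-- The elements of `𝔰𝔭(2)`. -/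
noncomputable def spMat (a b : ℝ) (z w c d : ℂ) : Mat 4 :=
  !![a * Complex.I, z, w, c;
    -conj z, b * Complex.I, d, -w;
    -conj w, -conj d, -(b * Complex.I), z;
    -conj c, conj w, -conj z, -(a * Complex.I)]

/-- The elements of the orthogonal complement of `𝔰𝔭(2)` in `𝔰𝔲(4)`. -/
noncomputable def asMat (r : ℝ) (z w : ℂ) : Mat 4 :=
  !![r * Complex.I, z, w, 0;
    -conj z, -(r * Complex.I), 0, w;
    -conj w, 0, -(r * Complex.I), -z;
    0, -conj w, conj z, r * Complex.I]

/-- The elements of `𝔰𝔲(2)`. -/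
noncomputable def rhoMat (α : ℝ) (β : ℂ) : Mat 4 := spMat (3 * α) α (r3 * β) 0 0 (2 * β)

/-- The elements of the orthogonal complement of `𝔰𝔲(2)` in `𝔰𝔭(2)`. -/
noncomputable def fibMat (t : ℝ) (z w c : ℂ) : Mat 4 := spMat t (-3 * t) z w c (-(r3 * z))

theorem star_spMat (a b : ℝ) (z w c d : ℂ) : star (spMat a b z w c d) = -spMat a b z w c d := by
  ext i j
  fin_cases i <;> fin_cases j <;> simp [spMat, Matrix.star_apply]

theorem star_asMat (r : ℝ) (z w : ℂ) : star (asMat r z w) = -asMat r z w := by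
  ext i j
  fin_cases i <;> fin_cases j <;> simp [asMat, Matrix.star_apply]

theorem spMat_mem (a b : ℝ) (z w c d : ℂ) : spMat a b z w c d ∈ lieAlg Sp2 := by
  refine mem_lieAlg_Sp2.2 ⟨star_spMat .., ?_⟩
  ext i j
  fin_cases i <;> fin_cases j <;> simp [spMat, J, Matrix.mul_apply, Fin.sum_univ_four]

theorem asMat_mem (r : ℝ) (z w : ℂ) : asMat r z w ∈ lieAlg SU4 := by
  refine mem_lieAlg_SU4.2 ⟨star_asMat .., ?_⟩
  simp [asMat, Matrix.trace, Fin.sum_univ_four]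

theorem spMat_add (a b : ℝ) (z w c d : ℂ) (a' b' : ℝ) (z' w' c' d' : ℂ) :
    spMat a b z w c d + spMat a' b' z' w' c' d' =
      spMat (a + a') (b + b') (z + z') (w + w') (c + c') (d + d') := by
  ext i j
  fin_cases i <;> fin_cases j <;> simp [spMat] <;> ring

theorem spMat_smul (s a b : ℝ) (z w c d : ℂ) :
    s • spMat a b z w c d = spMat (s * a) (s * b) (s * z) (s * w) (s * c) (s * d) := by
  ext i j
  fin_cases i <;> fin_cases j <;> simp [spMat] <;> ring

theorem asMat_add (r : ℝ) (z w : ℂ) (r' : ℝ) (z' w' : ℂ) :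
    asMat r z w + asMat r' z' w' = asMat (r + r') (z + z') (w + w') := by
  ext i j
  fin_cases i <;> fin_cases j <;> simp [asMat] <;> ring

theorem asMat_smul (s r : ℝ) (z w : ℂ) : s • asMat r z w = asMat (s * r) (s * z) (s * w) := by
  ext i j
  fin_cases i <;> fin_cases j <;> simp [asMat] <;> ring

theorem skew_entry {X : Mat 4} (h : star X = -X) (i j : Fin 4) : X j i = -conj (X i j) := by
  have := congrFun (congrFun h j) i
  rw [Matrix.star_apply, Matrix.neg_apply] at this
  rw [← neg_eq_iff_eq_neg, ← this]
  rfl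

theorem skew_diag {X : Mat 4} (h : star X = -X) (i : Fin 4) :
    X i i = ((X i i).im : ℂ) * Complex.I := by
  have := congrArg Complex.re (skew_entry h i i)
  simp at this
  apply Complex.ext
  · simp; linarith
  · simp

theorem exists_spMat {X : Mat 4} (hX : X ∈ lieAlg Sp2) : ∃ a b z w c d, X = spMat a b z w c d := by
  obtain ⟨hs, hJ⟩ := mem_lieAlg_Sp2.1 hX
  refine ⟨(X 0 0).im, (X 1 1).im, X 0 1, X 0 2, X 0 3, X 1 2, ?_⟩
  have e : ∀ i j, ∑ k, X k i * J k j + ∑ k, J i k * X k j = 0 :=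
    fun i j => congrFun (congrFun hJ i) j
  have e03 := e 0 3
  have e12 := e 1 2
  have e13 := e 1 3
  have e23 := e 2 3
  simp only [J, Fin.sum_univ_four, Matrix.of_apply, Matrix.cons_val] at e03 e12 e13 e23
  have s := skew_entry hs
  have f00 := skew_diag hs 0
  have f11 := skew_diag hs 1
  have f33 : X 3 3 = -(((X 0 0).im : ℂ) * Complex.I) := by rw [← f00]; linear_combination e03
  have f22 : X 2 2 = -(((X 1 1).im : ℂ) * Complex.I) := by rw [← f11]; linear_combination -e12
  have f23 : X 2 3 = X 0 1 := by linear_combination -e13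
  have f13 : X 1 3 = -X 0 2 := by linear_combination e23
  have f31 : X 3 1 = conj (X 0 2) := by rw [s 1 3, f13, map_neg, neg_neg]
  have f32 : X 3 2 = -conj (X 0 1) := by rw [s 2 3, f23]
  ext i j
  fin_cases i <;> fin_cases j
  exacts [f00, rfl, rfl, rfl, s 0 1, f11, rfl, f13, s 0 2, s 1 2, f22, f23, s 0 3, f31, f32, f33]

theorem exists_spMat_add_asMat {X : Mat 4} (hX : X ∈ lieAlg SU4) :
    ∃ a b z w c d r z' w', X = spMat a b z w c d + asMat r z' w' := by
  obtain ⟨hs, ht⟩ := mem_lieAlg_SU4.1 hX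
  -- Half-sums and half-differences of the entries that coincide in one of the two families and are
  -- opposite in the other; vanishing trace settles the middle of the diagonal.
  refine ⟨((X 0 0).im - (X 3 3).im) / 2, ((X 1 1).im - (X 2 2).im) / 2, (X 0 1 + X 2 3) / 2,
    (X 0 2 - X 1 3) / 2, X 0 3, X 1 2, ((X 0 0).im + (X 3 3).im) / 2, (X 0 1 - X 2 3) / 2,
    (X 0 2 + X 1 3) / 2, ?_⟩
  have s := skew_entry hs
  have d := skew_diag hs
  have ht' : (((X 0 0).im : ℂ) + (X 1 1).im + (X 2 2).im + (X 3 3).im) = 0 := by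
    have := congrArg Complex.im ht
    simp only [Matrix.trace, Matrix.diag, Fin.sum_univ_four, Complex.add_im, Complex.zero_im] at this
    exact_mod_cast this
  ext i j
  fin_cases i <;> fin_cases j <;> simp [spMat, asMat, map_ofNat]
  · linear_combination d 0
  · ring
  · ring
  · linear_combination s 0 1
  · linear_combination d 1 + ht' / 2 * Complex.I
  · ring
  · linear_combination s 0 2
  · linear_combination s 1 2
  · linear_combination d 2 + ht' / 2 * Complex.I
  · ring
  · linear_combination s 0 3
  · linear_combination s 1 3
  · linear_combination s 2 3
  · linear_combination d 3

theorem negKilling4_apply (X Y : Mat 4) : negKilling4 X Y = -8 * (X * Y).trace.re := rfl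

theorem negKilling4_spMat (a b : ℝ) (z w c d : ℂ) (a' b' : ℝ) (z' w' c' d' : ℂ) :
    negKilling4 (spMat a b z w c d) (spMat a' b' z' w' c' d') =
      16 * (a * a' + b * b') + 32 * (z * conj z').re + 32 * (w * conj w').re +
        16 * (c * conj c').re + 16 * (d * conj d').re := by
  simp [negKilling4_apply, spMat, Matrix.trace, Fin.sum_univ_four]
  ring

theorem negKilling4_asMat (r : ℝ) (z w : ℂ) (r' : ℝ) (z' w' : ℂ) :
    negKilling4 (asMat r z w) (asMat r' z' w') =
      32 * (r * r') + 32 * (z * conj z').re + 32 * (w * conj w').re := by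
  simp [negKilling4_apply, asMat, Matrix.trace, Fin.sum_univ_four]
  ring

theorem negKilling4_spMat_asMat (a b : ℝ) (z w c d : ℂ) (r : ℝ) (z' w' : ℂ) :
    negKilling4 (spMat a b z w c d) (asMat r z' w') = 0 := by
  simp [negKilling4_apply, spMat, asMat, Matrix.trace, Fin.sum_univ_four]
  ring

theorem isBackground_negKilling4 : IsBackground SU4 negKilling4 where
  symm X _ Y _ := by rw [negKilling4_apply, negKilling4_apply, Matrix.trace_mul_comm]
  pos X hX h0 := by
    have hs := (mem_lieAlg_SU4.1 hX).1
    have e : X = -star X := by rw [hs, neg_neg]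
    have : (X * X).trace.re = -∑ i, ∑ j, ‖X i j‖ ^ 2 := by
      conv_lhs => rw [show X * X = X * (-star X) by rw [← e]]
      simp only [Matrix.trace, Matrix.diag, Matrix.mul_apply, Matrix.neg_apply, Matrix.star_apply,
        Complex.re_sum, ← Finset.sum_neg_distrib]
      refine Finset.sum_congr rfl fun i _ => Finset.sum_congr rfl fun j _ => ?_
      rw [mul_neg, Complex.neg_re, Complex.star_def, Complex.mul_conj, Complex.normSq_eq_norm_sq]
      norm_cast
    rw [negKilling4_apply, this]
    obtain ⟨i, j, hij⟩ : ∃ i j, X i j ≠ 0 := by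
      by_contra hcon
      push Not at hcon
      exact h0 (Matrix.ext hcon)
    have h1 : 0 < ‖X i j‖ ^ 2 := by positivity
    have h2 : ‖X i j‖ ^ 2 ≤ ∑ j, ‖X i j‖ ^ 2 :=
      Finset.single_le_sum (f := fun j => ‖X i j‖ ^ 2) (fun _ _ => by positivity)
        (Finset.mem_univ j)
    have h3 : ∑ j, ‖X i j‖ ^ 2 ≤ ∑ i, ∑ j, ‖X i j‖ ^ 2 :=
      Finset.single_le_sum (f := fun i => ∑ j, ‖X i j‖ ^ 2)
        (fun _ _ => Finset.sum_nonneg fun _ _ => by positivity) (Finset.mem_univ i)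
    linarith
  inv u _ X _ Y _ := by
    have h1 := star_mul_self_coe u
    have e : Ad u X * Ad u Y = (u : Mat 4) * (X * Y) * star (u : Mat 4) := by
      simp only [Ad, Matrix.mul_assoc]
      rw [← Matrix.mul_assoc (star (u : Mat 4)) (u : Mat 4), h1, Matrix.one_mul]
    rw [negKilling4_apply, negKilling4_apply, e, Matrix.trace_mul_comm, ← Matrix.mul_assoc, h1,
      Matrix.one_mul]

/-! ## The Lie algebra of `SU(2)` -/

/-- A curve in `SU(2)`, in terms of the entries of the first row. -/
theorem sym3_velocity_mem {p q : ℝ → ℂ} {p' q' : ℂ} (hp : ContDiff ℝ ∞ p) (hq : ContDiff ℝ ∞ q)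
    (hpq : ∀ t, p t * conj (p t) + q t * conj (q t) = 1) (hp0 : p 0 = 1) (hq0 : q 0 = 0)
    (dp : HasDerivAt p p' 0) (dq : HasDerivAt q q' 0) :
    !![3 * p', r3 * q', 0, 0; -(r3 * conj q'), 2 * p' + conj p', 2 * q', 0;
      0, -(2 * conj q'), 2 * conj p' + p', r3 * q'; 0, 0, -(r3 * conj q'), 3 * conj p'] ∈
      lieAlg SU2 := by
  set a : ℝ → Mat 2 := fun t => !![p t, q t; -conj (q t), conj (p t)] with ha
  have hU : ∀ t, a t ∈ Matrix.unitaryGroup (Fin 2) ℂ := fun t => by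
    rw [Matrix.mem_unitaryGroup_iff]
    ext i j
    fin_cases i <;> fin_cases j <;> simp [ha, Matrix.mul_apply, Matrix.star_apply]
    · exact hpq t
    · ring
    · ring
    · linear_combination hpq t
  have hdet : ∀ t, (a t).det = 1 := fun t => by
    rw [Matrix.det_fin_two]; simp [ha]; linear_combination hpq t
  have hp' : ContDiff ℝ ∞ fun t => conj (p t) := Complex.conjCLE.contDiff.comp hp
  have hq' : ContDiff ℝ ∞ fun t => conj (q t) := Complex.conjCLE.contDiff.comp hq
  have dp' : HasDerivAt (fun t => conj (p t)) (conj p') 0 :=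
    HasFDerivAt.comp_hasDerivAt (l := Complex.conjCLE) (0 : ℝ) Complex.conjCLE.hasFDerivAt dp
  have dq' : HasDerivAt (fun t => -conj (q t)) (-conj q') 0 := HasDerivAt.neg
    (HasFDerivAt.comp_hasDerivAt (l := Complex.conjCLE) (0 : ℝ) Complex.conjCLE.hasFDerivAt dq)
  refine ⟨fun t => ⟨sym3 (a t), sym3_mem_unitary ⟨a t, hU t⟩⟩, fun t => ?_, fun i j => ?_, ?_,
    velocity_eq (hasDerivAt_matrix_iff.2 fun i j => ?_)⟩
  · exact mem_SU2_iff.2 ⟨⟨a t, hU t⟩, hdet t, rfl⟩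
  · fin_cases i <;> fin_cases j <;> simp [sym3, ha] <;> fun_prop
  · refine Subtype.ext ?_
    have : a 0 = 1 := by
      ext i j
      fin_cases i <;> fin_cases j <;> simp [ha, hp0, hq0]
    simp [this, sym3_one]
  · fin_cases i <;> fin_cases j
    · exact (dp.pow 3).congr_deriv (by simp [hp0])
    · exact (((dp.pow 2).mul dq).const_mul r3).congr_deriv (by simp [hp0, hq0])
    · exact ((dp.mul (dq.pow 2)).const_mul r3).congr_deriv (by simp [hp0, hq0])
    · exact (dq.pow 3).congr_deriv (by simp [hq0])
    · exact (((dp.pow 2).mul dq').const_mul r3).congr_deriv (by simp [hp0, hq0])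
    · exact (dp.mul ((dp.mul dp').add ((dq.mul dq').const_mul 2))).congr_deriv
        (by simp [hp0, hq0]; ring)
    · exact (dq.mul (((dp.mul dp').const_mul 2).add (dq.mul dq'))).congr_deriv
        (by simp [hp0, hq0]; ring)
    · exact (((dq.pow 2).mul dp').const_mul r3).congr_deriv (by simp [hp0, hq0])
    · exact ((dp.mul (dq'.pow 2)).const_mul r3).congr_deriv (by simp [hp0, hq0])
    · exact (dq'.mul (((dp.mul dp').const_mul 2).add (dq.mul dq'))).congr_deriv
        (by simp [hp0, hq0]; ring)
    · exact (dp'.mul ((dp.mul dp').add ((dq.mul dq').const_mul 2))).congr_deriv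
        (by simp [hp0, hq0]; ring)
    · exact ((dq.mul (dp'.pow 2)).const_mul r3).congr_deriv (by simp [hp0, hq0])
    · exact (dq'.pow 3).congr_deriv (by simp [hq0])
    · exact (((dq'.pow 2).mul dp').const_mul r3).congr_deriv (by simp [hp0, hq0])
    · exact ((dq'.mul (dp'.pow 2)).const_mul r3).congr_deriv (by simp [hp0, hq0])
    · exact (dp'.pow 3).congr_deriv (by simp [hp0])

/-- The imaginary part of `β` is reached by a bracket, so two explicit curves in `SU(2)`, a diagonal
one and a rotation, suffice for the whole Lie algebra. -/
theorem rhoMat_eq (α : ℝ) (β : ℂ) : rhoMat α β =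
    α • rhoMat 1 0 + β.re • rhoMat 0 1 + (β.im / 2) • comm (rhoMat 1 0) (rhoMat 0 1) := by
  have hβ := Complex.re_add_im β
  have hβ' : (β.re : ℂ) - β.im * Complex.I = conj β := by
    apply Complex.ext <;> simp
  ext i j
  fin_cases i <;> fin_cases j <;>
    simp [rhoMat, spMat, comm, conj_r3, map_ofNat] <;> ring_nf
  exacts [by linear_combination (-r3) * hβ, by linear_combination r3 * hβ',
    by linear_combination -2 * hβ, by linear_combination 2 * hβ',
    by linear_combination (-r3) * hβ, by linear_combination r3 * hβ']

theorem rhoMat_mem (α : ℝ) (β : ℂ) : rhoMat α β ∈ lieAlg SU2 := by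
  have h1 : rhoMat 1 0 ∈ lieAlg SU2 := by
    have hd : HasDerivAt (fun t : ℝ => Complex.exp (t * Complex.I)) Complex.I 0 := by
      have := ((Complex.ofRealCLM.hasDerivAt (x := (0 : ℝ))).mul_const Complex.I).cexp
      simpa using this
    have := sym3_velocity_mem (p := fun t => Complex.exp (t * Complex.I)) (q := fun _ => 0)
      (Complex.ofRealCLM.contDiff.mul contDiff_const).cexp contDiff_const (fun t => by
        rw [← Complex.exp_conj, ← Complex.exp_add]; simp) (by simp) rfl hd (hasDerivAt_const _ _)
    convert this using 1
    ext i j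
    fin_cases i <;> fin_cases j <;> simp [rhoMat, spMat] <;> ring
  have h2 : rhoMat 0 1 ∈ lieAlg SU2 := by
    have d1 : HasDerivAt (fun t : ℝ => (Real.cos t : ℂ)) 0 0 := by
      simpa using (Real.hasDerivAt_cos 0).ofReal_comp
    have d2 : HasDerivAt (fun t : ℝ => (Real.sin t : ℂ)) 1 0 := by
      simpa using (Real.hasDerivAt_sin 0).ofReal_comp
    have := sym3_velocity_mem (p := fun t => (Real.cos t : ℂ)) (q := fun t => (Real.sin t : ℂ))
      (Complex.ofRealCLM.contDiff.comp Real.contDiff_cos)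
      (Complex.ofRealCLM.contDiff.comp Real.contDiff_sin) (fun t => by
        rw [Complex.conj_ofReal, Complex.conj_ofReal]
        have := Real.cos_sq_add_sin_sq t
        exact_mod_cast (by linarith : Real.cos t * Real.cos t + Real.sin t * Real.sin t = 1))
      (by simp) (by simp) d1 d2
    convert this using 1
    ext i j
    fin_cases i <;> fin_cases j <;> simp [rhoMat, spMat, conj_r3, map_ofNat]
  rw [rhoMat_eq]
  exact add_mem (add_mem (Submodule.smul_mem _ _ h1) (Submodule.smul_mem _ _ h2))
    (Submodule.smul_mem _ _ (comm_mem_lieAlg h1 h2))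

/-- The entries of `sym3 a` satisfy polynomial relations. Differentiated at the identity, the four
in `R` give in turn `w = 0`, `c = 0`, `2 z = √3 d` and `a = 3 b`, which cut `𝔰𝔭(2)` down to the
matrices `rhoMat`. -/
theorem exists_rhoMat {X : Mat 4} (hX : X ∈ lieAlg SU2) : ∃ α β, X = rhoMat α β := by
  obtain ⟨a, b, z, w, c, d, e⟩ := exists_spMat (lieAlg_mono SU2_le_Sp2 hX)
  obtain ⟨γ, hγ, hs, h0, hv⟩ := hX
  have D : ∀ i j, HasDerivAt (fun t => (γ t : Mat 4) i j) (spMat a b z w c d i j) 0 := fun i j => by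
    rw [← e, ← hv]; exact hs.hasDerivAt 0 i j
  have I0 : ∀ i j, (γ 0 : Mat 4) i j = (1 : Mat 4) i j := fun i j => by rw [h0]; rfl
  have R : ∀ t, (γ t : Mat 4) 0 1 ^ 2 = r3 * ((γ t : Mat 4) 0 0 * (γ t : Mat 4) 0 2) ∧
      (γ t : Mat 4) 0 1 * (γ t : Mat 4) 0 2 = 3 * ((γ t : Mat 4) 0 0 * (γ t : Mat 4) 0 3) ∧
      r3 * ((γ t : Mat 4) 0 0 * (γ t : Mat 4) 1 2) - 2 * ((γ t : Mat 4) 0 1 * (γ t : Mat 4) 1 1) =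
        -(r3 * ((γ t : Mat 4) 0 2 * (γ t : Mat 4) 1 0)) ∧
      r3 * ((γ t : Mat 4) 0 0 * (γ t : Mat 4) 2 2 - (γ t : Mat 4) 1 1 ^ 2) =
        -((γ t : Mat 4) 0 1 * (γ t : Mat 4) 2 1) -
          r3 * ((γ t : Mat 4) 0 2 * (γ t : Mat 4) 2 0) := fun t => by
    obtain ⟨A, hA, eA⟩ := mem_SU2_iff.1 (hγ t)
    rw [Matrix.det_fin_two] at hA
    have h3 := r3_sq
    rw [eA]
    simp only [sym3, Matrix.of_apply, Matrix.cons_val]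
    generalize (A : Mat 2) 0 0 = p at *
    generalize (A : Mat 2) 0 1 = q at *
    generalize (A : Mat 2) 1 0 = r at *
    generalize (A : Mat 2) 1 1 = s at *
    exact ⟨by ring, by linear_combination p ^ 3 * q ^ 3 * h3,
      by linear_combination r3 * p ^ 3 * q ^ 2 * r * h3,
      by linear_combination r3 * p ^ 2 * q ^ 2 * r ^ 2 * h3⟩
  have Z : ∀ {F : ℝ → ℂ} {v : ℂ}, HasDerivAt F v 0 → (∀ t, F t = 0) → v = 0 := fun h hF =>
    (h.congr_of_eventuallyEq (Eventually.of_forall fun t => (hF t).symm)).unique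
      (hasDerivAt_const _ _)
  have z1 := Z (((D 0 1).pow 2).sub (((D 0 0).mul (D 0 2)).const_mul r3))
    fun t => sub_eq_zero.2 (R t).1
  have z2 := Z (((D 0 1).mul (D 0 2)).sub (((D 0 0).mul (D 0 3)).const_mul 3))
    fun t => sub_eq_zero.2 (R t).2.1
  have z3 := Z (((((D 0 0).mul (D 1 2)).const_mul r3).sub
    (((D 0 1).mul (D 1 1)).const_mul 2)).sub (((D 0 2).mul (D 1 0)).const_mul r3).neg)
    fun t => sub_eq_zero.2 (R t).2.2.1
  have z4 := Z (((((D 0 0).mul (D 2 2)).sub ((D 1 1).pow 2)).const_mul r3).sub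
    (((D 0 1).mul (D 2 1)).neg.sub (((D 0 2).mul (D 2 0)).const_mul r3)))
    fun t => sub_eq_zero.2 (R t).2.2.2
  simp [I0, spMat, r3_ne] at z1 z2 z3 z4

  have ha : a = 3 * b := by
    have := congrArg Complex.im z4
    simp at this
    linarith
  refine ⟨b, d / 2, ?_⟩
  rw [e, rhoMat, z1, z2, ha, show r3 * (d / 2) = z by linear_combination z3 / 2,
    show 2 * (d / 2) = d by ring]

/-! ## The isotropy summands of `SU(4)/SU(2)` -/

/-- The isotropy representation of `Sp(2)/SU(2)`. -/
noncomputable def fibSpace : Submodule ℝ (Mat 4) := lieAlg Sp2 ⊓ negKilling4.orthogonal (lieAlg SU2)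

/-- The isotropy representation of `SU(4)/Sp(2)`. -/
noncomputable def baseSpace : Submodule ℝ (Mat 4) :=
  lieAlg SU4 ⊓ negKilling4.orthogonal (lieAlg Sp2)

theorem Sp2_le_alg : lieAlg Sp2 ≤ lieAlg SU4 := lieAlg_mono Sp2_le_SU4

theorem SU2_le_alg : lieAlg SU2 ≤ lieAlg Sp2 := lieAlg_mono SU2_le_Sp2

theorem fibMat_add (t : ℝ) (z w c : ℂ) (t' : ℝ) (z' w' c' : ℂ) :
    fibMat t z w c + fibMat t' z' w' c' = fibMat (t + t') (z + z') (w + w') (c + c') := by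
  rw [fibMat, fibMat, fibMat, spMat_add]
  congr 1 <;> ring

theorem fibMat_smul (s t : ℝ) (z w c : ℂ) :
    s • fibMat t z w c = fibMat (s * t) (s * z) (s * w) (s * c) := by
  rw [fibMat, fibMat, spMat_smul]
  congr 1 <;> ring

theorem negKilling4_fibMat (t : ℝ) (z w c : ℂ) (t' : ℝ) (z' w' c' : ℂ) :
    negKilling4 (fibMat t z w c) (fibMat t' z' w' c') = 160 * (t * t') + 80 * (z * conj z').re +
      32 * (w * conj w').re + 16 * (c * conj c').re := by
  have e : (-(r3 * z)) * conj (-(r3 * z')) = 3 * (z * conj z') := by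
    rw [map_neg, map_mul, conj_r3]; linear_combination z * conj z' * r3_sq
  rw [fibMat, fibMat, negKilling4_spMat, e]
  simp
  ring

theorem negKilling4_rhoMat (α : ℝ) (β : ℂ) (α' : ℝ) (β' : ℂ) :
    negKilling4 (rhoMat α β) (rhoMat α' β') = 160 * (α * α') + 160 * (β * conj β').re := by
  have e : (r3 * β) * conj (r3 * β') = 3 * (β * conj β') := by
    rw [map_mul, conj_r3]; linear_combination β * conj β' * r3_sq
  have e' : (2 * β) * conj (2 * β') = 4 * (β * conj β') := by
    rw [map_mul, map_ofNat]; ring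
  rw [rhoMat, rhoMat, negKilling4_spMat, e, e']
  simp
  ring

theorem negKilling4_rhoMat_fibMat (α : ℝ) (β : ℂ) (t : ℝ) (z w c : ℂ) :
    negKilling4 (rhoMat α β) (fibMat t z w c) = 0 := by
  have e : 2 * β * conj (-(r3 * z)) = -2 * (r3 * β * conj z) := by
    rw [map_neg, map_mul, conj_r3]; ring
  rw [rhoMat, fibMat, negKilling4_spMat, e]
  simp
  ring

theorem fibMat_mem (t : ℝ) (z w c : ℂ) : fibMat t z w c ∈ fibSpace := by
  refine ⟨spMat_mem .., LinearMap.BilinForm.mem_orthogonal_iff.2 fun Y hY => ?_⟩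
  obtain ⟨α, β, rfl⟩ := exists_rhoMat hY
  exact negKilling4_rhoMat_fibMat ..

theorem asMat_mem_baseSpace (r : ℝ) (z w : ℂ) : asMat r z w ∈ baseSpace := by
  refine ⟨asMat_mem .., LinearMap.BilinForm.mem_orthogonal_iff.2 fun Y hY => ?_⟩
  obtain ⟨a, b, z, w, c, d, rfl⟩ := exists_spMat hY
  exact negKilling4_spMat_asMat ..

/-- The coefficients are orthogonal projections: `rhoMat` has diagonal direction `(3, 1)` and
off-diagonal direction `(√3, 2)`, the latter with weights `32` and `16` in `negKilling4`. -/
theorem spMat_eq_rhoMat_add_fibMat (a b : ℝ) (z w c d : ℂ) : spMat a b z w c d =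
    rhoMat ((3 * a + b) / 10) ((r3 * z + d) / 5) +
      fibMat ((a - 3 * b) / 10) ((2 * z - r3 * d) / 5) w c := by
  have h := r3_sq
  rw [rhoMat, fibMat, spMat_add]
  congr 1
  · ring
  · ring
  · linear_combination -(z / 5) * h
  · ring
  · ring
  · linear_combination -(d / 5) * h

/-- If `X = A + B` with `A ∈ W` and `B ⊥ W`, and `X ⊥ W`, then `X = B`. -/
theorem IsBackground.eq_of_orthogonal {N : ℕ} {G : Subgroup (U N)}
    {Q : LinearMap.BilinForm ℝ (Mat N)} (hQ : IsBackground G Q) {W : Submodule ℝ (Mat N)}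
    (hW : W ≤ lieAlg G) {A B : Mat N} (hA : A ∈ W) (hB : B ∈ Q.orthogonal W)
    (hX : A + B ∈ Q.orthogonal W) : A + B = B := by
  have h1 : Q A (A + B) = 0 := LinearMap.BilinForm.mem_orthogonal_iff.1 hX A hA
  have h2 : Q A B = 0 := LinearMap.BilinForm.mem_orthogonal_iff.1 hB A hA
  rw [map_add, h2, add_zero] at h1
  rw [hQ.eq_zero (hW hA) h1, zero_add]

theorem exists_fibMat {X : Mat 4} (hX : X ∈ fibSpace) : ∃ t z w c, X = fibMat t z w c := by
  obtain ⟨a, b, z, w, c, d, rfl⟩ := exists_spMat hX.1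
  have e := spMat_eq_rhoMat_add_fibMat a b z w c d
  refine ⟨_, _, _, _, e.trans (isBackground_negKilling4.eq_of_orthogonal
    (SU2_le_alg.trans Sp2_le_alg) (rhoMat_mem _ _) (fibMat_mem _ _ _ _).2 ?_)⟩
  rw [← e]; exact hX.2

theorem exists_asMat {X : Mat 4} (hX : X ∈ baseSpace) : ∃ r z w, X = asMat r z w := by
  obtain ⟨a, b, z, w, c, d, r, z', w', e⟩ := exists_spMat_add_asMat hX.1
  refine ⟨r, z', w', e.trans (isBackground_negKilling4.eq_of_orthogonal
    Sp2_le_alg (spMat_mem _ _ _ _ _ _) (asMat_mem_baseSpace _ _ _).2 ?_)⟩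
  rw [← e]; exact hX.2

/-! ## Brackets -/

theorem comm_rhoMat_asMat₀ (r : ℝ) (β : ℂ) :
    comm (rhoMat 0 β) (asMat r 0 0) = asMat 0 (-(2 * r3 * Complex.I * r * β)) 0 := by
  ext i j
  fin_cases i <;> fin_cases j <;> simp [rhoMat, spMat, asMat, comm, conj_r3, map_ofNat] <;> ring

theorem comm_rhoMat_asMat₁ (z : ℂ) :
    comm (rhoMat 0 1) (asMat 0 z 0) =
      asMat (2 * Real.sqrt 3 * z.im) 0 (-(2 * z)) := by
  have hz : (z.im : ℂ) * Complex.I = (z - conj z) / 2 := by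
    rw [Complex.sub_conj]; push_cast; ring
  have e : (Real.sqrt 3 : ℂ) = r3 := rfl
  ext i j
  fin_cases i <;> fin_cases j <;>
    simp [rhoMat, spMat, asMat, comm, conj_r3, map_ofNat, e, mul_assoc, hz] <;> ring

theorem comm_rhoMat_fibMat₀ (t : ℝ) (β : ℂ) :
    comm (rhoMat 0 β) (fibMat t 0 0 0) = fibMat 0 (-(4 * r3 * Complex.I * t * β)) 0 0 := by
  have h := r3_sq
  ext i j
  fin_cases i <;> fin_cases j <;>
    simp [rhoMat, spMat, fibMat, comm, conj_r3, map_ofNat] <;> ring_nf <;> simp only [h] <;> ring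

theorem comm_rhoMat_fibMat₁ (z : ℂ) :
    comm (rhoMat 0 1) (fibMat 0 z 0 0) =
      fibMat (2 * Real.sqrt 3 * z.im) 0 (-(5 * z)) 0 := by
  have hz : (z.im : ℂ) * Complex.I = (z - conj z) / 2 := by
    rw [Complex.sub_conj]; push_cast; ring
  have h := r3_sq
  have e : (Real.sqrt 3 : ℂ) = r3 := rfl
  ext i j
  fin_cases i <;> fin_cases j <;>
    simp [rhoMat, spMat, fibMat, comm, conj_r3, map_ofNat, e, mul_assoc, hz] <;> ring_nf <;>
    simp only [h] <;> ring

theorem comm_rhoMat_fibMat₂ (w : ℂ) :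
    comm (rhoMat 0 1) (fibMat 0 0 w 0) = fibMat 0 (2 * w) 0 (-(2 * r3 * w)) := by
  ext i j
  fin_cases i <;> fin_cases j <;>
    simp [rhoMat, spMat, fibMat, comm, conj_r3, map_ofNat] <;> ring

theorem comm_rhoMat_asMat_diag (r : ℝ) (z w : ℂ) : comm (rhoMat 1 0) (asMat r z w) =
    asMat 0 (2 * Complex.I * z) (4 * Complex.I * w) := by
  ext i j
  fin_cases i <;> fin_cases j <;>
    simp [rhoMat, spMat, asMat, comm, map_ofNat] <;> ring

theorem comm_rhoMat_fibMat_diag (t : ℝ) (z w c : ℂ) : comm (rhoMat 1 0) (fibMat t z w c) =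
    fibMat 0 (2 * Complex.I * z) (4 * Complex.I * w) (6 * Complex.I * c) := by
  ext i j
  fin_cases i <;> fin_cases j <;>
    simp [rhoMat, spMat, fibMat, comm, map_ofNat, conj_r3] <;> ring

theorem comm_fibMat_asMat (r : ℝ) (z w : ℂ) : comm (fibMat 1 0 0 0) (asMat r z w) =
    asMat 0 (4 * Complex.I * z) (-(2 * Complex.I * w)) := by
  ext i j
  fin_cases i <;> fin_cases j <;>
    simp [spMat, asMat, fibMat, comm, map_ofNat] <;> ring

theorem comm_asMat_fibMat (t : ℝ) (z w c : ℂ) : comm (asMat 1 0 0) (fibMat t z w c) =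
    asMat 0 (2 * Complex.I * z) (2 * Complex.I * w) := by
  ext i j
  fin_cases i <;> fin_cases j <;>
    simp [spMat, asMat, fibMat, comm, map_ofNat] <;> ring

theorem comm_asMat_asMat (r : ℝ) (z w : ℂ) : comm (asMat 1 0 0) (asMat r z w) =
    spMat 0 0 (2 * Complex.I * z) (2 * Complex.I * w) 0 0 := by
  ext i j
  fin_cases i <;> fin_cases j <;>
    simp [spMat, asMat, comm, map_ofNat] <;> ring

theorem comm_fibMat_fibMat (t : ℝ) (z w c : ℂ) : comm (fibMat 1 0 0 0) (fibMat t z w c) =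
    spMat 0 0 (4 * Complex.I * z) (-(2 * Complex.I * w)) (2 * Complex.I * c)
      (6 * r3 * Complex.I * z) := by
  ext i j
  fin_cases i <;> fin_cases j <;>
    simp [spMat, fibMat, comm, map_ofNat, conj_r3] <;> ring

/-! ### A criterion for irreducibility, and dimensions from orthonormal bases -/

section

variable {N : ℕ} {G K : Subgroup (U N)} {Q : LinearMap.BilinForm ℝ (Mat N)}
  {W : Submodule ℝ (Mat N)}

/-- An irreducibility criterion: a weight vector of multiplicity one that is cyclic. -/
theorem isAdIrreducible_of_cyclic (hQ : IsBackground G Q) (hKG : K ≤ G) (hWG : W ≤ lieAlg G)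
    (hW : IsAdInvariant K W) {f X : Mat N} (hf : f ∈ W) (hf0 : f ≠ 0) (hX : X ∈ lieAlg K)
    (hXf : comm X f = 0) (hker : ∀ Y ∈ W, comm X Y = 0 → ∃ c : ℝ, Y = c • f)
    (hcyc : ∀ W' : Submodule ℝ (Mat N), IsAdInvariant K W' → f ∈ W' → W ≤ W') :
    IsAdIrreducible K W := by
  refine ⟨hW, fun h => hf0 (by rw [h] at hf; simpa using hf), fun W' hle hW' => ?_⟩
  have hO := hW'.orthogonal hQ hKG (hle.trans hWG)
  -- Split the weight vector `f` along `W'` and its complement. As `[X, f] = 0` and both pieces are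
  -- invariant, `[X, A] = 0`, so `A` is a multiple of `f`: either `f` lies in `W'`, or it lies in
  -- the complement. By cyclicity the one containing `f` contains `W`.
  obtain ⟨A, hA, hB⟩ := hQ.exists_add (hle.trans hWG) (hWG hf)
  have h1 := hW'.comm_mem hX hA
  have h2 := hO.comm_mem hX hB
  have e : comm X (f - A) = -comm X A := by
    rw [sub_eq_add_neg, comm_add_right, hXf, zero_add]
    simp only [comm]
    noncomm_ring
  have h3 : comm X A = 0 := by
    rw [e] at h2
    have h4 := LinearMap.BilinForm.mem_orthogonal_iff.1 h2.2 _ h1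
    refine hQ.eq_zero (hWG (hle h1)) ?_
    rw [map_neg, neg_eq_zero] at h4
    exact h4
  obtain ⟨c, hc⟩ := hker A (hle hA) h3
  rcases eq_or_ne c 0 with rfl | hc0
  · left
    rw [hc, zero_smul, sub_zero] at hB
    have := hcyc _ hO hB
    rw [Submodule.eq_bot_iff]
    intro Y hY
    exact hQ.eq_zero (hWG (hle hY))
      (LinearMap.BilinForm.mem_orthogonal_iff.1 (this (hle hY)).2 Y hY)
  · right
    refine le_antisymm hle (hcyc _ hW' ?_)
    have : f = c⁻¹ • A := by rw [hc, smul_smul, inv_mul_cancel₀ hc0, one_smul]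
    rw [this]
    exact W'.smul_mem _ hA

theorem IsONBasis.finrank_eq {ι : Type*} [Fintype ι] [DecidableEq ι] {e : ι → Mat N}
    (he : IsONBasis Q W e) : Module.finrank ℝ W = Fintype.card ι := by
  let φ : W ≃ₗ[ℝ] (ι → ℝ) := LinearEquiv.ofLinearMap
    (LinearMap.pi fun i => (Q.flip (e i)).comp W.subtype)
    (∑ i, (LinearMap.proj i).smulRight (⟨e i, he.mem i⟩ : W))
    (by
      refine LinearMap.ext fun c => funext fun i => ?_
      simp [he.orth])
    (by
      refine LinearMap.ext fun X => Subtype.ext ?_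
      simpa [LinearMap.sum_apply] using (he.expand X X.2).symm)
  rw [φ.finrank_eq, Module.finrank_fintype_fun_eq_card]

end

/-! ## Irreducibility -/

theorem fibSpace_invariant : IsAdInvariant SU2 fibSpace := by
  have h1 : IsAdInvariant SU2 (lieAlg SU2) := isAdInvariant_lieAlg le_rfl
  have h2 := h1.orthogonal isBackground_negKilling4 (SU2_le_Sp2.trans Sp2_le_SU4)
    (SU2_le_alg.trans Sp2_le_alg)
  exact fun u hu X hX => ⟨isAdInvariant_lieAlg SU2_le_Sp2 u hu X hX.1,
    (h2 u hu X ⟨Sp2_le_alg hX.1, hX.2⟩).2⟩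

theorem baseSpace_invariant : IsAdInvariant SU2 baseSpace :=
  (isAdInvariant_lieAlg SU2_le_Sp2).orthogonal isBackground_negKilling4
    (SU2_le_Sp2.trans Sp2_le_SU4) Sp2_le_alg

theorem asMat_zero : asMat 0 0 0 = 0 := by
  ext i j
  fin_cases i <;> fin_cases j <;> simp [asMat]

theorem fibMat_zero : fibMat 0 0 0 0 = 0 := by
  ext i j
  fin_cases i <;> fin_cases j <;> simp [fibMat, spMat]

theorem asMat_sub (r : ℝ) (z w : ℂ) (r' : ℝ) (z' w' : ℂ) :
    asMat r z w - asMat r' z' w' = asMat (r - r') (z - z') (w - w') := by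
  rw [sub_eq_iff_eq_add, asMat_add]
  simp

theorem fibMat_sub (t : ℝ) (z w c : ℂ) (t' : ℝ) (z' w' c' : ℂ) :
    fibMat t z w c - fibMat t' z' w' c' = fibMat (t - t') (z - z') (w - w') (c - c') := by
  rw [sub_eq_iff_eq_add, fibMat_add]
  simp

theorem asMat_inj {r r' : ℝ} {z z' w w' : ℂ} (h : asMat r z w = asMat r' z' w') :
    r = r' ∧ z = z' ∧ w = w' := by
  refine ⟨?_, congrFun (congrFun h 0) 1, congrFun (congrFun h 0) 2⟩
  have := congrArg Complex.im (congrFun (congrFun h 0) 0)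
  simpa [asMat] using this

theorem fibMat_inj {t t' : ℝ} {z z' w w' c c' : ℂ} (h : fibMat t z w c = fibMat t' z' w' c') :
    t = t' ∧ z = z' ∧ w = w' ∧ c = c' := by
  refine ⟨?_, congrFun (congrFun h 0) 1, congrFun (congrFun h 0) 2, congrFun (congrFun h 0) 3⟩
  have := congrArg Complex.im (congrFun (congrFun h 0) 0)
  simpa [fibMat, spMat] using this

/-- Under `rhoMat 1 0` the coordinates `r`, `z`, `w` have weights `0`, `2`, `4`. Brackets with
`rhoMat 0 β` move the zero weight vector to weight `2`, and those vectors to weight `4` up to weight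
`0`. -/
theorem baseSpace_irreducible : IsAdIrreducible SU2 baseSpace := by
  have hr := r3_ne
  refine isAdIrreducible_of_cyclic isBackground_negKilling4 (SU2_le_Sp2.trans Sp2_le_SU4)
    inf_le_left baseSpace_invariant (asMat_mem_baseSpace 1 0 0) ?_ (rhoMat_mem 1 0) ?_ ?_ ?_
  · rw [← asMat_zero]
    exact fun h => one_ne_zero (asMat_inj h).1
  · rw [comm_rhoMat_asMat_diag, ← asMat_zero]; simp
  · intro Y hY h
    obtain ⟨r, z, w, rfl⟩ := exists_asMat hY
    rw [comm_rhoMat_asMat_diag, ← asMat_zero] at h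
    obtain ⟨-, hz, hw⟩ := asMat_inj h
    have hz' : z = 0 := by simpa using hz
    have hw' : w = 0 := by simpa using hw
    exact ⟨r, by rw [asMat_smul, hz', hw']; simp⟩
  · intro W' hW' hf X hX
    have h0 : ∀ r : ℝ, asMat r 0 0 ∈ W' := fun r => by
      have := W'.smul_mem r hf
      rw [asMat_smul] at this
      simpa using this
    have h1 : ∀ z : ℂ, asMat 0 z 0 ∈ W' := fun z => by
      have := hW'.comm_mem (rhoMat_mem 0 (-(z / (2 * r3 * Complex.I)))) hf
      rw [comm_rhoMat_asMat₀] at this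
      convert this using 2
      field_simp [Complex.I_ne_zero]
      simp
    have h2 : ∀ w : ℂ, asMat 0 0 w ∈ W' := fun w => by
      have := hW'.comm_mem (rhoMat_mem 0 1) (h1 (-(w / 2)))
      rw [comm_rhoMat_asMat₁] at this
      have := W'.sub_mem this (h0 (2 * Real.sqrt 3 * (-(w / 2)).im))
      rw [asMat_sub] at this
      convert this using 2
      · ring
      · simp
      · simp; ring
    obtain ⟨r, z, w, rfl⟩ := exists_asMat hX
    have := W'.add_mem (W'.add_mem (h0 r) (h1 z)) (h2 w)
    simpa [asMat_add] using this

/-- As for `baseSpace`, with the weights `0`, `2`, `4`, `6`. -/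
theorem fibSpace_irreducible : IsAdIrreducible SU2 fibSpace := by
  have hr := r3_ne
  refine isAdIrreducible_of_cyclic isBackground_negKilling4 (SU2_le_Sp2.trans Sp2_le_SU4)
    (inf_le_left.trans Sp2_le_alg) fibSpace_invariant (fibMat_mem 1 0 0 0) ?_ (rhoMat_mem 1 0)
    ?_ ?_ ?_
  · rw [← fibMat_zero]
    exact fun h => one_ne_zero (fibMat_inj h).1
  · rw [comm_rhoMat_fibMat_diag, ← fibMat_zero]; simp
  · intro Y hY h
    obtain ⟨t, z, w, c, rfl⟩ := exists_fibMat hY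
    rw [comm_rhoMat_fibMat_diag, ← fibMat_zero] at h
    obtain ⟨-, hz, hw, hc⟩ := fibMat_inj h
    have hz' : z = 0 := by simpa using hz
    have hw' : w = 0 := by simpa using hw
    have hc' : c = 0 := by simpa using hc
    exact ⟨t, by rw [fibMat_smul, hz', hw', hc']; simp⟩
  · intro W' hW' hf X hX
    have h0 : ∀ t : ℝ, fibMat t 0 0 0 ∈ W' := fun t => by
      have := W'.smul_mem t hf
      rw [fibMat_smul] at this
      simpa using this
    have h1 : ∀ z : ℂ, fibMat 0 z 0 0 ∈ W' := fun z => by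
      have := hW'.comm_mem (rhoMat_mem 0 (-(z / (4 * r3 * Complex.I)))) hf
      rw [comm_rhoMat_fibMat₀] at this
      convert this using 2
      field_simp [Complex.I_ne_zero]
      simp
    have h2 : ∀ w : ℂ, fibMat 0 0 w 0 ∈ W' := fun w => by
      have := hW'.comm_mem (rhoMat_mem 0 1) (h1 (-(w / 5)))
      rw [comm_rhoMat_fibMat₁] at this
      have := W'.sub_mem this (h0 (2 * Real.sqrt 3 * (-(w / 5)).im))
      rw [fibMat_sub] at this
      convert this using 2
      · ring
      · simp
      · simp; ring
      · simp
    have h3 : ∀ c : ℂ, fibMat 0 0 0 c ∈ W' := fun c => by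
      have := hW'.comm_mem (rhoMat_mem 0 1) (h2 (-(c / (2 * r3))))
      rw [comm_rhoMat_fibMat₂] at this
      have := W'.sub_mem this (h1 (2 * -(c / (2 * r3))))
      rw [fibMat_sub] at this
      convert this using 2
      · ring
      · simp
      · simp
      · field_simp; simp
    obtain ⟨t, z, w, c, rfl⟩ := exists_fibMat hX
    have := W'.add_mem (W'.add_mem (W'.add_mem (h0 t) (h1 z)) (h2 w)) (h3 c)
    simpa [fibMat_add] using this

/-! ## Orthonormal bases -/

/-- An orthonormal basis of the isotropy representation of `SU(4)/Sp(2)`. -/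
noncomputable def baseBasis : Fin 5 → Mat 4 :=
  let k : ℝ := (Real.sqrt 32)⁻¹
  ![asMat k 0 0, asMat 0 k 0, asMat 0 (k * Complex.I) 0, asMat 0 0 k, asMat 0 0 (k * Complex.I)]

/-- An orthonormal basis of the isotropy representation of `Sp(2)/SU(2)`. -/
noncomputable def fibBasis : Fin 7 → Mat 4 :=
  ![fibMat (Real.sqrt 160)⁻¹ 0 0 0, fibMat 0 ((Real.sqrt 80)⁻¹ : ℝ) 0 0,
    fibMat 0 (((Real.sqrt 80)⁻¹ : ℝ) * Complex.I) 0 0, fibMat 0 0 ((Real.sqrt 32)⁻¹ : ℝ) 0,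
    fibMat 0 0 (((Real.sqrt 32)⁻¹ : ℝ) * Complex.I) 0, fibMat 0 0 0 ((Real.sqrt 16)⁻¹ : ℝ),
    fibMat 0 0 0 (((Real.sqrt 16)⁻¹ : ℝ) * Complex.I)]

theorem inv_sqrt_mul_self {x : ℝ} (hx : 0 ≤ x) : (Real.sqrt x)⁻¹ * (Real.sqrt x)⁻¹ = x⁻¹ := by
  rw [← mul_inv, Real.mul_self_sqrt hx]

theorem isONBasis_baseBasis : IsONBasis negKilling4 baseSpace baseBasis where
  mem i := by fin_cases i <;> exact asMat_mem_baseSpace ..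
  orth i j := by
    have hk := inv_sqrt_mul_self (x := 32) (by norm_num)
    simp only [baseBasis]
    generalize (Real.sqrt 32)⁻¹ = k at hk
    fin_cases i <;> fin_cases j <;> simp [negKilling4_asMat] <;> linarith
  expand X hX := by
    obtain ⟨r, z, w, rfl⟩ := exists_asMat hX
    have hk := inv_sqrt_mul_self (x := 32) (by norm_num)
    simp only [baseBasis]
    generalize (Real.sqrt 32)⁻¹ = k at hk
    rw [Fin.sum_univ_five]
    simp [negKilling4_asMat, asMat_smul, asMat_add]
    have hC : (k : ℂ) * k = 32⁻¹ := by rw [← Complex.ofReal_mul, hk]; norm_num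
    have hz := Complex.re_add_im z
    have hw := Complex.re_add_im w
    congr 1
    · linear_combination (-32 * r) * hk
    · linear_combination (-32 * z) * hC - 32 * k * k * hz
    · linear_combination (-32 * w) * hC - 32 * k * k * hw

theorem isONBasis_fibBasis : IsONBasis negKilling4 fibSpace fibBasis where
  mem i := by fin_cases i <;> exact fibMat_mem ..
  orth i j := by
    have hk₁ := inv_sqrt_mul_self (x := 160) (by norm_num)
    have hk₂ := inv_sqrt_mul_self (x := 80) (by norm_num)
    have hk₃ := inv_sqrt_mul_self (x := 32) (by norm_num)
    have hk₄ := inv_sqrt_mul_self (x := 16) (by norm_num)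
    simp only [fibBasis]
    generalize (Real.sqrt 160)⁻¹ = k₁ at hk₁
    generalize (Real.sqrt 80)⁻¹ = k₂ at hk₂
    generalize (Real.sqrt 32)⁻¹ = k₃ at hk₃
    generalize (Real.sqrt 16)⁻¹ = k₄ at hk₄
    fin_cases i <;> fin_cases j <;> simp [negKilling4_fibMat] <;> linarith
  expand X hX := by
    obtain ⟨r, z, w, c, rfl⟩ := exists_fibMat hX
    have hk₁ := inv_sqrt_mul_self (x := 160) (by norm_num)
    have hk₂ := inv_sqrt_mul_self (x := 80) (by norm_num)
    have hk₃ := inv_sqrt_mul_self (x := 32) (by norm_num)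
    have hk₄ := inv_sqrt_mul_self (x := 16) (by norm_num)
    simp only [fibBasis]
    generalize (Real.sqrt 160)⁻¹ = k₁ at hk₁
    generalize (Real.sqrt 80)⁻¹ = k₂ at hk₂
    generalize (Real.sqrt 32)⁻¹ = k₃ at hk₃
    generalize (Real.sqrt 16)⁻¹ = k₄ at hk₄
    rw [Fin.sum_univ_seven]
    simp [negKilling4_fibMat, fibMat_smul, fibMat_add]
    have hC₂ : (k₂ : ℂ) * k₂ = 80⁻¹ := by rw [← Complex.ofReal_mul, hk₂]; norm_num
    have hC₃ : (k₃ : ℂ) * k₃ = 32⁻¹ := by rw [← Complex.ofReal_mul, hk₃]; norm_num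
    have hC₄ : (k₄ : ℂ) * k₄ = 16⁻¹ := by rw [← Complex.ofReal_mul, hk₄]; norm_num
    have hz := Complex.re_add_im z
    have hw := Complex.re_add_im w
    have hc := Complex.re_add_im c
    congr 1
    · linear_combination (-160 * r) * hk₁
    · linear_combination (-80 * z) * hC₂ - 80 * k₂ * k₂ * hz
    · linear_combination (-32 * w) * hC₃ - 32 * k₃ * k₃ * hw
    · linear_combination (-16 * c) * hC₄ - 16 * k₄ * k₄ * hc

/-! ## The Ricci tensor of `SU(4)/SU(2)` -/

/-- The dimensions are 7 and 5. -/
theorem not_adEquivalent : ¬ AdEquivalent SU2 fibSpace baseSpace := by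
  rintro ⟨φ, -⟩
  have := φ.finrank_eq
  rw [isONBasis_fibBasis.finrank_eq, isONBasis_baseBasis.finrank_eq] at this
  simp at this

theorem NonMaximalTwoSummand.commK_eq {N : ℕ} {G H K : Subgroup (U N)}
    {Q : LinearMap.BilinForm ℝ (Mat N)} {p₁ p₂ : Submodule ℝ (Mat N)}
    (h : NonMaximalTwoSummand G H K Q p₁ p₂) {X Y A B : Mat N} (e : comm X Y = A + B)
    (hA : A ∈ lieAlg K) (hB : B ∈ isotropy Q G K) : commK Q G K X Y = A := by
  rw [commK, e, map_add, proj_apply_left h.disjoint_k_p hA, zero_add,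
    proj_apply_right h.disjoint_k_p ⟨B, hB⟩, add_sub_cancel_right]

theorem fibSpace_le : fibSpace ≤ isotropy negKilling4 SU4 SU2 :=
  inf_le_inf_right _ Sp2_le_alg

section

variable (h : NonMaximalTwoSummand SU4 Sp2 SU2 negKilling4 fibSpace baseSpace)
include h

theorem commK_fibMat (t : ℝ) (z w c : ℂ) :
    commK negKilling4 SU4 SU2 (fibMat 1 0 0 0) (fibMat t z w c) =
      rhoMat 0 (2 * r3 * Complex.I * z) := by
  have e := (comm_fibMat_fibMat t z w c).trans (spMat_eq_rhoMat_add_fibMat ..)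
  rw [h.commK_eq e (rhoMat_mem _ _) (fibSpace_le (fibMat_mem _ _ _ _))]
  congr 1
  · norm_num
  · ring

theorem commK_asMat (r : ℝ) (z w : ℂ) :
    commK negKilling4 SU4 SU2 (asMat 1 0 0) (asMat r z w) =
      rhoMat 0 (2 / 5 * r3 * Complex.I * z) := by
  have e := (comm_asMat_asMat r z w).trans (spMat_eq_rhoMat_add_fibMat ..)
  rw [h.commK_eq e (rhoMat_mem _ _) (fibSpace_le (fibMat_mem _ _ _ _))]
  congr 1
  · norm_num
  · ring

omit h in
theorem crossForm_fibMat :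
    crossForm negKilling4 baseBasis (fibMat 1 0 0 0) (fibMat 1 0 0 0) = 40 := by
  have hk := inv_sqrt_mul_self (x := 32) (by norm_num)
  simp only [crossForm, baseBasis, Fin.sum_univ_five]
  generalize (Real.sqrt 32)⁻¹ = k at hk
  simp [comm_fibMat_asMat, negKilling4_asMat]
  linarith

omit h in
theorem crossForm_asMat :
    crossForm negKilling4 fibBasis (asMat 1 0 0) (asMat 1 0 0) = 56 / 5 := by
  have hk₂ := inv_sqrt_mul_self (x := 80) (by norm_num)
  have hk₃ := inv_sqrt_mul_self (x := 32) (by norm_num)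
  simp only [crossForm, fibBasis, Fin.sum_univ_seven]
  generalize (Real.sqrt 80)⁻¹ = k₂ at hk₂
  generalize (Real.sqrt 32)⁻¹ = k₃ at hk₃
  simp [comm_asMat_fibMat, negKilling4_asMat]
  linarith

/-- The bracket of `asMat 1 0 0` with `baseSpace` lies in `𝔰𝔭(2)`, as expected for the symmetric
space `SU(4)/Sp(2)`, so only the isotropy part contributes. -/
theorem selfForm_asMat : selfForm negKilling4 SU4 SU2 (cp₂ Sp2 baseSpace) baseBasis
    (asMat 1 0 0) (asMat 1 0 0) = 24 / 5 := by
  have hk := inv_sqrt_mul_self (x := 32) (by norm_num)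
  have hc : ∀ r z w, cp₂ Sp2 baseSpace (comm (asMat 1 0 0) (asMat r z w)) = 0 := fun r z w => by
    rw [comm_asMat_asMat]; exact h.cp₂_of_mem_H (spMat_mem ..)
  have h3 : ∀ z : ℂ, (2 / 5 * r3 * Complex.I * z) * conj (2 / 5 * r3 * Complex.I * z) =
      12 / 25 * (z * conj z) := fun z => by
    simp only [map_mul, map_div₀, map_ofNat, conj_r3, Complex.conj_I]
    linear_combination (-(4 / 25) * r3 ^ 2 * z * conj z) * Complex.I_sq +
      4 / 25 * z * conj z * r3_sq
  simp only [selfForm, baseBasis, Fin.sum_univ_five]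
  generalize (Real.sqrt 32)⁻¹ = k at hk
  simp only [Matrix.cons_val, hc, commK_asMat h, negKilling4_rhoMat, h3]
  simp
  linarith

/-- Dropping the nonnegative `p₁`-components leaves a lower bound for `a₁`, which is all that the
discriminant needs. -/
theorem le_selfForm_fibMat : 48 ≤ selfForm negKilling4 SU4 SU2 (cp₁ SU2 fibSpace baseSpace)
    fibBasis (fibMat 1 0 0 0) (fibMat 1 0 0 0) := by
  have hk₂ := inv_sqrt_mul_self (x := 80) (by norm_num)
  have h3 : ∀ z : ℂ, (2 * r3 * Complex.I * z) * conj (2 * r3 * Complex.I * z) =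
      12 * (z * conj z) := fun z => by
    simp only [map_mul, map_ofNat, conj_r3, Complex.conj_I]
    linear_combination (-4 * r3 ^ 2 * z * conj z) * Complex.I_sq + 4 * z * conj z * r3_sq
  have hle : ∑ i, negKilling4 (commK negKilling4 SU4 SU2 (fibMat 1 0 0 0) (fibBasis i))
      (commK negKilling4 SU4 SU2 (fibMat 1 0 0 0) (fibBasis i)) ≤
      selfForm negKilling4 SU4 SU2 (cp₁ SU2 fibSpace baseSpace) fibBasis
        (fibMat 1 0 0 0) (fibMat 1 0 0 0) :=
    Finset.sum_le_sum fun i _ => le_add_of_nonneg_left (mul_nonneg (by norm_num)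
      (h.Q₁_nonneg _))
  refine le_trans ?_ hle
  simp only [fibBasis, Fin.sum_univ_seven]
  generalize (Real.sqrt 80)⁻¹ = k₂ at hk₂
  simp only [Matrix.cons_val, commK_fibMat h, negKilling4_rhoMat, h3]
  simp
  linarith

/-- The polynomial is at least `3/10 - y/2 + 19 y²/80`, whose discriminant `1/4 - 57/200` is
negative. -/
theorem not_isEinstein_SU4 (g : LinearMap.BilinForm ℝ (isotropy negKilling4 SU4 SU2)) :
    ¬ IsEinstein SU2 (isotropy negKilling4 SU4 SU2) g := by
  obtain ⟨a₁, b₁, a₂, b₂, -, -, -, e1, e2, e3, e4, hR⟩ :=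
    h.exists_ricci_eq isONBasis_fibBasis isONBasis_baseBasis
  refine h.not_isEinstein hR (fun y hy h0 => ?_) g
  have e1' := e1 _ (fibMat_mem 1 0 0 0)
  have e2' := e2 _ (fibMat_mem 1 0 0 0)
  have e3' := e3 _ (asMat_mem_baseSpace 1 0 0)
  have e4' := e4 _ (asMat_mem_baseSpace 1 0 0)
  have hf : negKilling4 (fibMat 1 0 0 0) (fibMat 1 0 0 0) = 160 := by
    simp [negKilling4_fibMat]
  have hb : negKilling4 (asMat 1 0 0) (asMat 1 0 0) = 32 := by
    simp [negKilling4_asMat]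
  rw [hf] at e1' e2'
  rw [hb] at e3' e4'
  have hle := le_selfForm_fibMat h
  rw [crossForm_fibMat] at e2'
  rw [selfForm_asMat h, crossForm_asMat] at e3'
  rw [crossForm_asMat] at e4'
  have ha₁ : 3 / 10 ≤ a₁ := by linarith
  have hb₁ : b₁ = 1 / 16 := by linarith
  have ha₂ : a₂ = 1 / 2 := by linarith
  have hb₂ : b₂ = 7 / 40 := by linarith
  rw [einsteinPoly, hb₁, ha₂, hb₂] at h0
  nlinarith [sq_nonneg (y - 1)]

end

/-! ## Connectedness of `SU(4)` and `Sp(2)` -/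

/-- The pencil `(1 - s) u + (1 + s)`. -/
noncomputable def pencil {N : ℕ} (u : Mat N) (s : ℝ) : Mat N :=
  (1 - s) • u + (1 + s) • (1 : Mat N)

/-- The expression depends on `s` only through `s²`. This makes `moebius` unitary, since it is the
quotient of the pencils at `-s` and `s`. -/
theorem star_pencil_mul_pencil {N : ℕ} (u : U N) (s : ℝ) :
    star (pencil (u : Mat N) s) * pencil (u : Mat N) s =
      (1 - s ^ 2) • (star (1 + (u : Mat N)) * (1 + (u : Mat N))) + (4 * s ^ 2) • (1 : Mat N) := by
  have h : star (u : Mat N) * (u : Mat N) = 1 := by simp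
  simp only [pencil, star_add, star_smul, star_one, add_mul, mul_add, smul_mul_assoc,
    mul_smul_comm, h, mul_one, one_mul, smul_add, star_trivial]
  module

-- For `s > 0` the product of the pencil with its adjoint is a positive semidefinite matrix plus `4
-- s²`, hence positive definite. For `s = 0` it is the hypothesis on `u`.
open scoped ComplexOrder in
theorem det_pencil_ne_zero {N : ℕ} {u : U N} (hu : (1 + (u : Mat N)).det ≠ 0) {s : ℝ}
    (hs : s ∈ Icc (0 : ℝ) 1) : (pencil (u : Mat N) s).det ≠ 0 := by
  rcases hs.1.eq_or_lt with rfl | h0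
  · simpa [pencil, add_comm] using hu
  intro h
  obtain ⟨v, hv, hv0⟩ := Matrix.exists_mulVec_eq_zero_iff.2 h
  have h1 : (star (pencil (u : Mat N) s) * pencil (u : Mat N) s).PosDef := by
    rw [star_pencil_mul_pencil]
    refine Matrix.PosDef.posSemidef_add ?_ ?_
    · exact (Matrix.posSemidef_conjTranspose_mul_self _).smul (by nlinarith [hs.2])
    · exact Matrix.PosDef.one.smul (by positivity)
  have h2 := h1.isUnit
  rw [Matrix.isUnit_iff_isUnit_det, Matrix.det_mul, h, mul_zero] at h2
  exact not_isUnit_zero h2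

/-- A curve from `1` to `u`. -/
noncomputable def moebius {N : ℕ} (u : Mat N) (s : ℝ) : Mat N :=
  pencil u (-s) * (pencil u s)⁻¹

theorem moebius_mul_pencil {N : ℕ} {u : U N} (hu : (1 + (u : Mat N)).det ≠ 0) {s : ℝ}
    (hs : s ∈ Icc (0 : ℝ) 1) :
    moebius (u : Mat N) s * pencil (u : Mat N) s = pencil (u : Mat N) (-s) := by
  rw [moebius, Matrix.mul_assoc, Matrix.nonsing_inv_mul _ (det_pencil_ne_zero hu hs).isUnit,
    Matrix.mul_one]

theorem eq_of_mul_mul_pencil {N : ℕ} {u : U N} (hu : (1 + (u : Mat N)).det ≠ 0) {s : ℝ}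
    (hs : s ∈ Icc (0 : ℝ) 1) {A B C : Mat N} (hC : C.det ≠ 0)
    (h : C * A * pencil (u : Mat N) s = C * B * pencil (u : Mat N) s) : A = B := by
  have h1 := congrArg (fun M => C⁻¹ * M * (pencil (u : Mat N) s)⁻¹) h
  simpa only [Matrix.mul_assoc, Matrix.mul_nonsing_inv _ (det_pencil_ne_zero hu hs).isUnit,
    Matrix.mul_one, ← Matrix.mul_assoc C⁻¹, Matrix.nonsing_inv_mul _ hC.isUnit,
    Matrix.one_mul] using h1

theorem moebius_mem_unitary {N : ℕ} {u : U N} (hu : (1 + (u : Mat N)).det ≠ 0) {s : ℝ}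
    (hs : s ∈ Icc (0 : ℝ) 1) : moebius (u : Mat N) s ∈ Matrix.unitaryGroup (Fin N) ℂ := by
  rw [Matrix.mem_unitaryGroup_iff']
  refine eq_of_mul_mul_pencil hu hs (C := star (pencil (u : Mat N) s)) ?_ ?_
  · rw [Matrix.star_eq_conjTranspose, Matrix.det_conjTranspose]
    exact star_ne_zero.2 (det_pencil_ne_zero hu hs)
  · rw [← Matrix.mul_assoc, ← star_mul, Matrix.mul_assoc, moebius_mul_pencil hu hs, Matrix.mul_one,
      star_pencil_mul_pencil, star_pencil_mul_pencil, neg_sq]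

/-- `pencilᵀ J pencil` is again even in the parameter, so the path of a symplectic `u` stays
symplectic. -/
theorem moebius_transpose_J {u : U 4} (hu : (1 + (u : Mat 4)).det ≠ 0) (hJ : u ∈ Sp2) {s : ℝ}
    (hs : s ∈ Icc (0 : ℝ) 1) :
    (moebius (u : Mat 4) s)ᵀ * J * moebius (u : Mat 4) s = J := by
  have hJ' : (u : Mat 4)ᵀ * J * (u : Mat 4) = J := hJ
  refine eq_of_mul_mul_pencil hu hs (C := (pencil (u : Mat 4) s)ᵀ) ?_ ?_
  · rw [Matrix.det_transpose]
    exact det_pencil_ne_zero hu hs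
  · have h1 : (pencil (u : Mat 4) s)ᵀ * ((moebius (u : Mat 4) s)ᵀ * J * moebius (u : Mat 4) s) *
        pencil (u : Mat 4) s = (pencil (u : Mat 4) (-s))ᵀ * J * pencil (u : Mat 4) (-s) := by
      rw [← moebius_mul_pencil hu hs, Matrix.transpose_mul]
      simp only [Matrix.mul_assoc]
    have h2 : ∀ t : ℝ, (pencil (u : Mat 4) t)ᵀ * J * pencil (u : Mat 4) t =
        (2 + 2 * t ^ 2) • J + (1 - t ^ 2) • ((u : Mat 4)ᵀ * J + J * (u : Mat 4)) := by
      intro t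
      simp only [pencil, Matrix.transpose_add, Matrix.transpose_smul, Matrix.transpose_one,
        add_mul, mul_add, smul_mul_assoc, mul_smul_comm, hJ', mul_one, one_mul, smul_add]
      module
    rw [h1, h2, h2, neg_sq]

theorem continuousOn_moebius {N : ℕ} {u : U N} (hu : (1 + (u : Mat N)).det ≠ 0) :
    ContinuousOn (moebius (u : Mat N)) (Icc 0 1) := by
  have h : Continuous (pencil (u : Mat N)) := by unfold pencil; fun_prop
  have h' : ContinuousOn (fun s => (pencil (u : Mat N) s)⁻¹) (Icc 0 1) := by
    simp only [Matrix.inv_def, Ring.inverse_eq_inv']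
    exact (h.matrix_det.continuousOn.inv₀ fun s hs => det_pencil_ne_zero hu hs).smul
      h.matrix_adjugate.continuousOn
  exact (h.comp continuous_neg).continuousOn.mul h'

/-- At `s = 0` the two pencils coincide, so the path starts at `1`; at `s = 1` their quotient is
`u`. -/
theorem joined_one_of_det_ne_zero {N : ℕ} {G : Subgroup (U N)} (u : G)
    (hu : (1 + ((u : U N) : Mat N)).det ≠ 0)
    (hG : ∀ v : U N, ∀ s ∈ Icc (0 : ℝ) 1, (v : Mat N) = moebius ((u : U N) : Mat N) s → v ∈ G) :
    Joined 1 u := by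
  refine ⟨⟨⟨fun s => ⟨⟨moebius ((u : U N) : Mat N) s, moebius_mem_unitary hu s.2⟩,
    hG _ s s.2 rfl⟩, ?_⟩, ?_, ?_⟩⟩
  · exact ((continuousOn_iff_continuous_domRestrict.1 (continuousOn_moebius hu)).subtype_mk
      _).subtype_mk _
  · refine Subtype.ext (Subtype.ext ?_)
    have h := det_pencil_ne_zero hu (s := 0) (by simp)
    simp [moebius, Matrix.mul_nonsing_inv _ h.isUnit]
  · refine Subtype.ext (Subtype.ext ?_)
    have h : pencil ((u : U N) : Mat N) 1 = (2 : ℝ) • 1 := by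
      rw [pencil]; module
    have h' : pencil ((u : U N) : Mat N) (-1) =
        ((u : U N) : Mat N) * pencil ((u : U N) : Mat N) 1 := by
      rw [h, pencil, mul_smul_comm, mul_one]; module
    have h1 := det_pencil_ne_zero hu (s := 1) (by simp)
    change moebius ((u : U N) : Mat N) 1 = _
    rw [moebius, h', Matrix.mul_assoc, Matrix.mul_nonsing_inv _ h1.isUnit, Matrix.mul_one]

theorem joined_one_Sp2 (u : Sp2) (hu : (1 + ((u : U 4) : Mat 4)).det ≠ 0) : Joined 1 u :=
  joined_one_of_det_ne_zero u hu fun v s hs hv => by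
    change (v : Mat 4)ᵀ * J * (v : Mat 4) = J
    rw [hv]
    exact moebius_transpose_J hu u.2 hs

theorem joined_one_mul {G : Type*} [Group G] [TopologicalSpace G] [ContinuousMul G] {a b : G}
    (ha : Joined 1 a) (hb : Joined 1 b) : Joined 1 (a * b) := by
  simpa using ha.mul hb

theorem joined_one_of_mul {G : Type*} [Group G] [TopologicalSpace G] [IsTopologicalGroup G]
    {a b : G} (ha : Joined 1 a) (hb : Joined 1 (a * b)) : Joined 1 b := by
  simpa using ha.inv.mul hb

theorem joined_one_pow {G : Type*} [Group G] [TopologicalSpace G] [ContinuousMul G] {a : G}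
    (ha : Joined 1 a) (n : ℕ) : Joined 1 (a ^ n) := by
  induction n with
  | zero => simpa using Joined.refl _
  | succ n ih => exact pow_succ a n ▸ joined_one_mul ih ha

theorem det_one_add_smul (u : Mat 4) : ∃ p q r : ℂ, ∀ x : ℂ,
    (1 + x • u).det = 1 + p * x + q * x ^ 2 + r * x ^ 3 + u.det * x ^ 4 := by
  have h : ∀ i j k : Fin 4, (u.submatrix ![i, j, k] ![i, j, k]).det =
      u i i * u j j * u k k - u i i * u j k * u k j - u i j * u j i * u k k +
        u i j * u j k * u k i + u i k * u j i * u k j - u i k * u j j * u k i := fun i j k => by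
    rw [Matrix.det_fin_three]
    rfl
  refine ⟨u 0 0 + u 1 1 + u 2 2 + u 3 3,
    u 0 0 * u 1 1 - u 0 1 * u 1 0 + (u 0 0 * u 2 2 - u 0 2 * u 2 0) +
      (u 0 0 * u 3 3 - u 0 3 * u 3 0) + (u 1 1 * u 2 2 - u 1 2 * u 2 1) +
      (u 1 1 * u 3 3 - u 1 3 * u 3 1) + (u 2 2 * u 3 3 - u 2 3 * u 3 2),
    (u.submatrix ![0, 1, 2] ![0, 1, 2]).det + (u.submatrix ![0, 1, 3] ![0, 1, 3]).det +
      (u.submatrix ![0, 2, 3] ![0, 2, 3]).det + (u.submatrix ![1, 2, 3] ![1, 2, 3]).det,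
    fun x => ?_⟩
  simp only [h]
  rw [det_fin_four, det_fin_four]
  simp
  ring

/-- The determinants of `1 + w u`, for the four `w` in the group generated by `-1` and
`diag(1, -1, -1, 1)`. -/
theorem sum_det_one_add (u : Mat 4) :
    (1 + u).det + (1 - u).det + (1 + diagonal ![1, -1, -1, 1] * u).det +
        (1 - diagonal ![1, -1, -1, 1] * u).det =
      4 * (1 + u.det + (u 0 0 * u 3 3 - u 0 3 * u 3 0) + (u 1 1 * u 2 2 - u 1 2 * u 2 1)) := by
  simp only [det_fin_four]
  simp [Matrix.diagonal_mul]
  ring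

/-- The diagonal unitary matrix with diagonal `d`. -/
noncomputable def diagU (d : Fin 4 → ℂ) (h : ∀ i, d i * star (d i) = 1) : U 4 :=
  ⟨diagonal d, by
    rw [Matrix.mem_unitaryGroup_iff, Matrix.star_eq_conjTranspose, Matrix.diagonal_conjTranspose,
      Matrix.diagonal_mul_diagonal, ← Matrix.diagonal_one]
    congr 1
    funext i
    exact h i⟩

theorem diagU_mem_Sp2 {d : Fin 4 → ℂ} {h} (h03 : d 0 * d 3 = 1) (h12 : d 1 * d 2 = 1) :
    diagU d h ∈ Sp2 := by
  change (diagonal d)ᵀ * J * diagonal d = J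
  rw [Matrix.diagonal_transpose]
  ext i j
  fin_cases i <;> fin_cases j <;>
    simp [J, Matrix.mul_apply, Matrix.diagonal_apply, mul_comm (d 3),
      mul_comm (d 2), h03, h12]

theorem det_one_add_diagonal (d : Fin 4 → ℂ) :
    (1 + diagonal d).det = (1 + d 0) * (1 + d 1) * (1 + d 2) * (1 + d 3) := by
  rw [← Matrix.diagonal_one, Matrix.diagonal_add, Matrix.det_diagonal, Fin.prod_univ_four]

theorem one_add_I_ne_zero : (1 + Complex.I) ≠ 0 := fun h => by
  simpa using congrArg Complex.re h

theorem one_add_neg_I_ne_zero : (1 + -Complex.I) ≠ 0 := fun h => by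
  simpa using congrArg Complex.re h

theorem joined_one_Sp2_diag {d : Fin 4 → ℂ} {h} (hd : diagU d h ∈ Sp2)
    (hd' : ∀ i, 1 + d i ≠ 0) : Joined 1 (⟨diagU d h, hd⟩ : Sp2) := by
  refine joined_one_Sp2 _ ?_
  change (1 + diagonal d).det ≠ 0
  rw [det_one_add_diagonal]
  exact mul_ne_zero (mul_ne_zero (mul_ne_zero (hd' 0) (hd' 1)) (hd' 2)) (hd' 3)

/-- Entries of a symplectic unitary matrix. -/
theorem Sp2_apply {u : U 4} (hu : u ∈ Sp2) :
    (u : Mat 4) 3 3 = star ((u : Mat 4) 0 0) ∧ (u : Mat 4) 3 0 = -star ((u : Mat 4) 0 3) ∧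
      (u : Mat 4) 2 2 = star ((u : Mat 4) 1 1) ∧ (u : Mat 4) 2 1 = -star ((u : Mat 4) 1 2) := by
  have hJ : (u : Mat 4)ᵀ * J * (u : Mat 4) = J := hu
  have h1 : (star (u : Mat 4))ᵀ * (u : Mat 4)ᵀ = 1 := by
    rw [← Matrix.transpose_mul]; simp
  have h2 : J * (u : Mat 4) = (star (u : Mat 4))ᵀ * J := by
    conv_rhs => rw [← hJ]
    rw [Matrix.mul_assoc _ J, ← Matrix.mul_assoc _ (u : Mat 4)ᵀ, h1, Matrix.one_mul]
  have e := fun i j => congrFun (congrFun h2 i) j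
  have e00 := e 0 0
  have e03 := e 0 3
  have e11 := e 1 1
  have e12 := e 1 2
  simp [J, Matrix.mul_apply, Fin.sum_univ_four, Matrix.star_apply] at e00 e03 e11 e12
  exact ⟨e03, e00, e12, by simp [← e11]⟩

/-- It is enough to find `w` joined to `1` such that `-1` is not an eigenvalue of `w u`. The choices
`±1` and `±diag(1, -1, -1, 1)` cannot all fail: the determinants of `1 + w u` sum to `4` times `2`
plus squares of absolute values of entries of `u`. -/
theorem joined_one_of_mem_Sp2 (u : Sp2) : Joined 1 u := by
  have hI : ∀ i, ![Complex.I, Complex.I, -Complex.I, -Complex.I] i *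
      star (![Complex.I, Complex.I, -Complex.I, -Complex.I] i) = 1 := by
    intro i; fin_cases i <;> simp
  have hI' : ∀ i, ![1, Complex.I, -Complex.I, 1] i * star (![1, Complex.I, -Complex.I, 1] i) = 1 := by
    intro i; fin_cases i <;> simp
  have ht := joined_one_Sp2_diag (diagU_mem_Sp2 (h := hI) (by simp) (by simp)) (by
    intro i
    fin_cases i
    exacts [one_add_I_ne_zero, one_add_I_ne_zero, one_add_neg_I_ne_zero, one_add_neg_I_ne_zero])
  have ht' := joined_one_Sp2_diag (diagU_mem_Sp2 (h := hI') (by simp) (by simp)) (by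
    intro i
    fin_cases i
    exacts [by norm_num, one_add_I_ne_zero, one_add_neg_I_ne_zero, by norm_num])
  -- The diagonal elements `-1` and `diag(1, -1, -1, 1)` have eigenvalue `-1` and escape the Cayley
  -- path; their square roots `s` and `s'` do not.
  generalize hs : (⟨diagU _ hI, _⟩ : Sp2) = s at ht
  generalize hs' : (⟨diagU _ hI', _⟩ : Sp2) = s' at ht'
  have e : (((s * s : Sp2) : U 4) : Mat 4) = -1 := by
    rw [← hs]
    change Matrix.diagonal _ * Matrix.diagonal _ = _
    rw [Matrix.diagonal_mul_diagonal, ← Matrix.diagonal_one, Matrix.diagonal_neg]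
    congr 1; funext i; fin_cases i <;> simp
  have e' : (((s' * s' : Sp2) : U 4) : Mat 4) = diagonal ![1, -1, -1, 1] := by
    rw [← hs']
    change Matrix.diagonal _ * Matrix.diagonal _ = _
    rw [Matrix.diagonal_mul_diagonal]
    congr 1; funext i; fin_cases i <;> simp
  have j := joined_one_mul ht ht
  have j' := joined_one_mul ht' ht'
  by_contra hu
  have key : ∀ w : Sp2, Joined 1 w → (1 + ((w : U 4) : Mat 4) * ((u : U 4) : Mat 4)).det = 0 :=
    fun w hw => by
      by_contra h
      exact hu (joined_one_of_mul hw (joined_one_Sp2 (w * u) h))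
  have h1 := key 1 (Joined.refl 1)
  have h2 := key _ j
  have h3 := key _ j'
  have h4 := key _ (joined_one_mul j j')
  have e1 : (((s * s * (s' * s') : Sp2) : U 4) : Mat 4) = -diagonal ![1, -1, -1, 1] := by
    change (((s * s : Sp2) : U 4) : Mat 4) * (((s' * s' : Sp2) : U 4) : Mat 4) = _
    rw [e, e', neg_mul, one_mul]
  rw [e] at h2
  rw [e'] at h3
  rw [e1] at h4
  have h := sum_det_one_add ((u : U 4) : Mat 4)
  have hd : ((u : U 4) : Mat 4).det = 1 := Sp2_le_SU4 u.2
  obtain ⟨u1, u2, u3, u4⟩ := Sp2_apply u.2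
  rw [neg_mul, ← sub_eq_add_neg] at h2 h4
  rw [one_mul] at h2
  have h1' : (1 + ((u : U 4) : Mat 4)).det = 0 := by simpa using h1
  rw [h1', h2, h3, h4, hd, u1, u2, u3, u4] at h
  have h' := congrArg Complex.re h
  simp at h'
  nlinarith [sq_nonneg (((u : U 4) : Mat 4) 0 0).re, sq_nonneg (((u : U 4) : Mat 4) 0 0).im,
    sq_nonneg (((u : U 4) : Mat 4) 0 3).re, sq_nonneg (((u : U 4) : Mat 4) 0 3).im,
    sq_nonneg (((u : U 4) : Mat 4) 1 1).re, sq_nonneg (((u : U 4) : Mat 4) 1 1).im,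
    sq_nonneg (((u : U 4) : Mat 4) 1 2).re, sq_nonneg (((u : U 4) : Mat 4) 1 2).im]

/-- The same trick with the scalars `iⁿ`: summing `det (1 + iⁿ u)` over the four fourth roots of
unity kills the middle coefficients and leaves `4 (1 + det u) = 8`. -/
theorem joined_one_unitary (u : (⊤ : Subgroup (U 4))) (hd : ((u : U 4) : Mat 4).det = 1) :
    Joined 1 u := by
  have hM : ∀ v : (⊤ : Subgroup (U 4)), (1 + ((v : U 4) : Mat 4)).det ≠ 0 → Joined 1 v :=
    fun v hv => joined_one_of_det_ne_zero v hv fun _ _ _ _ => Subgroup.mem_top _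
  obtain ⟨t, ht⟩ : ∃ t : (⊤ : Subgroup (U 4)), ((t : U 4) : Mat 4) = Complex.I • (1 : Mat 4) :=
    ⟨⟨⟨Complex.I • (1 : Mat 4), by simp [Matrix.mem_unitaryGroup_iff, smul_smul]⟩,
      Subgroup.mem_top _⟩, rfl⟩
  have jt : Joined 1 t := hM t <| by
    rw [ht, show (1 : Mat 4) + Complex.I • (1 : Mat 4) = (1 + Complex.I) • (1 : Mat 4) by module,
      Matrix.det_smul, Matrix.det_one, mul_one]
    exact pow_ne_zero _ one_add_I_ne_zero
  by_contra hu
  have key : ∀ n : ℕ, (1 + (Complex.I ^ n) • ((u : U 4) : Mat 4)).det = 0 := by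
    intro n
    by_contra h
    have j : Joined 1 (t ^ n) := joined_one_pow jt n
    have e : (((t ^ n : (⊤ : Subgroup (U 4))) : U 4) : Mat 4) = (Complex.I ^ n) • (1 : Mat 4) := by
      simp [ht, smul_pow]
    refine hu (joined_one_of_mul j (hM _ ?_))
    change (1 + (((t ^ n : (⊤ : Subgroup (U 4))) : U 4) : Mat 4) * ((u : U 4) : Mat 4)).det ≠ 0
    rw [e, smul_one_mul]
    exact h
  obtain ⟨p, q, r, h⟩ := det_one_add_smul ((u : U 4) : Mat 4)
  have h0 := key 0
  have h1 := key 1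
  have h2 := key 2
  have h3 := key 3
  rw [h, hd] at h0 h1 h2 h3
  have I2 := Complex.I_sq
  have I3 : Complex.I ^ 3 = -Complex.I := Complex.I_pow_three
  have I4 : Complex.I ^ 4 = 1 := Complex.I_pow_four
  have : (8 : ℂ) = 0 := by
    simp only [I2, I3, pow_one, pow_zero, neg_sq, I4, Even.neg_pow (n := 4) (by decide)] at h0 h1 h2 h3
    linear_combination h0 + h1 + h2 + h3 + r * Complex.I * I2
  norm_num at this

theorem star_det_mul_det {N : ℕ} (u : U N) : star (u : Mat N).det * (u : Mat N).det = 1 := by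
  rw [← Matrix.det_conjTranspose, ← Matrix.det_mul, ← Matrix.star_eq_conjTranspose]
  simp

/-- Rescaling the first row of a unitary matrix to make its determinant `1`. -/
noncomputable def retractSU4 (u : (⊤ : Subgroup (U 4))) : SU4 :=
  ⟨diagU ![star ((u : U 4) : Mat 4).det, 1, 1, 1] (by
    have h := star_det_mul_det (u : U 4)
    intro i; fin_cases i <;> simp
    simpa using h) * u, by
    change (Matrix.diagonal ![star ((u : U 4) : Mat 4).det, 1, 1, 1] * ((u : U 4) : Mat 4)).det = 1
    rw [Matrix.det_mul, Matrix.det_diagonal, Fin.prod_univ_four]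
    simpa using star_det_mul_det (u : U 4)⟩

theorem continuous_retractSU4 : Continuous retractSU4 := by
  have h : Continuous fun u : (⊤ : Subgroup (U 4)) => ((u : U 4) : Mat 4) :=
    continuous_subtype_val.comp continuous_subtype_val
  have h' : Continuous fun u : (⊤ : Subgroup (U 4)) =>
      Matrix.diagonal ![star ((u : U 4) : Mat 4).det, 1, 1, 1] := by
    refine Continuous.matrix_diagonal (continuous_pi fun i => ?_)
    fin_cases i
    exacts [h.matrix_det.star, continuous_const, continuous_const, continuous_const]
  exact ((h'.mul h).subtype_mk _).subtype_mk _

/-- The path found in `U(4)` is pushed into `SU(4)` by a continuous retraction that fixes both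
endpoints. -/
theorem joined_one_of_mem_SU4 (u : SU4) : Joined 1 u := by
  have h := (joined_one_unitary ⟨u, Subgroup.mem_top _⟩ u.2).map continuous_retractSU4
  have e : ∀ v : SU4, retractSU4 ⟨v, Subgroup.mem_top _⟩ = v := by
    intro v
    have hv : ((v : U 4) : Mat 4).det = 1 := v.2
    refine Subtype.ext (Subtype.ext ?_)
    change Matrix.diagonal ![star ((v : U 4) : Mat 4).det, 1, 1, 1] * ((v : U 4) : Mat 4) = _
    rw [hv]
    ext i j
    rw [Matrix.diagonal_mul]
    fin_cases i <;> simp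
  have e1 := e 1
  rw [e] at h
  rwa [show retractSU4 1 = 1 from e 1] at h

instance : ConnectedSpace Sp2 := by
  have : PathConnectedSpace Sp2 :=
    ⟨⟨1⟩, fun x y => (joined_one_of_mem_Sp2 x).symm.trans (joined_one_of_mem_Sp2 y)⟩
  infer_instance

instance : ConnectedSpace SU4 := by
  have : PathConnectedSpace SU4 :=
    ⟨⟨1⟩, fun x y => (joined_one_of_mem_SU4 x).symm.trans (joined_one_of_mem_SU4 y)⟩
  infer_instance

theorem connectedSpace_cosetSpace {N : ℕ} (G L : Subgroup (U N)) [ConnectedSpace G] :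
    ConnectedSpace (CosetSpace G L) :=
  Quotient.instConnectedSpace

/-! ## The homogeneous space `SU(4)/SU(2)` -/

theorem baseSpace_le : baseSpace ≤ isotropy negKilling4 SU4 SU2 :=
  inf_le_inf_left _ (LinearMap.BilinForm.orthogonal_le SU2_le_alg)

theorem fibSpace_sup_baseSpace :
    fibSpace ⊔ baseSpace = isotropy negKilling4 SU4 SU2 := by
  refine le_antisymm (sup_le fibSpace_le baseSpace_le) fun X hX => ?_
  obtain ⟨a, b, z, w, c, d, r, z', w', rfl⟩ := exists_spMat_add_asMat hX.1
  have e := spMat_eq_rhoMat_add_fibMat a b z w c d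
  have h : ∀ A : Mat 4, A ∈ lieAlg SU2 → ∀ B : Mat 4, B ∈ fibSpace → ∀ C : Mat 4, C ∈ baseSpace →
      A + B + C ∈ isotropy negKilling4 SU4 SU2 → A + B + C ∈ fibSpace ⊔ baseSpace := by
    intro A hA B hB C hC h
    have h' := h.2
    rw [add_assoc] at h' ⊢
    rw [isBackground_negKilling4.eq_of_orthogonal (SU2_le_alg.trans Sp2_le_alg) hA
      (add_mem hB.2 (baseSpace_le hC).2) h']
    exact Submodule.add_mem_sup hB hC
  rw [e] at hX ⊢
  exact h _ (rhoMat_mem _ _) _ (fibMat_mem ..) _ (asMat_mem_baseSpace ..) hX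

theorem lieAlg_Sp2 : lieAlg Sp2 = lieAlg SU2 ⊔ fibSpace := by
  refine le_antisymm (fun X hX => ?_) (sup_le SU2_le_alg inf_le_left)
  obtain ⟨a, b, z, w, c, d, rfl⟩ := exists_spMat hX
  rw [spMat_eq_rhoMat_add_fibMat]
  exact Submodule.add_mem_sup (rhoMat_mem _ _) (fibMat_mem ..)

theorem disjoint_fibSpace_baseSpace : Disjoint fibSpace baseSpace :=
  Submodule.disjoint_def.2 fun X h₁ h₂ => isBackground_negKilling4.eq_zero h₂.1
    (LinearMap.BilinForm.mem_orthogonal_iff.1 h₂.2 X h₁.1)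

theorem nonMaximalTwoSummand_SU4 :
    NonMaximalTwoSummand SU4 Sp2 SU2 negKilling4 fibSpace baseSpace where
  closed_G := isClosed_SU4
  closed_H := isClosed_Sp2
  closed_K := isClosed_SU2
  K_le_H := SU2_le_Sp2
  H_le_G := Sp2_le_SU4
  connected_total := connectedSpace_cosetSpace SU4 SU2
  connected_fibre := connectedSpace_cosetSpace Sp2 SU2
  background := isBackground_negKilling4
  disjoint := disjoint_fibSpace_baseSpace
  sum := fibSpace_sup_baseSpace
  irreducible₁ := fibSpace_irreducible
  irreducible₂ := baseSpace_irreducible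
  inequivalent := not_adEquivalent
  lieAlg_H := lieAlg_Sp2
  structureConstant_pos := ⟨fibMat 1 0 0 0, fibMat_mem .., asMat 0 1 0, asMat_mem_baseSpace ..,
    asMat 0 Complex.I 0, asMat_mem_baseSpace .., by
      rw [comm_fibMat_asMat, negKilling4_asMat]; simp⟩

end HRF

theorem mainTheorem6 :
    (∀ (N : ℕ) (G H K : Subgroup (HRF.U N)) (Q : LinearMap.BilinForm ℝ (HRF.Mat N))
        (p₁ p₂ : Submodule ℝ (HRF.Mat N)) (h : HRF.NonMaximalTwoSummand G H K Q p₁ p₂),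
      (¬ ∃ g : LinearMap.BilinForm ℝ (HRF.isotropy Q G K),
          HRF.IsEinstein K (HRF.isotropy Q G K) g) →
        HRF.NoAncientSolution K (HRF.isotropy Q G K) ∧
        HRF.EverySolutionCollapses G H K h.le₁ h.le₂) ∧
    (∃ (p₁ p₂ : Submodule ℝ (HRF.Mat 4))
        (h : HRF.NonMaximalTwoSummand HRF.SU4 HRF.Sp2 HRF.SU2 HRF.negKilling4 p₁ p₂),
      (¬ ∃ g : LinearMap.BilinForm ℝ (HRF.isotropy HRF.negKilling4 HRF.SU4 HRF.SU2),
          HRF.IsEinstein HRF.SU2 (HRF.isotropy HRF.negKilling4 HRF.SU4 HRF.SU2) g) ∧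
        HRF.NoAncientSolution HRF.SU2 (HRF.isotropy HRF.negKilling4 HRF.SU4 HRF.SU2) ∧
        HRF.EverySolutionCollapses HRF.SU4 HRF.Sp2 HRF.SU2 h.le₁ h.le₂) := by
  refine ⟨fun N G H K Q p₁ p₂ h hE => h.noAncientSolution_and_everySolutionCollapses hE,
    HRF.fibSpace, HRF.baseSpace, HRF.nonMaximalTwoSummand_SU4, ?_⟩
  have hE : ¬ ∃ g : LinearMap.BilinForm ℝ (HRF.isotropy HRF.negKilling4 HRF.SU4 HRF.SU2),
      HRF.IsEinstein HRF.SU2 (HRF.isotropy HRF.negKilling4 HRF.SU4 HRF.SU2) g :=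
    fun ⟨g, hg⟩ => HRF.not_isEinstein_SU4 HRF.nonMaximalTwoSummand_SU4 g hg
  exact ⟨hE, HRF.nonMaximalTwoSummand_SU4.noAncientSolution_and_everySolutionCollapses hE⟩
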